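/- Let $G:\mathbb{R}\to\mathbb{R}_{\ge 0}$ be such that (1) $G$ is strictly increasing and convex on $[0,\infty)$; (2) $G(0)=0$ and $G(-x)=G(x)$ for all $x$; (3) there is $C_G>0$ with $G(y)/G(x)\le C_G (y/x)^2$ for all $0<x<y$. For $y\in\mathbb{R}^n$ let $\|y\|_G$ be the Orlicz norm: $\|0\|_G=0$, and for $y\ne 0$, $\|y\|_G$ is the unique $\alpha>0$ with $\sum_{i=1}^n G(|y_i|/\alpha)=1$. For integers $n\ge 2$, $d\ge 1$ the random matrix SymSketch $S=\frac{1}{\sqrt{m_2}}\,g\cdot\Phi\Sigma\cdot\widetilde D\in\mathbb{R}^{m_2\times n}$ is defined as follows. Let $t=\lfloor\log_2 n\rfloor$. The matrix $\widetilde D\in\mathbb{R}^{n(t+1)\times n}$ is the vertical stack of $w_0D_0,\dots,w_tD_t$, where $w_i=\|(1,\dots,1,0,\dots,0)\|_G$ (with $2^i$ ones) and $D_i=\mathrm{diag}(z_{i,1},\dots,z_{i,n})$ with $z_{i,j}\sim\mathrm{Ber}(2^{-i})$. The CountSketch matrix $\Phi\Sigma$ is $m_1\times n(t+1)$, where $\Sigma$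 is diagonal with uniform $\pm1$ entries and each column of $\Phi$ has a single $1$, in a uniformly random row, and zeros elsewhere. The matrix $g\in\mathbb{R}^{m_2\times m_1}$ has standard Gaussian entries. All random choices are independent, and the law of $S$ does not depend on the matrix $A$ below. The dimensions are $m_1=\Theta(d^2/\varepsilon^2)$ and $m_2=\Theta(d/\varepsilon^2)$ with $\varepsilon=0.1$, i.e. $K_0 d^2/\varepsilon^2\le m_1\le K_1d^2/\varepsilon^2$ and $K_0 d/\varepsilon^2\le m_2\le K_1d/\varepsilon^2$, where $K_0$ is a sufficiently large absolute constant and $K_1\ge K_0$ is any constant; in particular $S$ has $O(d)$ rows. There are absolute constants $K_0,c,C>0$ such that for every such $G$ (with any $C_G$ as in (3)) and every $A\in\mathbb{R}^{n\times d}$, with probability at least $0.9$, for all $x\in\mathbb{R}^d$ simultaneously, $$\frac{c}{\sqrt d\,\log^{3} n}\,\|Ax\|_G\ \le\ \|SAx\|_2\ \le\ C\sqrt{C_G}\,d^2\log^{7/2} n\,\|Ax\|_G .$$ Furthermore, $SA$ can be computed in $\widetilde O(\mathrm{nnz}(A)+\mathrm{poly}(d))$ time, where $\mathrm{nnz}(A)$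 is the number of nonzero entries of $A$. Precisely: there is one program for the unit-cost real RAM (with the operations $+,-,\times$ on reals and $+,-,<$ on indices) which, given the list of the nonzero entries of $A$ in any order and $S$ in factored form (the weights $w_i$, the matrix $\widetilde D$ in sparse column format, the buckets and signs of the CountSketch matrix, the entries of the Gaussian matrix), always outputs $SA$; for some $B$ and $k$ depending only on $K_1$, the number of its steps is always at most $B(\mathrm{nnz}(A)\log n+d^k)$, and its expectation over $S$ is at most $B(\mathrm{nnz}(A)+d^k)$. -/

import Mathlib

open MeasureTheory ProbabilityTheory
open scoped ENNReal

/-! ### Orlicz norms -/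

/-- The standing assumption on `G`, with growth constant `C`. (Together the fields force
`0 ≤ G`.) -/
structure OrliczAssumption (G : ℝ → ℝ) (C : ℝ) : Prop where
  strictMono : StrictMonoOn G (Set.Ici 0)
  convex : ConvexOn ℝ (Set.Ici 0) G
  map_zero : G 0 = 0
  even : ∀ x : ℝ, G (-x) = G x
  const_pos : 0 < C
  growth : ∀ x y : ℝ, 0 < x → x < y → G y / G x ≤ C * (y / x) ^ 2

open Classical in
/-- The Orlicz norm on `ℝⁿ`: `0` at the zero vector, and otherwise the unique `α > 0` with
`∑ i, G (|y i| / α) = 1`; see `orliczNorm_unique`. -/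
noncomputable def orliczNorm (G : ℝ → ℝ) {n : ℕ} (y : Fin n → ℝ) : ℝ :=
  if y = 0 then 0 else sInf {α : ℝ | 0 < α ∧ ∑ i, G (|y i| / α) = 1}

theorem orlicz_existsUnique {G : ℝ → ℝ} {C : ℝ} (hG : OrliczAssumption G C) {n : ℕ}
    {y : Fin n → ℝ} (hy : y ≠ 0) : ∃! α : ℝ, 0 < α ∧ ∑ i, G (|y i| / α) = 1 := by
  have hnn : ∀ x : ℝ, 0 ≤ x → 0 ≤ G x := fun x hx => by
    have := hG.strictMono.monotoneOn (Set.mem_Ici.2 le_rfl) (Set.mem_Ici.2 hx) hx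
    rwa [hG.map_zero] at this
  obtain ⟨i₀, hi₀⟩ : ∃ i, y i ≠ 0 := Function.ne_iff.1 hy
  set h : ℝ → ℝ := fun s => ∑ i, G (|y i| * s) with hh
  have hmono : StrictMonoOn h (Set.Ici 0) := by
    intro a ha b hb hab
    refine Finset.sum_lt_sum (fun i _ => ?_) ⟨i₀, Finset.mem_univ _, ?_⟩
    · exact hG.strictMono.monotoneOn (Set.mem_Ici.2 (mul_nonneg (abs_nonneg _) ha))
        (Set.mem_Ici.2 (mul_nonneg (abs_nonneg _) hb))
        (mul_le_mul_of_nonneg_left hab.le (abs_nonneg _))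
    · exact hG.strictMono (Set.mem_Ici.2 (mul_nonneg (abs_nonneg _) ha))
        (Set.mem_Ici.2 (mul_nonneg (abs_nonneg _) hb))
        (mul_lt_mul_of_pos_left hab (abs_pos.2 hi₀))
  have h0 : h 0 = 0 := by simp [hh, hG.map_zero]
  have h1 : 0 < h 1 := by
    rw [← h0]; exact hmono (Set.mem_Ici.2 le_rfl) (Set.mem_Ici.2 zero_le_one) zero_lt_one
  have hstar : ∀ x r : ℝ, 0 ≤ x → 0 ≤ r → r ≤ 1 → G (r * x) ≤ r * G x := by
    intro x r hx hr hr1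
    have := hG.convex.2 (Set.mem_Ici.2 hx) (Set.mem_Ici.2 le_rfl) hr (sub_nonneg.2 hr1)
      (by ring)
    simpa [hG.map_zero] using this
  have hGc : ContinuousOn G (Set.Ioi 0) :=
    (hG.convex.subset Set.Ioi_subset_Ici_self (convex_Ioi 0)).continuousOn isOpen_Ioi
  have hc : ContinuousOn h (Set.Ioi 0) := by
    refine continuousOn_finsetSum _ (fun i _ => ?_)
    by_cases hyi : y i = 0
    · simp only [hyi, abs_zero, zero_mul]; exact continuousOn_const
    · exact hGc.comp (by fun_prop) (fun s hs => mul_pos (abs_pos.2 hyi) hs)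
  set a : ℝ := min 1 (1 / h 1)
  set b : ℝ := max 1 (1 / h 1)
  have ha : 0 < a := lt_min one_pos (by positivity)
  have hab : a ≤ b := (min_le_left _ _).trans (le_max_left _ _)
  have hb : 0 < b := ha.trans_le hab
  have hla : h a ≤ 1 := by
    have : h a ≤ a * h 1 := by
      simp only [hh, Finset.mul_sum]
      refine Finset.sum_le_sum (fun i _ => ?_)
      have := hstar (|y i| * 1) a (by positivity) ha.le (min_le_left _ _)
      rw [mul_one, mul_comm a] at this
      rwa [mul_one]
    refine this.trans ((mul_le_mul_of_nonneg_right (min_le_right _ _) h1.le).trans ?_)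
    rw [one_div, inv_mul_cancel₀ h1.ne']
  have hlb : 1 ≤ h b := by
    have : b⁻¹ * h b ≥ h 1 := by
      simp only [hh, Finset.mul_sum]
      refine Finset.sum_le_sum (fun i _ => ?_)
      have := hstar (|y i| * b) b⁻¹ (by positivity) (by positivity)
        (inv_le_one_of_one_le₀ (le_max_left _ _))
      have e : b⁻¹ * (|y i| * b) = |y i| * 1 := by field_simp
      rwa [e] at this
    have h2 : b * h 1 ≤ h b := by
      have := mul_le_mul_of_nonneg_left this hb.le
      rwa [← mul_assoc, mul_inv_cancel₀ hb.ne', one_mul] at this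
    refine le_trans ?_ h2
    calc (1 : ℝ) = 1 / h 1 * h 1 := by field_simp
      _ ≤ b * h 1 := mul_le_mul_of_nonneg_right (le_max_right _ _) h1.le
  obtain ⟨s, hs, hs1⟩ := intermediate_value_Icc hab
    (hc.mono (fun x hx => ha.trans_le hx.1)) (show (1 : ℝ) ∈ Set.Icc (h a) (h b) from ⟨hla, hlb⟩)
  have hs0 : 0 < s := ha.trans_le hs.1
  refine ⟨s⁻¹, ⟨by positivity, ?_⟩, ?_⟩
  · simpa only [div_inv_eq_mul] using hs1
  · rintro α ⟨hα, hα1⟩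
    have : h α⁻¹ = h s := by rw [hs1, ← hα1]; simp only [hh, div_eq_mul_inv]
    have := hmono.injOn (Set.mem_Ici.2 (inv_nonneg.2 hα.le)) (Set.mem_Ici.2 hs0.le) this
    rw [← this, inv_inv]

/-- For nonzero `y`, the value `orliczNorm G y` is the unique positive solution of the defining
equation. -/
theorem orliczNorm_unique {G : ℝ → ℝ} {C : ℝ} (hG : OrliczAssumption G C) {n : ℕ}
    {y : Fin n → ℝ} (hy : y ≠ 0) (α : ℝ) :
    (0 < α ∧ ∑ i, G (|y i| / α) = 1) ↔ α = orliczNorm G y := by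
  obtain ⟨β, hβ, hu⟩ := orlicz_existsUnique hG hy
  have hset : {α : ℝ | 0 < α ∧ ∑ i, G (|y i| / α) = 1} = {β} :=
    Set.eq_singleton_iff_unique_mem.2 ⟨hβ, fun γ hγ => hu γ hγ⟩
  have : orliczNorm G y = β := by rw [orliczNorm, if_neg hy, hset, csInf_singleton]
  rw [this]
  exact ⟨fun h => hu α h, fun h => h ▸ hβ⟩

/-! ### The sketch -/

/-- The number `t = ⌊log₂ n⌋`: the levels are `0, 1, …, t`. -/
def numLevels (n : ℕ) : ℕ := Nat.log 2 n

/-- The weight `w_i = ‖(1, …, 1, 0, …, 0)‖_G` (with `2 ^ i` ones) of level `i`. -/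
noncomputable def levelWeight (G : ℝ → ℝ) (n i : ℕ) : ℝ :=
  orliczNorm G (fun j : Fin n => if j.val < 2 ^ i then (1 : ℝ) else 0)

/-- The random choices made by the sketch: the sampling bits `z i j`; for each of the `n (t + 1)`
columns of the CountSketch matrix its bucket and its sign; the entries of the Gaussian matrix
before normalization. -/
abbrev SketchSample (n m₁ m₂ : ℕ) : Type :=
  (Fin (numLevels n + 1) → Fin n → Bool) ×
  (Fin (numLevels n + 1) × Fin n → Fin m₁) ×
  (Fin (numLevels n + 1) × Fin n → ℝ) ×
  (Fin m₂ → Fin m₁ → ℝ)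

/-- The probability `1 / 2 ^ i`. -/
noncomputable def levelProb (i : ℕ) : unitInterval :=
  ⟨1 / 2 ^ i, by positivity, by
    rw [div_le_one (by positivity)]; exact one_le_pow₀ (by norm_num)⟩

/-- The law of the random choices. All of them are independent; `z i j` is Bernoulli with
parameter `1 / 2 ^ i`, buckets are uniform, signs are `1` or `-1` with probability `1 / 2` each,
and the Gaussian matrix has standard normal entries. -/
noncomputable def sketchLaw (n m₁ m₂ : ℕ) : Measure (SketchSample n m₁ m₂) :=
  (Measure.pi fun i : Fin (numLevels n + 1) => Measure.pi fun _ : Fin n =>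
      bernoulliMeasure true false (levelProb i.val)).prod
  ((Measure.pi fun _ : Fin (numLevels n + 1) × Fin n => uniformOn (Set.univ : Set (Fin m₁))).prod
  ((Measure.pi fun _ : Fin (numLevels n + 1) × Fin n =>
      bernoulliMeasure (1 : ℝ) (-1) (levelProb 1)).prod
  (Measure.pi fun _ : Fin m₂ => Measure.pi fun _ : Fin m₁ => gaussianReal 0 1)))

/-- `D_i = diag (z i 1, …, z i n)`. -/
def samplingMatrix {n : ℕ} (z : Fin n → Bool) : Matrix (Fin n) (Fin n) ℝ :=
  Matrix.diagonal fun j => if z j then 1 else 0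

/-- The blocks `w_i D_i`, for `i = 0, …, t`, stacked on top of each other; the row `(i, j)` is row
`j` of block `i`. -/
noncomputable def stackedMatrix (G : ℝ → ℝ) {n : ℕ}
    (z : Fin (numLevels n + 1) → Fin n → Bool) :
    Matrix (Fin (numLevels n + 1) × Fin n) (Fin n) ℝ :=
  Matrix.of fun p j => (levelWeight G n p.1.val • samplingMatrix (z p.1)) p.2 j

/-- The CountSketch matrix `Φ * diag σ`, where `Φ (h i) i = 1` and the other entries of `Φ`
are `0`. -/
def countSketch {ι : Type} [Fintype ι] [DecidableEq ι] {m : ℕ} (h : ι → Fin m) (σ : ι → ℝ) :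
    Matrix (Fin m) ι ℝ :=
  (Matrix.of fun b i => if h i = b then (1 : ℝ) else 0) * Matrix.diagonal σ

/-- The Gaussian embedding `(1 / √m₂) g`. -/
noncomputable def gaussianEmbedding {m₂ m₁ : ℕ} (g : Fin m₂ → Fin m₁ → ℝ) :
    Matrix (Fin m₂) (Fin m₁) ℝ :=
  (1 / Real.sqrt (m₂ : ℝ)) • Matrix.of g

/-- The sketch `S = (Gaussian embedding) * CountSketch * D̃`, as a function of the random
choices. -/
noncomputable def symSketch (G : ℝ → ℝ) {n m₁ m₂ : ℕ} (ω : SketchSample n m₁ m₂) :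
    Matrix (Fin m₂) (Fin n) ℝ :=
  gaussianEmbedding ω.2.2.2 * countSketch ω.2.1 ω.2.2.1 * stackedMatrix G ω.1

/-- The Euclidean norm on `ℝᵐ`. -/
noncomputable def l2norm {m : ℕ} (v : Fin m → ℝ) : ℝ := Real.sqrt (∑ i, v i ^ 2)

open Classical in
/-- The number of nonzero entries. -/
noncomputable def nnz {n d : ℕ} (A : Matrix (Fin n) (Fin d) ℝ) : ℕ :=
  (Finset.univ.filter fun p : Fin n × Fin d => A p.1 p.2 ≠ 0).card

/-! ### A real RAM with unit costs

The memory consists of index registers and real registers, and of two-dimensional arrays of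
indices and of reals, addressed through index registers. The operations on indices are the
constants, `+`, truncated `-` and `<`, those on reals the integer constants, `+`, `-` and `*`;
every operation, memory access and evaluation of a test costs one step. -/

structure RamState where
  ireg : ℕ → ℕ
  rreg : ℕ → ℝ
  imem : ℕ → ℕ → ℕ → ℕ
  rmem : ℕ → ℕ → ℕ → ℝ

/-- Programs. Registers and arrays are named by natural numbers that are fixed in the program. -/
inductive Program : Type
  | iconst (x k : ℕ)
  | iadd (x y z : ℕ)
  | isub (x y z : ℕ)
  | iload (x a i j : ℕ)
  | istore (a i j x : ℕ)
  | rconst (x : ℕ) (k : ℤ)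
  | radd (x y z : ℕ)
  | rsub (x y z : ℕ)
  | rmul (x y z : ℕ)
  | rload (x a i j : ℕ)
  | rstore (a i j x : ℕ)
  | seq (p q : Program)
  | ifLt (x y : ℕ) (p q : Program)
  | whileLt (x y : ℕ) (p : Program)

/-- Overwrite the entry `(i, j)` of the array `a`. -/
def writeCell {α : Type} (mem : ℕ → ℕ → ℕ → α) (a i j : ℕ) (v : α) : ℕ → ℕ → ℕ → α :=
  fun a' i' j' => if a' = a ∧ i' = i ∧ j' = j then v else mem a' i' j'

/-- `Exec p s T s'`: started in state `s`, the program `p` halts after exactly `T` steps, in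
state `s'`. -/
inductive Exec : Program → RamState → ℕ → RamState → Prop
  | iconst (x k : ℕ) (s : RamState) :
      Exec (.iconst x k) s 1 { s with ireg := Function.update s.ireg x k }
  | iadd (x y z : ℕ) (s : RamState) :
      Exec (.iadd x y z) s 1 { s with ireg := Function.update s.ireg x (s.ireg y + s.ireg z) }
  | isub (x y z : ℕ) (s : RamState) :
      Exec (.isub x y z) s 1 { s with ireg := Function.update s.ireg x (s.ireg y - s.ireg z) }
  | iload (x a i j : ℕ) (s : RamState) :
      Exec (.iload x a i j) s 1
        { s with ireg := Function.update s.ireg x (s.imem a (s.ireg i) (s.ireg j)) }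
  | istore (a i j x : ℕ) (s : RamState) :
      Exec (.istore a i j x) s 1
        { s with imem := writeCell s.imem a (s.ireg i) (s.ireg j) (s.ireg x) }
  | rconst (x : ℕ) (k : ℤ) (s : RamState) :
      Exec (.rconst x k) s 1 { s with rreg := Function.update s.rreg x (k : ℝ) }
  | radd (x y z : ℕ) (s : RamState) :
      Exec (.radd x y z) s 1 { s with rreg := Function.update s.rreg x (s.rreg y + s.rreg z) }
  | rsub (x y z : ℕ) (s : RamState) :
      Exec (.rsub x y z) s 1 { s with rreg := Function.update s.rreg x (s.rreg y - s.rreg z) }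
  | rmul (x y z : ℕ) (s : RamState) :
      Exec (.rmul x y z) s 1 { s with rreg := Function.update s.rreg x (s.rreg y * s.rreg z) }
  | rload (x a i j : ℕ) (s : RamState) :
      Exec (.rload x a i j) s 1
        { s with rreg := Function.update s.rreg x (s.rmem a (s.ireg i) (s.ireg j)) }
  | rstore (a i j x : ℕ) (s : RamState) :
      Exec (.rstore a i j x) s 1
        { s with rmem := writeCell s.rmem a (s.ireg i) (s.ireg j) (s.rreg x) }
  | seq {p q : Program} {s s₁ s₂ : RamState} {T₁ T₂ : ℕ} :
      Exec p s T₁ s₁ → Exec q s₁ T₂ s₂ → Exec (.seq p q) s (T₁ + T₂) s₂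
  | if_true {x y : ℕ} {p q : Program} {s s₁ : RamState} {T : ℕ} :
      s.ireg x < s.ireg y → Exec p s T s₁ → Exec (.ifLt x y p q) s (T + 1) s₁
  | if_false {x y : ℕ} {p q : Program} {s s₁ : RamState} {T : ℕ} :
      ¬ s.ireg x < s.ireg y → Exec q s T s₁ → Exec (.ifLt x y p q) s (T + 1) s₁
  | while_true {x y : ℕ} {p : Program} {s s₁ s₂ : RamState} {T₁ T₂ : ℕ} :
      s.ireg x < s.ireg y → Exec p s T₁ s₁ → Exec (.whileLt x y p) s₁ T₂ s₂ →
      Exec (.whileLt x y p) s (T₁ + 1 + T₂) s₂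
  | while_false {x y : ℕ} {p : Program} {s : RamState} :
      ¬ s.ireg x < s.ireg y → Exec (.whileLt x y p) s 1 s

/-- Runs are deterministic, so that "the" number of steps makes sense. -/
theorem Exec.unique {p : Program} {s s₁ s₂ : RamState} {T₁ T₂ : ℕ}
    (h₁ : Exec p s T₁ s₁) (h₂ : Exec p s T₂ s₂) : T₁ = T₂ ∧ s₁ = s₂ := by
  induction h₁ generalizing T₂ s₂ with
  | seq _ _ ih₁ ih₂ =>
    cases h₂ with
    | seq a b => obtain ⟨rfl, rfl⟩ := ih₁ a; obtain ⟨rfl, rfl⟩ := ih₂ b; exact ⟨rfl, rfl⟩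
  | if_true hc _ ih =>
    cases h₂ with
    | if_true _ a => obtain ⟨rfl, rfl⟩ := ih a; exact ⟨rfl, rfl⟩
    | if_false hn _ => exact absurd hc hn
  | if_false hc _ ih =>
    cases h₂ with
    | if_true hn _ => exact absurd hn hc
    | if_false _ a => obtain ⟨rfl, rfl⟩ := ih a; exact ⟨rfl, rfl⟩
  | while_true hc _ _ ih₁ ih₂ =>
    cases h₂ with
    | while_true _ a b => obtain ⟨rfl, rfl⟩ := ih₁ a; obtain ⟨rfl, rfl⟩ := ih₂ b; exact ⟨rfl, rfl⟩
    | while_false hn => exact absurd hc hn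
  | while_false hc =>
    cases h₂ with
    | while_true hn _ _ => exact absurd hn hc
    | while_false _ => exact ⟨rfl, rfl⟩
  | _ => cases h₂; exact ⟨rfl, rfl⟩

/-! ### Input format -/

/-- The levels `i`, in increasing order, such that column `j` of the stacked matrix has a nonzero
entry in block `i`. -/
def activeLevels {n : ℕ} (z : Fin (numLevels n + 1) → Fin n → Bool) (j : Fin n) :
    List (Fin (numLevels n + 1)) :=
  (List.finRange (numLevels n + 1)).filter fun i => z i j

/-- The value of a function on `Fin a`, extended by a default value. -/
def lookup {α : Type} {a : ℕ} (f : Fin a → α) (dflt : α) (i : ℕ) : α :=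
  if h : i < a then f ⟨i, h⟩ else dflt

/-- The input of the computation of `S * A`. The matrix `A` is given by the list `L` of the
positions of its nonzero entries, with the values there. The matrix `S` is given through its
factors: the stacked matrix sparsely by columns (for every column the number of its nonzero
entries and the list of the blocks in which they stand, together with the weights `w_i`); the
CountSketch matrix by its buckets and signs; the Gaussian embedding by its entries. All other cells
contain `0`. -/
noncomputable def initialState (G : ℝ → ℝ) {n d m₁ m₂ : ℕ} (A : Matrix (Fin n) (Fin d) ℝ)
    (L : List (Fin n × Fin d)) (ω : SketchSample n m₁ m₂) : RamState where
  ireg x := match x with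
    | 0 => L.length
    | 1 => n
    | 2 => d
    | 3 => m₁
    | 4 => m₂
    | 5 => numLevels n
    | _ => 0
  rreg _ := 0
  imem a i j := match a with
    -- row and column of the entry number `i` of the list
    | 0 => lookup (fun k => (L.get k).1.val) 0 i
    | 1 => lookup (fun k => (L.get k).2.val) 0 i
    -- number of nonzero entries of column `i`, and the block of the `j`-th of them
    | 2 => lookup (fun c => (activeLevels ω.1 c).length) 0 i
    | 3 => lookup (fun c => lookup (fun k => ((activeLevels ω.1 c).get k).val) 0 j) 0 i
    -- bucket of the CountSketch column `(i, j)`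
    | 4 => lookup (fun l => lookup (fun c => (ω.2.1 (l, c)).val) 0 j) 0 i
    | _ => 0
  rmem a i j := match a with
    -- value of the entry number `i` of the list
    | 0 => lookup (fun k => A (L.get k).1 (L.get k).2) 0 i
    -- weight of level `i`
    | 1 => lookup (fun l : Fin (numLevels n + 1) => levelWeight G n l.val) 0 i
    -- sign of the CountSketch column `(i, j)`
    | 2 => lookup (fun l => lookup (fun c => ω.2.2.1 (l, c)) 0 j) 0 i
    -- entry `(i, j)` of the Gaussian embedding
    | 3 => lookup (fun r => lookup (fun b => gaussianEmbedding ω.2.2.2 r b) 0 j) 0 i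
    | _ => 0

/-- In state `s`, the real array number `4` contains the matrix `M`. -/
def HasOutput {m d : ℕ} (s : RamState) (M : Matrix (Fin m) (Fin d) ℝ) : Prop :=
  ∀ (r : Fin m) (c : Fin d), s.rmem 4 r.val c.val = M r c

/-! ### The program -/

/-! Write `l` for the number `t + 1` of levels. Of the weights only `w_i > 0` and `2 ^ i * G (1 /
w_i) = 1` matter (`levelWeight_spec`). The two distortion bounds are proved separately, for squared
norms and in terms of `l`; both come out stronger than required, and `distortion_of_sq` gives the
slack away.

Contraction. Let `y` be in the column space with `∑ G |y j| = 1`. A dyadic pigeonhole yields `θ`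
such that `U = {j | θ ≤ |y j|}` satisfies `|U| * G (2θ) ≥ 1 / (4l)` (`exists_heavy_superlevel`). By
convexity `w_i θ ≥ 2 ^ i / (8 l |U|)` at every level with `2 ^ i ≤ |U|`. Take the level at which
between `Λ` and `2Λ` points of `U` are expected to be sampled, `Λ` of order `d * l`, or level `0`,
which keeps everything, if `|U| < Λ`. If at least half of the expected number is sampled, these
points alone give a squared norm of order `1 / (l² Λ)` (`le_sum_sq_stackedMatrix`). Uniformity in
`x` needs no net here: the sampling event depends on `x` only through `U`, and `U` is a union of two
traces of half spaces on the rows of `A`, so Sauer–Shelah leaves at most `(n + 1) ^ (2d)` sets for a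
Chernoff and union bound (`samplingLaw_contraction`). The other two factors are independent of the
sampling and embed the resulting column space, of dimension at most `d`: CountSketch by a second
moment bound on the Gram matrix (`countSketch_contraction`), the Gaussian matrix by chi-square tails
and a net (`gaussianEmbedding_contraction`).

Dilation. An Auerbach basis `u_1, …, u_r` of the column space for the Orlicz norm
(`exists_auerbach`) gives `Ax = ∑ c_k u_k` with `|c_k| ≤ ‖Ax‖_G`, so by Cauchy–Schwarz it suffices
to bound `∑ ‖S u_k‖²` for at most `d` fixed vectors. Coordinates above `T / w_i` could spoil the
second moment at level `i`, but for `T` of order `d * l` they are so few that probably none of them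
is sampled (`samplingLaw_large_le`). For the remaining ones the growth condition bounds the second
moment by `l * C_G * T` (`lintegral_truncatedStack_le`). CountSketch and the Gaussian matrix
preserve expected squared norms, and Markov's inequality finishes.

Running time. The program scatters every nonzero entry of `A` into the buckets of the levels that
sample its row, then does a dense product of size polynomial in `d`. A row is sampled by at most `l`
levels, and by at most `∑ 2 ^ (-i) ≤ 2` in expectation; these are the worst-case and the expected
bound. -/

theorem Exec.cast {p : Program} {s s' : RamState} {T T' : ℕ} (h : Exec p s T s') (e : T = T') :
    Exec p s T' s' := e ▸ h

/-- A `while` loop with an invariant indexed by the number of completed iterations. -/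
theorem Exec.while_invariant {x y : ℕ} {p : Program} (Inv : ℕ → RamState → Prop) (N : ℕ)
    (cost : ℕ → ℕ)
    (step : ∀ k < N, ∀ s, Inv k s → s.ireg x < s.ireg y ∧
      ∃ s', Exec p s (cost k) s' ∧ Inv (k + 1) s')
    (exit : ∀ s, Inv N s → ¬ s.ireg x < s.ireg y) {s : RamState} (h : Inv 0 s) :
    ∃ s', Exec (.whileLt x y p) s (∑ k ∈ Finset.range N, (cost k + 1) + 1) s' ∧ Inv N s' := by
  -- Induction on the number `m` of remaining iterations, since a run of a loop unfolds at its first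
  -- iteration.
  suffices H : ∀ m k : ℕ, k + m = N → ∀ s, Inv k s →
      ∃ s', Exec (.whileLt x y p) s (∑ j ∈ Finset.range m, (cost (k + j) + 1) + 1) s' ∧
        Inv N s' by
    simpa using H N 0 (by simp) s h
  intro m
  induction m with
  | zero =>
    intro k hk s hs
    obtain rfl : k = N := by simpa using hk
    exact ⟨s, by simpa using Exec.while_false (exit s hs), hs⟩
  | succ m ih =>
    intro k hk s hs
    obtain ⟨hlt, s₁, h₁, i₁⟩ := step k (by omega) s hs
    obtain ⟨s₂, h₂, i₂⟩ := ih (k + 1) (by omega) s₁ i₁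
    refine ⟨s₂, (Exec.while_true hlt h₁ h₂).cast ?_, i₂⟩
    rw [Finset.sum_range_succ']
    simp only [add_zero, add_assoc, add_comm 1]
    ring

/-! ### Symbolic execution of single instructions -/

namespace RamState

/-- Assign to an index register. -/
def setI (s : RamState) (x v : ℕ) : RamState := { s with ireg := Function.update s.ireg x v }

/-- Assign to a real register. -/
def setR (s : RamState) (x : ℕ) (v : ℝ) : RamState :=
  { s with rreg := Function.update s.rreg x v }

/-- Assign to a cell of a real array. -/
def setM (s : RamState) (a i j : ℕ) (v : ℝ) : RamState :=
  { s with rmem := writeCell s.rmem a i j v }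

variable (s : RamState) (x a i j : ℕ) (v : ℕ) (r : ℝ)

@[simp] theorem setI_ireg (y : ℕ) : (s.setI x v).ireg y = if y = x then v else s.ireg y :=
  Function.update_apply _ _ _ _
@[simp] theorem setI_rreg : (s.setI x v).rreg = s.rreg := rfl
@[simp] theorem setI_imem : (s.setI x v).imem = s.imem := rfl
@[simp] theorem setI_rmem : (s.setI x v).rmem = s.rmem := rfl
@[simp] theorem setR_rreg (y : ℕ) : (s.setR x r).rreg y = if y = x then r else s.rreg y :=
  Function.update_apply _ _ _ _
@[simp] theorem setR_ireg : (s.setR x r).ireg = s.ireg := rfl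
@[simp] theorem setR_imem : (s.setR x r).imem = s.imem := rfl
@[simp] theorem setR_rmem : (s.setR x r).rmem = s.rmem := rfl
@[simp] theorem setM_ireg : (s.setM a i j r).ireg = s.ireg := rfl
@[simp] theorem setM_rreg : (s.setM a i j r).rreg = s.rreg := rfl
@[simp] theorem setM_imem : (s.setM a i j r).imem = s.imem := rfl
theorem setM_rmem (a' i' j' : ℕ) : (s.setM a i j r).rmem a' i' j' =
    if a' = a ∧ i' = i ∧ j' = j then r else s.rmem a' i' j' := rfl
theorem setM_rmem_of_ne {a' : ℕ} (h : a' ≠ a) : (s.setM a i j r).rmem a' = s.rmem a' := by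
  funext i' j'
  rw [setM_rmem, if_neg (fun hh => h hh.1)]

end RamState

namespace Exec

variable {s : RamState} {x y z a i j v : ℕ} {r : ℝ}

theorem iconst_set (k : ℕ) : Exec (.iconst x k) s 1 (s.setI x k) := .iconst _ _ _
-- The computed value is a free variable tied down by an equation, so that a chain of instructions
-- can be run with chosen names for the values and the equations settled afterwards.
theorem iadd_set (h : s.ireg y + s.ireg z = v) : Exec (.iadd x y z) s 1 (s.setI x v) :=
  h ▸ .iadd _ _ _ _
theorem iload_set (h : s.imem a (s.ireg i) (s.ireg j) = v) :
    Exec (.iload x a i j) s 1 (s.setI x v) := h ▸ .iload _ _ _ _ _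
theorem rconst_set (k : ℤ) (h : (k : ℝ) = r) : Exec (.rconst x k) s 1 (s.setR x r) :=
  h ▸ .rconst _ _ _
theorem radd_set (h : s.rreg y + s.rreg z = r) : Exec (.radd x y z) s 1 (s.setR x r) :=
  h ▸ .radd _ _ _ _
theorem rmul_set (h : s.rreg y * s.rreg z = r) : Exec (.rmul x y z) s 1 (s.setR x r) :=
  h ▸ .rmul _ _ _ _
theorem rload_set (h : s.rmem a (s.ireg i) (s.ireg j) = r) :
    Exec (.rload x a i j) s 1 (s.setR x r) := h ▸ .rload _ _ _ _ _
theorem rstore_set {i' j' : ℕ} (hi : s.ireg i = i') (hj : s.ireg j = j') (h : s.rreg x = r) :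
    Exec (.rstore a i j x) s 1 (s.setM a i' j' r) := by
  subst hi hj h
  exact .rstore _ _ _ _ _

end Exec

/-- Add the contribution of one block of a sampled row. -/
def scatterStep : Program :=
  .seq (.iload 13 3 9 12) <| .seq (.iload 14 4 13 9) <| .seq (.rload 1 1 13 7) <|
  .seq (.rload 2 2 13 9) <| .seq (.rmul 1 1 2) <| .seq (.rmul 1 1 0) <|
  .seq (.rload 3 5 14 10) <| .seq (.radd 3 3 1) <| .seq (.rstore 5 14 10 3) (.iadd 12 12 6)

/-- Process one nonzero entry of the input matrix. -/
def entryStep : Program :=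
  .seq (.iload 9 0 8 7) <| .seq (.iload 10 1 8 7) <| .seq (.rload 0 0 8 7) <|
  .seq (.iload 11 2 9 7) <| .seq (.iconst 12 0) <|
  .seq (.whileLt 12 11 scatterStep) (.iadd 8 8 6)

/-- Accumulate one product in an inner product. -/
def innerStep : Program :=
  .seq (.rload 5 3 15 17) <| .seq (.rload 6 5 17 16) <| .seq (.rmul 5 5 6) <|
  .seq (.radd 4 4 5) (.iadd 17 17 6)

/-- Compute one entry of the output. -/
def cellStep : Program :=
  .seq (.rconst 4 0) <| .seq (.iconst 17 0) <| .seq (.whileLt 17 3 innerStep) <|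
  .seq (.rstore 4 15 16 4) (.iadd 16 16 6)

/-- Compute one row of the output. -/
def rowStep : Program :=
  .seq (.iconst 16 0) <| .seq (.whileLt 16 2 cellStep) (.iadd 15 15 6)

/-- Multiply the stacked and the CountSketch matrix with the input, entry by entry, and then
multiply the Gaussian matrix with the result. -/
def sketchProgram : Program :=
  .seq (.iconst 6 1) <| .seq (.whileLt 8 0 entryStep) <| .seq (.iconst 15 0)
    (.whileLt 15 4 rowStep)

/-! ### Loop invariants and exact step counts -/

/-- The number of blocks in which the row of entry `e` is sampled. -/
def entryCount (s : RamState) (e : ℕ) : ℕ := s.imem 2 (s.imem 0 e 0) 0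

/-- What the block number `q` of entry `e` contributes to the cell `(b, c)`. -/
noncomputable def entryTerm (s : RamState) (e q b c : ℕ) : ℝ :=
  if b = s.imem 4 (s.imem 3 (s.imem 0 e 0) q) (s.imem 0 e 0) ∧ c = s.imem 1 e 0 then
    s.rmem 1 (s.imem 3 (s.imem 0 e 0) q) 0 *
      s.rmem 2 (s.imem 3 (s.imem 0 e 0) q) (s.imem 0 e 0) * s.rmem 0 e 0
  else 0

/-- The compressed matrix after the first `e` entries. -/
noncomputable def compressed (s : RamState) (e b c : ℕ) : ℝ :=
  ∑ e' ∈ Finset.range e, ∑ q ∈ Finset.range (entryCount s e'), entryTerm s e' q b c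

/-- The part of the memory that the first phase leaves alone. -/
structure FrameEq (s₀ s : RamState) : Prop where
  ireg : ∀ x < 6, s.ireg x = s₀.ireg x
  one : s.ireg 6 = 1
  zero : s.ireg 7 = 0
  imem : s.imem = s₀.imem
  rmem : ∀ a < 4, s.rmem a = s₀.rmem a

/-- Everything is expressed through the initial state `s₀`, whose input arrays never change.
Register `6` holds the constant one, register `7` the constant zero, and real array `5` accumulates
the compressed matrix. -/
structure ScatterInv (s₀ : RamState) (e q : ℕ) (s : RamState) : Prop extends FrameEq s₀ s where
  entry : s.ireg 8 = e
  row : s.ireg 9 = s₀.imem 0 e 0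
  col : s.ireg 10 = s₀.imem 1 e 0
  count : s.ireg 11 = entryCount s₀ e
  idx : s.ireg 12 = q
  val : s.rreg 0 = s₀.rmem 0 e 0
  acc : ∀ b c, s.rmem 5 b c =
    compressed s₀ e b c + ∑ q' ∈ Finset.range q, entryTerm s₀ e q' b c

structure EntryInv (s₀ : RamState) (e : ℕ) (s : RamState) : Prop extends FrameEq s₀ s where
  entry : s.ireg 8 = e
  acc : ∀ b c, s.rmem 5 b c = compressed s₀ e b c

theorem exec_scatterStep {s₀ s : RamState} {e q : ℕ} (h : ScatterInv s₀ e q s) :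
    ∃ s', Exec scatterStep s 10 s' ∧ ScatterInv s₀ e (q + 1) s' := by
  obtain ⟨⟨h1, h2, h3, h4, h5⟩, h6, h7, h8, h9, h10, h11, h12⟩ := h
  have r1 : s.rmem 1 = s₀.rmem 1 := h5 1 (by norm_num)
  have r2 : s.rmem 2 = s₀.rmem 2 := h5 2 (by norm_num)
  set row := s₀.imem 0 e 0 with hrow
  set col := s₀.imem 1 e 0 with hcol
  set l := s₀.imem 3 row q with hl
  set bk := s₀.imem 4 l row with hbk
  set w := s₀.rmem 1 l 0 with hw
  set sg := s₀.rmem 2 l row with hsg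
  refine ⟨_, Exec.seq (.iload_set (v := l) ?_) <| .seq (.iload_set (v := bk) ?_) <|
    .seq (.rload_set (r := w) ?_) <| .seq (.rload_set (r := sg) ?_) <|
    .seq (.rmul_set (r := w * sg) ?_) <|
    .seq (.rmul_set (r := w * sg * s₀.rmem 0 e 0) ?_) <|
    .seq (.rload_set (r := s.rmem 5 bk col) ?_) <|
    .seq (.radd_set (r := s.rmem 5 bk col + w * sg * s₀.rmem 0 e 0) ?_) <|
    .seq (.rstore_set (i' := bk) (j' := col) ?_ ?_ rfl) (.iadd_set (v := q + 1) ?_),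
    ⟨⟨?_, ?_, ?_, ?_, ?_⟩, ?_, ?_, ?_, ?_, ?_, ?_, ?_⟩⟩
  case refine_12 =>
    intro x hx
    rw [← h1 x hx]
    simp only [RamState.setI_ireg, RamState.setR_ireg, RamState.setM_ireg]
    repeat' rw [if_neg (by omega)]
  case refine_16 =>
    intro a ha
    rw [← h5 a ha, RamState.setI_rmem, RamState.setM_rmem_of_ne _ _ _ _ _ (by omega)]
    simp
  case refine_23 =>
    intro b c
    rw [RamState.setI_rmem, RamState.setM_rmem]
    simp only [RamState.setI_rmem, RamState.setR_rmem, RamState.setR_rreg]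
    rw [Finset.sum_range_succ, entryTerm, ← add_assoc, ← h12 b c]
    -- The cell `(bk, col)` is the only one written and the only one at which `entryTerm` can be
    -- nonzero.
    by_cases hc : b = bk ∧ c = col
    · rw [if_pos ⟨trivial, hc.1, hc.2⟩, if_pos hc, hc.1, hc.2]
      simp [hw, hsg, hl, hrow]
    · rw [if_neg (fun h => hc h.2), if_neg hc, add_zero]
  all_goals simp [h2, h3, h4, h6, h7, h8, h9, h10, h11, r1, r2, hrow, hl, hbk, hcol, hw, hsg]

theorem exec_entryStep {s₀ s : RamState} {e : ℕ} (h : EntryInv s₀ e s) :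
    ∃ s', Exec entryStep s (11 * entryCount s₀ e + 7) s' ∧ EntryInv s₀ (e + 1) s' := by
  obtain ⟨⟨h1, h2, h3, h4, h5⟩, h6, h7⟩ := h
  -- Each iteration costs ten instructions and one test; the last `1` is the failing test.
  have key : ∀ s : RamState, ScatterInv s₀ e 0 s → ∃ s',
      Exec (.whileLt 12 11 scatterStep) s (11 * entryCount s₀ e + 1) s' ∧
        ScatterInv s₀ e (entryCount s₀ e) s' := by
    intro s hs
    obtain ⟨s', he, hi⟩ := Exec.while_invariant (x := 12) (y := 11) (p := scatterStep)
      (ScatterInv s₀ e) (entryCount s₀ e)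
      (fun _ => 10) (fun k hk s hs => ⟨by rw [hs.idx, hs.count]; exact hk, exec_scatterStep hs⟩)
      (fun s hs => by rw [hs.idx, hs.count]; exact lt_irrefl _) hs
    exact ⟨s', he.cast (by simp [mul_comm]), hi⟩
  have hr0 : s.rmem 0 = s₀.rmem 0 := h5 0 (by norm_num)
  set s₁ : RamState := ((((s.setI 9 (s₀.imem 0 e 0)).setI 10 (s₀.imem 1 e 0)).setR 0
    (s₀.rmem 0 e 0)).setI 11 (entryCount s₀ e)).setI 12 0 with hs₁
  have hfr : ScatterInv s₀ e 0 s₁ := by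
    refine ⟨⟨?_, ?_, ?_, ?_, ?_⟩, ?_, ?_, ?_, ?_, ?_, ?_, ?_⟩
    · intro x hx
      rw [← h1 x hx]
      simp only [hs₁, RamState.setI_ireg, RamState.setR_ireg]
      repeat' rw [if_neg (by omega)]
    case refine_5 => exact h5
    all_goals simp [hs₁, h2, h3, h4, h6, h7]
  obtain ⟨s₂, he, hi⟩ := key s₁ hfr
  refine ⟨s₂.setI 8 (e + 1), Exec.cast (Exec.seq (.iload_set ?_) <| .seq (.iload_set ?_) <|
      .seq (.rload_set ?_) <| .seq (.iload_set ?_) <| .seq (.iconst_set _) <|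
      .seq he (.iadd_set ?_)) (by ring), ⟨⟨?_, ?_, ?_, hi.imem, hi.rmem⟩, ?_, ?_⟩⟩
  case refine_6 =>
    intro x hx
    rw [← hi.ireg x hx, RamState.setI_ireg, if_neg (by omega)]
  case refine_10 =>
    intro b c
    rw [compressed, Finset.sum_range_succ]
    exact hi.acc b c
  all_goals simp [h3, h4, h6, hr0, entryCount, hi.entry, hi.one, hi.zero]

structure InnerInv (s₀ : RamState) (r c b : ℕ) (out : ℕ → ℕ → ℝ) (s : RamState) : Prop where
  ireg : ∀ x < 6, s.ireg x = s₀.ireg x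
  one : s.ireg 6 = 1
  row : s.ireg 15 = r
  col : s.ireg 16 = c
  idx : s.ireg 17 = b
  gauss : s.rmem 3 = s₀.rmem 3
  comp : s.rmem 5 = compressed s₀ (s₀.ireg 0)
  out : s.rmem 4 = out
  acc : s.rreg 4 =
    ∑ b' ∈ Finset.range b, s₀.rmem 3 r b' * compressed s₀ (s₀.ireg 0) b' c

theorem exec_innerStep {s₀ s : RamState} {r c b : ℕ} {out : ℕ → ℕ → ℝ}
    (h : InnerInv s₀ r c b out s) :
    ∃ s', Exec innerStep s 5 s' ∧ InnerInv s₀ r c (b + 1) out s' := by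
  obtain ⟨h1, h2, h3, h4, h5, h6, h7, h8, h9⟩ := h
  refine ⟨_, Exec.seq (.rload_set rfl) <| .seq (.rload_set rfl) <| .seq (.rmul_set rfl) <|
    .seq (.radd_set rfl) (.iadd_set rfl), ⟨?_, ?_, ?_, ?_, ?_, ?_, ?_, ?_, ?_⟩⟩
  · intro x hx
    rw [← h1 x hx]
    simp only [RamState.setI_ireg, RamState.setR_ireg]
    rw [if_neg (by omega)]
  all_goals simp [h2, h3, h4, h5, h6, h7, h8, h9, Finset.sum_range_succ]

/-- The entry `(r, c)` of the output. -/
noncomputable def outputCell (s : RamState) (r c : ℕ) : ℝ :=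
  ∑ b ∈ Finset.range (s.ireg 3), s.rmem 3 r b * compressed s (s.ireg 0) b c

/-- The output is filled in row-major order, so the finished cells are those lexicographically
before `(r, c)`. -/
structure CellInv (s₀ : RamState) (r c : ℕ) (s : RamState) : Prop where
  ireg : ∀ x < 6, s.ireg x = s₀.ireg x
  one : s.ireg 6 = 1
  row : s.ireg 15 = r
  col : s.ireg 16 = c
  gauss : s.rmem 3 = s₀.rmem 3
  comp : s.rmem 5 = compressed s₀ (s₀.ireg 0)
  out : ∀ r' c', r' < r ∧ c' < s₀.ireg 2 ∨ r' = r ∧ c' < c → s.rmem 4 r' c' = outputCell s₀ r' c'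

theorem exec_cellStep {s₀ s : RamState} {r c : ℕ} (h : CellInv s₀ r c s) :
    ∃ s', Exec cellStep s (6 * s₀.ireg 3 + 5) s' ∧ CellInv s₀ r (c + 1) s' := by
  obtain ⟨h1, h2, h3, h4, h5, h6, h7⟩ := h
  set s₁ : RamState := (s.setR 4 0).setI 17 0
    with hs₁
  have hfr : InnerInv s₀ r c 0 (s.rmem 4) s₁ := by
    refine ⟨?_, ?_, ?_, ?_, ?_, ?_, ?_, ?_, ?_⟩
    · intro x hx
      rw [← h1 x hx]
      simp only [hs₁, RamState.setI_ireg, RamState.setR_ireg]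
      rw [if_neg (by omega)]
    all_goals simp [hs₁, h2, h3, h4, h5, h6]
  obtain ⟨s₂, he, hi⟩ := Exec.while_invariant (x := 17) (y := 3) (p := innerStep)
      (fun b => InnerInv s₀ r c b (s.rmem 4)) (s₀.ireg 3)
      (fun _ => 5) (fun k hk s hs => ⟨by rw [hs.idx, hs.ireg 3 (by norm_num)]; exact hk,
        exec_innerStep hs⟩)
      (fun s hs => by rw [hs.idx, hs.ireg 3 (by norm_num)]; exact lt_irrefl _) hfr
  refine ⟨_, Exec.cast (Exec.seq (.rconst_set 0 (by simp)) <| .seq (.iconst_set _) <|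
      .seq he <| .seq (.rstore_set rfl rfl rfl) (.iadd_set rfl)) ?_, ?_⟩
  · simp; ring
  · refine ⟨?_, ?_, ?_, ?_, ?_, ?_, ?_⟩
    · intro x hx
      rw [← hi.ireg x hx]
      rw [RamState.setI_ireg, RamState.setM_ireg, if_neg (by omega)]
    · simp [hi.one]
    · simp [hi.row]
    · simp [hi.one, hi.col]
    · rw [RamState.setI_rmem, RamState.setM_rmem_of_ne _ _ _ _ _ (by omega), hi.gauss]
    · rw [RamState.setI_rmem, RamState.setM_rmem_of_ne _ _ _ _ _ (by omega), hi.comp]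
    · intro r' c' hrc
      simp only [RamState.setI_rmem, RamState.setM_rmem, hi.row, hi.col, hi.out, hi.acc]
      by_cases hh : r' = r ∧ c' = c
      · simp [hh, outputCell]
      · rw [if_neg (by tauto)]
        exact h7 r' c' (by omega)

structure RowInv (s₀ : RamState) (r : ℕ) (s : RamState) : Prop where
  ireg : ∀ x < 6, s.ireg x = s₀.ireg x
  one : s.ireg 6 = 1
  row : s.ireg 15 = r
  gauss : s.rmem 3 = s₀.rmem 3
  comp : s.rmem 5 = compressed s₀ (s₀.ireg 0)
  out : ∀ r' c', r' < r ∧ c' < s₀.ireg 2 → s.rmem 4 r' c' = outputCell s₀ r' c'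

theorem exec_rowStep {s₀ s : RamState} {r : ℕ} (h : RowInv s₀ r s) :
    ∃ s', Exec rowStep s (s₀.ireg 2 * (6 * s₀.ireg 3 + 6) + 3) s' ∧ RowInv s₀ (r + 1) s' := by
  obtain ⟨h1, h2, h3, h5, h6, h7⟩ := h
  set s₁ : RamState := s.setI 16 0 with hs₁
  have hfr : CellInv s₀ r 0 s₁ := by
    refine ⟨?_, ?_, ?_, ?_, ?_, ?_, ?_⟩
    · intro x hx
      rw [← h1 x hx]
      simp only [hs₁, RamState.setI_ireg]
      rw [if_neg (by omega)]
    all_goals simp [hs₁, h2, h3, h5, h6]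
    exact fun r' c' a b => h7 r' c' ⟨a, b⟩
  obtain ⟨s₂, he, hi⟩ := Exec.while_invariant (x := 16) (y := 2) (p := cellStep)
      (fun c => CellInv s₀ r c) (s₀.ireg 2)
      (fun _ => 6 * s₀.ireg 3 + 5) (fun k hk s hs => ⟨by
        rw [hs.col, hs.ireg 2 (by norm_num)]; exact hk, exec_cellStep hs⟩)
      (fun s hs => by rw [hs.col, hs.ireg 2 (by norm_num)]; exact lt_irrefl _) hfr
  refine ⟨_, Exec.cast (Exec.seq (.iconst_set _) <| .seq he (.iadd_set rfl)) ?_, ?_⟩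
  · simp; ring
  · refine ⟨?_, ?_, ?_, hi.gauss, hi.comp, ?_⟩
    · intro x hx
      rw [← hi.ireg x hx, RamState.setI_ireg, if_neg (by omega)]
    · simp [hi.one]
    · simp [hi.one, hi.row]
    · intro r' c' hrc
      exact hi.out r' c' (by omega)

/-- Running time and output of the program. -/
theorem exec_sketchProgram (s₀ : RamState) (h7 : s₀.ireg 7 = 0) (h8 : s₀.ireg 8 = 0)
    (h5 : ∀ b c, s₀.rmem 5 b c = 0) :
    ∃ s, Exec sketchProgram s₀ (11 * ∑ e ∈ Finset.range (s₀.ireg 0), entryCount s₀ e +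
        8 * s₀.ireg 0 + s₀.ireg 4 * (s₀.ireg 2 * (6 * s₀.ireg 3 + 6) + 4) + 4) s ∧
      ∀ r < s₀.ireg 4, ∀ c < s₀.ireg 2, s.rmem 4 r c = outputCell s₀ r c := by
  set s₁ : RamState := s₀.setI 6 1 with hs₁
  have hfr : EntryInv s₀ 0 s₁ := by
    refine ⟨⟨?_, ?_, ?_, ?_, ?_⟩, ?_, ?_⟩
    · intro x hx
      simp only [hs₁, RamState.setI_ireg]
      rw [if_neg (by omega)]
    all_goals simp [hs₁, h7, h8, h5, compressed]
  obtain ⟨s₂, he, hi⟩ := Exec.while_invariant (x := 8) (y := 0) (p := entryStep)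
      (fun e => EntryInv s₀ e) (s₀.ireg 0)
      (fun e => 11 * entryCount s₀ e + 7) (fun k hk s hs => ⟨by
        rw [hs.entry, hs.ireg 0 (by norm_num)]; exact hk, exec_entryStep hs⟩)
      (fun s hs => by rw [hs.entry, hs.ireg 0 (by norm_num)]; exact lt_irrefl _) hfr
  have hfr₂ : RowInv s₀ 0 (s₂.setI 15 0) := by
    refine ⟨?_, ?_, ?_, ?_, ?_, ?_⟩
    · intro x hx
      rw [← hi.ireg x hx, RamState.setI_ireg, if_neg (by omega)]
    · simp [hi.one]
    · simp
    · exact hi.rmem 3 (by norm_num)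
    · funext b c
      exact hi.acc b c
    · simp
  obtain ⟨s₃, he', hi'⟩ := Exec.while_invariant (x := 15) (y := 4) (p := rowStep)
      (fun r => RowInv s₀ r) (s₀.ireg 4)
      (fun _ => s₀.ireg 2 * (6 * s₀.ireg 3 + 6) + 3) (fun k hk s hs => ⟨by
        rw [hs.row, hs.ireg 4 (by norm_num)]; exact hk, exec_rowStep hs⟩)
      (fun s hs => by rw [hs.row, hs.ireg 4 (by norm_num)]; exact lt_irrefl _) hfr₂
  refine ⟨s₃, Exec.cast (Exec.seq (.iconst_set _) <| .seq he <| .seq (.iconst_set _) he') ?_,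
    fun r hr c hc => hi'.out r c ⟨hr, hc⟩⟩
  simp only [add_assoc, Finset.sum_add_distrib, ← Finset.mul_sum, Finset.sum_const,
    Finset.card_range, smul_eq_mul]
  ring

/-! ### The program on the prescribed input format -/

theorem lookup_val {α : Type} {a : ℕ} (f : Fin a → α) (x : α) (i : Fin a) :
    lookup f x i.val = f i := dif_pos i.isLt

theorem countSketch_apply {ι : Type} [Fintype ι] [DecidableEq ι] {m : ℕ} (h : ι → Fin m)
    (σ : ι → ℝ) (b : Fin m) (i : ι) : countSketch h σ b i = if h i = b then σ i else 0 := by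
  rw [countSketch, Matrix.mul_diagonal, Matrix.of_apply]
  split_ifs <;> simp

/-- The matrix to which the Gaussian embedding is applied. -/
noncomputable def sparseSketch (G : ℝ → ℝ) {n m₁ m₂ : ℕ} (ω : SketchSample n m₁ m₂) :
    Matrix (Fin m₁) (Fin n) ℝ :=
  countSketch ω.2.1 ω.2.2.1 * stackedMatrix G ω.1

/-- Column `j` of the stacked matrix is supported on the indices `(l, j)`, so only these CountSketch
columns enter. -/
theorem sparseSketch_apply (G : ℝ → ℝ) {n m₁ m₂ : ℕ} (ω : SketchSample n m₁ m₂) (b : Fin m₁)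
    (j : Fin n) : sparseSketch G ω b j = ∑ l, if ω.1 l j then
      (if ω.2.1 (l, j) = b then levelWeight G n l.val * ω.2.2.1 (l, j) else 0) else 0 := by
  simp only [sparseSketch, countSketch_apply, stackedMatrix, samplingMatrix, Matrix.mul_apply,
    Matrix.of_apply, Matrix.smul_apply, Matrix.diagonal_apply,
    Fintype.sum_prod_type, smul_eq_mul]
  refine Finset.sum_congr rfl fun l _ => ?_
  rw [Finset.sum_eq_single j]
  · rw [if_pos rfl]
    split_ifs <;> simp [mul_comm]
  · intro j' _ h
    simp [h]
  · simp

theorem sum_range_length {α : Type} (l : List α) (f : α → ℝ) (F : ℕ → ℝ)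
    (h : ∀ k : Fin l.length, F k = f (l.get k)) :
    ∑ k ∈ Finset.range l.length, F k = (l.map f).sum := by
  rw [Finset.sum_range, ← Fin.sum_univ_fun_getElem]
  exact Finset.sum_congr rfl fun k _ => h k

theorem sum_map_activeLevels {n : ℕ} (z : Fin (numLevels n + 1) → Fin n → Bool) (j : Fin n)
    (f : Fin (numLevels n + 1) → ℝ) :
    ((activeLevels z j).map f).sum = ∑ l, if z l j then f l else 0 := by
  have : ∀ l : List (Fin (numLevels n + 1)), ((l.filter fun i => z i j).map f).sum =
      (l.map fun i => if z i j then f i else 0).sum := by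
    intro l
    induction l with
    | nil => simp
    | cons a l ih => by_cases h : z a j <;> simp [h, ih]
  rw [activeLevels, this, ← List.sum_toFinset _ (List.nodup_finRange _)]
  simp

section

variable {G : ℝ → ℝ} {n d m₁ m₂ : ℕ} {A : Matrix (Fin n) (Fin d) ℝ} {L : List (Fin n × Fin d)}

theorem entryCount_initialState (ω : SketchSample n m₁ m₂) (k : Fin L.length) :
    entryCount (initialState G A L ω) k = (activeLevels ω.1 (L.get k).1).length := by
  simp [entryCount, initialState, lookup_val]

/-- The active levels enumerate exactly the levels whose bit is set, so the loop over them is the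
sum in `sparseSketch_apply`. -/
theorem sum_entryTerm_initialState (ω : SketchSample n m₁ m₂) (k : Fin L.length) (b : Fin m₁)
    (c : Fin d) :
    ∑ q ∈ Finset.range (entryCount (initialState G A L ω) k),
      entryTerm (initialState G A L ω) k q b c =
      if c = (L.get k).2 then sparseSketch G ω b (L.get k).1 * A (L.get k).1 (L.get k).2 else 0 := by
  rw [entryCount_initialState, sum_range_length _ (fun l => if c = (L.get k).2 then
    (if ω.2.1 (l, (L.get k).1) = b then levelWeight G n l.val * ω.2.2.1 (l, (L.get k).1) else 0)
      * A (L.get k).1 (L.get k).2 else 0), sum_map_activeLevels]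
  · split_ifs with hc
    · rw [sparseSketch_apply, Finset.sum_mul]
      refine Finset.sum_congr rfl fun l _ => ?_
      split_ifs <;> simp
    · simp
  · intro q
    simp only [entryTerm, initialState, lookup_val, Fin.val_inj]
    simp only [@eq_comm _ b]
    split_ifs <;> simp_all

/-- No position is listed twice and the unlisted ones carry zero entries, so the sum over `L` is the
full matrix product. -/
theorem compressed_initialState (hL : L.Nodup) (hA : ∀ p, p ∈ L ↔ A p.1 p.2 ≠ 0)
    (ω : SketchSample n m₁ m₂) (b : Fin m₁) (c : Fin d) :
    compressed (initialState G A L ω) L.length b c = (sparseSketch G ω * A) b c := by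
  rw [compressed, sum_range_length _ (fun p => if c = p.2 then sparseSketch G ω b p.1 * A p.1 p.2
    else 0) _ fun k => sum_entryTerm_initialState ω k b c, ← List.sum_toFinset _ hL,
    Matrix.mul_apply]
  rw [Finset.sum_subset (Finset.subset_univ _), Fintype.sum_prod_type]
  · simp
  · intro p _ hp
    have : A p.1 p.2 = 0 := by simpa [hA] using hp
    simp [this]

theorem outputCell_initialState (hL : L.Nodup) (hA : ∀ p, p ∈ L ↔ A p.1 p.2 ≠ 0)
    (ω : SketchSample n m₁ m₂) (r : Fin m₂) (c : Fin d) :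
    outputCell (initialState G A L ω) r c = (symSketch G ω * A) r c := by
  have : symSketch G ω * A = gaussianEmbedding ω.2.2.2 * (sparseSketch G ω * A) := by
    simp only [symSketch, sparseSketch, Matrix.mul_assoc]
  rw [this, Matrix.mul_apply, outputCell]
  change ∑ b ∈ Finset.range m₁, _ * compressed _ L.length b c = _
  rw [Finset.sum_range]
  refine Finset.sum_congr rfl fun b _ => ?_
  rw [compressed_initialState hL hA]
  simp [initialState, lookup_val]

theorem nnz_eq_length (hL : L.Nodup) (hA : ∀ p, p ∈ L ↔ A p.1 p.2 ≠ 0) : nnz A = L.length := by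
  classical
  rw [nnz, ← List.toFinset_card_of_nodup hL]
  congr 1
  ext p
  simp [hA]

/-- The number of steps of the program. -/
def sketchTime (L : List (Fin n × Fin d)) (ω : SketchSample n m₁ m₂) : ℕ :=
  11 * ∑ k : Fin L.length, (activeLevels ω.1 (L.get k).1).length +
    8 * L.length + m₂ * (d * (6 * m₁ + 6) + 4) + 4

theorem exec_initialState (hL : L.Nodup) (hA : ∀ p, p ∈ L ↔ A p.1 p.2 ≠ 0)
    (ω : SketchSample n m₁ m₂) : ∃ s, Exec sketchProgram (initialState G A L ω) (sketchTime L ω) s ∧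
      HasOutput s (symSketch G ω * A) := by
  obtain ⟨s, hs, ho⟩ := exec_sketchProgram (initialState G A L ω) rfl rfl (fun _ _ => rfl)
  refine ⟨s, hs.cast ?_, fun r c => ?_⟩
  · change 11 * ∑ e ∈ Finset.range L.length, _ + 8 * L.length + m₂ * (d * (6 * m₁ + 6) + 4) + 4 = _
    rw [Finset.sum_range]
    simp only [entryCount_initialState, sketchTime]
  · rw [ho r r.isLt c c.isLt, outputCell_initialState hL hA]

/-- The time depends on the sample only through the sampling bits, which range over a finite space.
-/
theorem measurable_sketchTime (L : List (Fin n × Fin d)) :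
    Measurable (sketchTime L : SketchSample n m₁ m₂ → ℕ) :=
  (measurable_of_countable (fun z : Fin (numLevels n + 1) → Fin n → Bool =>
    11 * ∑ k : Fin L.length, (activeLevels z (L.get k).1).length +
    8 * L.length + m₂ * (d * (6 * m₁ + 6) + 4) + 4)).comp measurable_fst

end

/-! ### Expected and worst-case running time -/

instance {n m₁ m₂ : ℕ} [NeZero m₁] : IsProbabilityMeasure (sketchLaw n m₁ m₂) := by
  have : IsProbabilityMeasure (uniformOn (Set.univ : Set (Fin m₁))) :=
    isProbabilityMeasure_uniformOn Set.finite_univ Set.univ_nonempty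
  unfold sketchLaw
  infer_instance

/-- The law of the sampling bits. -/
noncomputable def samplingLaw (n : ℕ) : Measure (Fin (numLevels n + 1) → Fin n → Bool) :=
  Measure.pi fun i : Fin (numLevels n + 1) => Measure.pi fun _ : Fin n =>
      bernoulliMeasure true false (levelProb i.val)

instance {n : ℕ} : IsProbabilityMeasure (samplingLaw n) := by
  unfold samplingLaw
  infer_instance

theorem measurePreserving_sampling (n m₁ m₂ : ℕ) [NeZero m₁] :
    MeasurePreserving Prod.fst (sketchLaw n m₁ m₂) (samplingLaw n) := by
  have : IsProbabilityMeasure (uniformOn (Set.univ : Set (Fin m₁))) :=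
    isProbabilityMeasure_uniformOn Set.finite_univ Set.univ_nonempty
  unfold sketchLaw samplingLaw
  exact measurePreserving_fst

theorem samplingLaw_bit {n : ℕ} (i : Fin (numLevels n + 1)) (j : Fin n) :
    MeasurePreserving (fun z => z i j) (samplingLaw n)
      (bernoulliMeasure true false (levelProb i.val)) :=
  (measurePreserving_eval (fun _ : Fin n => bernoulliMeasure true false (levelProb i.val)) j).comp
    (measurePreserving_eval (fun i : Fin (numLevels n + 1) => Measure.pi fun _ : Fin n =>
      bernoulliMeasure true false (levelProb i.val)) i)

theorem samplingLaw_eval {n : ℕ} (i : Fin (numLevels n + 1)) (j : Fin n) :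
    samplingLaw n {z | z i j = true} = ENNReal.ofReal (1 / 2 ^ i.val) := by
  have h2 : samplingLaw n {z | z i j = true} =
      bernoulliMeasure true false (levelProb i.val) {true} :=
    (samplingLaw_bit i j).measure_preimage (s := {true}) (by measurability)
  rw [h2, bernoulliMeasure_apply_of_mem_of_notMem _ (by measurability) (by simp) (by simp),
    ← ENNReal.ofReal_coe_nnreal]
  rfl

theorem lintegral_bit {n : ℕ} (i : Fin (numLevels n + 1)) (j : Fin n) (c : ℝ≥0∞) :
    ∫⁻ z, (if z i j then c else 0) ∂(samplingLaw n) = c * ENNReal.ofReal (1 / 2 ^ i.val) := by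
  rw [← samplingLaw_eval i j, ← lintegral_indicator_const (measurableSet_eq_fun
    ((samplingLaw_bit i j).measurable) measurable_const)]
  simp [Set.indicator_apply]

theorem length_activeLevels {n : ℕ} (z : Fin (numLevels n + 1) → Fin n → Bool) (j : Fin n) :
    (activeLevels z j).length = ∑ l, if z l j then 1 else 0 := by
  have := sum_map_activeLevels z j (fun _ => 1)
  simp only [List.map_const', List.sum_replicate, nsmul_eq_mul, mul_one] at this
  exact_mod_cast this

/-- The geometric series of the sampling rates is the reason why the expected time has no
logarithmic factor. -/
theorem lintegral_length_activeLevels {n : ℕ} (j : Fin n) :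
    ∫⁻ z, ((activeLevels z j).length : ℝ≥0∞) ∂(samplingLaw n) ≤ 2 := by
  simp only [length_activeLevels, Nat.cast_sum, Nat.cast_ite, Nat.cast_one, Nat.cast_zero]
  rw [lintegral_finsetSum _ fun i _ => measurable_of_countable _]
  simp only [lintegral_bit, one_mul]
  rw [← ENNReal.ofReal_sum_of_nonneg fun i _ => by positivity,
    Fin.sum_univ_eq_sum_range (fun i => 1 / (2 : ℝ) ^ i),
    show (2 : ℝ≥0∞) = ENNReal.ofReal 2 by simp]
  refine ENNReal.ofReal_le_ofReal ?_
  have : ∀ k : ℕ, ∑ i ∈ Finset.range k, 1 / (2 : ℝ) ^ i = 2 - 2 / 2 ^ k := by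
    intro k
    induction k with
    | zero => simp
    | succ k ih => rw [Finset.sum_range_succ, ih, pow_succ]; field_simp; ring
  rw [this]
  have : (0 : ℝ) ≤ 2 / 2 ^ (numLevels n + 1) := by positivity
  linarith

theorem length_activeLevels_le {n : ℕ} (z : Fin (numLevels n + 1) → Fin n → Bool) (j : Fin n) :
    (activeLevels z j).length ≤ numLevels n + 1 := by
  rw [activeLevels]
  exact (List.length_filter_le _ _).trans (by simp)

/-- As `n ≥ 2`, the top level `t` is at least `1`, so `t + 1 ≤ 2t ≤ 2 log n / log 2`, and `2 / log 2
< 3`. -/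
theorem numLevels_add_one_le_log {n : ℕ} (hn : 2 ≤ n) :
    ((numLevels n + 1 : ℕ) : ℝ) ≤ 3 * Real.log n := by
  have h1 : 1 ≤ numLevels n := Nat.log_pos (by norm_num) hn
  have h2 : 2 ^ numLevels n ≤ n := Nat.pow_log_le_self 2 (by omega)
  have h3 : (numLevels n : ℝ) * Real.log 2 ≤ Real.log n := by
    rw [← Real.log_pow]
    exact Real.log_le_log (by positivity) (by exact_mod_cast h2)
  have h4 : (1 : ℝ) ≤ numLevels n := by exact_mod_cast h1
  push_cast
  nlinarith [Real.log_two_gt_d9]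

theorem lintegral_sketchTime_le {n d m₁ m₂ : ℕ} [NeZero m₁] (L : List (Fin n × Fin d)) :
    ∫⁻ ω, (sketchTime L ω : ℝ≥0∞) ∂(sketchLaw n m₁ m₂) ≤
      30 * L.length + (m₂ * (d * (6 * m₁ + 6) + 4) + 4) := by
  have e : ∀ ω : SketchSample n m₁ m₂, (sketchTime L ω : ℝ≥0∞) =
      11 * ∑ k : Fin L.length, ((activeLevels ω.1 (L.get k).1).length : ℝ≥0∞) +
    (8 * L.length + (m₂ * (d * (6 * m₁ + 6) + 4) + 4)) := by
    intro ω
    rw [sketchTime]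
    push_cast
    ring
  simp only [e]
  rw [lintegral_add_right _ measurable_const, lintegral_const_mul,
    lintegral_finsetSum, lintegral_const, measure_univ, mul_one, ← add_assoc]
  · gcongr
    have hk : ∀ k : Fin L.length, ∫⁻ ω, ((activeLevels ω.1 (L.get k).1).length : ℝ≥0∞)
        ∂(sketchLaw n m₁ m₂) ≤ 2 := fun k => by
      rw [(measurePreserving_sampling n m₁ m₂).lintegral_comp (f := fun z =>
        ((activeLevels z (L.get k).1).length : ℝ≥0∞)) (measurable_of_countable _)]
      exact lintegral_length_activeLevels _
    -- Two sampled levels on average at cost `11`, plus `8` per entry: `11 * 2 + 8 = 30`.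
    calc _ ≤ 11 * ∑ k : Fin L.length, (2 : ℝ≥0∞) + 8 * L.length := by gcongr; exact hk _
      _ = 30 * L.length := by
        simp only [Finset.sum_const, Finset.card_univ, Fintype.card_fin, nsmul_eq_mul]
        ring
  · exact fun k _ => (measurable_of_countable (fun z => ((activeLevels z (L.get k).1).length :
      ℝ≥0∞))).comp measurable_fst
  · exact Finset.measurable_fun_sum _ fun k _ => (measurable_of_countable (fun z =>
      ((activeLevels z (L.get k).1).length : ℝ≥0∞))).comp measurable_fst

theorem sketchTime_le {n d m₁ m₂ : ℕ} (L : List (Fin n × Fin d)) (ω : SketchSample n m₁ m₂) :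
    sketchTime L ω ≤ 19 * (L.length * (numLevels n + 1)) +
      (m₂ * (d * (6 * m₁ + 6) + 4) + 4) := by
  have h : ∑ k : Fin L.length, (activeLevels ω.1 (L.get k).1).length ≤
      L.length * (numLevels n + 1) :=
    (Finset.sum_le_card_nsmul _ _ _ fun k _ => length_activeLevels_le _ _).trans (by simp)
  have : L.length ≤ L.length * (numLevels n + 1) := Nat.le_mul_of_pos_right _ (by omega)
  rw [sketchTime]
  omega

/-- All lower order terms are absorbed into `m₂ * d * m₁`, with total coefficient `6 + 6 + 4 + 4 =
20`. -/
theorem poly_time_le {K d m₁ m₂ : ℝ} (hd : 1 ≤ d) (h1 : 1 ≤ m₁) (h2 : 1 ≤ m₂)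
    (hm₁ : m₁ ≤ K * d ^ 2) (hm₂ : m₂ ≤ K * d) :
    m₂ * (d * (6 * m₁ + 6) + 4) + 4 ≤ 20 * K ^ 2 * d ^ 4 := by
  have a : 1 ≤ m₂ * d := one_le_mul_of_one_le_of_one_le h2 hd
  have b : m₂ ≤ m₂ * d := le_mul_of_one_le_right (by linarith) hd
  have c : m₂ * d ≤ m₂ * d * m₁ := le_mul_of_one_le_right (by linarith) h1
  have e : m₂ * d * m₁ ≤ (K * d) * d * (K * d ^ 2) := by
    have : 0 ≤ K * d := by linarith
    gcongr
  nlinarith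

/-- Correctness and running time of the program. -/
theorem sketchProgram_spec {K₁ : ℝ} {G : ℝ → ℝ} {n d m₁ m₂ : ℕ} (hn : 2 ≤ n) (hd : 1 ≤ d)
    (h1 : 0 < m₁) (h2 : 0 < m₂) (hm₁ : (m₁ : ℝ) ≤ K₁ * ((d : ℝ) ^ 2 / (1 / 10) ^ 2))
    (hm₂ : (m₂ : ℝ) ≤ K₁ * ((d : ℝ) / (1 / 10) ^ 2)) {A : Matrix (Fin n) (Fin d) ℝ}
    {L : List (Fin n × Fin d)} (hL : L.Nodup) (hA : ∀ p, p ∈ L ↔ A p.1 p.2 ≠ 0) :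
    ∃ T : SketchSample n m₁ m₂ → ℕ, Measurable T ∧
      (∀ ω, ∃ s : RamState,
        Exec sketchProgram (initialState G A L ω) (T ω) s ∧ HasOutput s (symSketch G ω * A)) ∧
      (∀ ω, (T ω : ℝ) ≤ (60 + 200000 * K₁ ^ 2) * ((nnz A : ℝ) * Real.log (n : ℝ) +
        (d : ℝ) ^ 4)) ∧
      ∫⁻ ω, (T ω : ℝ≥0∞) ∂(sketchLaw n m₁ m₂)
        ≤ ENNReal.ofReal ((60 + 200000 * K₁ ^ 2) * ((nnz A : ℝ) + (d : ℝ) ^ 4)) := by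
  have : NeZero m₁ := ⟨h1.ne'⟩
  -- Since `1 / ε² = 100`, the constant is `100 * K₁`, and `20 * (100 * K₁) ^ 2 = 200000 * K₁ ^ 2`.
  have hp : (m₂ : ℝ) * (d * (6 * m₁ + 6) + 4) + 4 ≤ 20 * (100 * K₁) ^ 2 * (d : ℝ) ^ 4 :=
    poly_time_le (by exact_mod_cast hd) (by exact_mod_cast h1) (by exact_mod_cast h2)
      (hm₁.trans (by ring_nf; rfl)) (hm₂.trans (by ring_nf; rfl))
  have hlog := numLevels_add_one_le_log hn
  have hlog0 : 0 ≤ Real.log n := Real.log_natCast_nonneg n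
  have hnn : (0 : ℝ) ≤ nnz A := Nat.cast_nonneg _
  rw [nnz_eq_length hL hA] at *
  refine ⟨sketchTime L, measurable_sketchTime L, exec_initialState hL hA, fun ω => ?_, ?_⟩
  · have h := sketchTime_le L ω
    have h' : (sketchTime L ω : ℝ) ≤ 19 * (L.length * ((numLevels n + 1 : ℕ) : ℝ)) +
      (m₂ * (d * (6 * m₁ + 6) + 4) + 4) := by exact_mod_cast h
    have h3 : (L.length : ℝ) * ((numLevels n + 1 : ℕ) : ℝ) ≤ L.length * (3 * Real.log n) := by
      gcongr
    have h4 : 0 ≤ K₁ ^ 2 * ((L.length : ℝ) * Real.log n) := by positivity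
    have h5 : 0 ≤ (d : ℝ) ^ 4 := by positivity
    have h6 : 0 ≤ (L.length : ℝ) * Real.log n := by positivity
    nlinarith
  · refine (lintegral_sketchTime_le L).trans ?_
    have : (30 * L.length + (m₂ * (d * (6 * m₁ + 6) + 4) + 4) : ℝ≥0∞) =
        ENNReal.ofReal (30 * L.length + (m₂ * (d * (6 * m₁ + 6) + 4) + 4)) := by
      have : (30 * L.length + (m₂ * (d * (6 * m₁ + 6) + 4) + 4) : ℝ) =
        ((30 * L.length + (m₂ * (d * (6 * m₁ + 6) + 4) + 4) : ℕ) : ℝ) := by push_cast; ring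
      rw [this, ENNReal.ofReal_natCast]
      push_cast
      ring
    rw [this]
    refine ENNReal.ofReal_le_ofReal ?_
    have h4 : 0 ≤ K₁ ^ 2 * (L.length : ℝ) := by positivity
    have h5 : 0 ≤ (d : ℝ) ^ 4 := by positivity
    nlinarith

/-! ### Orlicz functions -/

namespace OrliczAssumption

variable {G : ℝ → ℝ} {C : ℝ}

theorem mono (hG : OrliczAssumption G C) {x y : ℝ} (hx : 0 ≤ x) (hxy : x ≤ y) : G x ≤ G y :=
  hG.strictMono.monotoneOn (Set.mem_Ici.2 hx) (Set.mem_Ici.2 (hx.trans hxy)) hxy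

theorem nonneg (hG : OrliczAssumption G C) {x : ℝ} (hx : 0 ≤ x) : 0 ≤ G x :=
  hG.map_zero ▸ hG.mono le_rfl hx

theorem pos (hG : OrliczAssumption G C) {x : ℝ} (hx : 0 < x) : 0 < G x :=
  hG.map_zero ▸ hG.strictMono (Set.mem_Ici.2 le_rfl) (Set.mem_Ici.2 hx.le) hx

theorem le_of_apply_le (hG : OrliczAssumption G C) {x y : ℝ} (hy : 0 ≤ y)
    (h : G x ≤ G y) : x ≤ y := by
  by_contra! hc
  exact absurd h (not_le.2 (hG.strictMono (Set.mem_Ici.2 hy) (Set.mem_Ici.2 (hy.trans hc.le)) hc))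

/-- Convexity on the segment from `0` to `x`, with `G 0 = 0`. This and its rescaling `mul_apply_le`
provide the linear comparisons of values of `G` in both distortion bounds. -/
theorem mul_le (hG : OrliczAssumption G C) {r x : ℝ} (hr : 0 ≤ r) (hr1 : r ≤ 1) (hx : 0 ≤ x) :
    G (r * x) ≤ r * G x := by
  have := hG.convex.2 (Set.mem_Ici.2 hx) (Set.mem_Ici.2 le_rfl) hr (sub_nonneg.2 hr1)
    (by ring)
  simpa [hG.map_zero] using this

theorem mul_apply_le (hG : OrliczAssumption G C) {T x : ℝ} (hT : 1 ≤ T) (hx : 0 ≤ x) :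
    T * G x ≤ G (T * x) := by
  have hT0 : 0 < T := by linarith
  have h := hG.mul_le (r := T⁻¹) (x := T * x) (by positivity) (inv_le_one_of_one_le₀ hT)
    (by positivity)
  rw [inv_mul_cancel_left₀ hT0.ne'] at h
  calc T * G x ≤ T * (T⁻¹ * G (T * x)) := by gcongr
    _ = G (T * x) := mul_inv_cancel_left₀ hT0.ne' _

end OrliczAssumption

/-! ### Level weights and the deterministic contraction bound -/

section

variable {G : ℝ → ℝ} {C : ℝ} {n : ℕ}

theorem orliczNorm_pos (hG : OrliczAssumption G C) {y : Fin n → ℝ} (hy : y ≠ 0) :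
    0 < orliczNorm G y := ((orliczNorm_unique hG hy _).2 rfl).1

theorem sum_div_orliczNorm (hG : OrliczAssumption G C) {y : Fin n → ℝ} (hy : y ≠ 0) :
    ∑ i, G (|y i| / orliczNorm G y) = 1 := ((orliczNorm_unique hG hy _).2 rfl).2

/-- The defining equation of the norm of the indicator vector. It has `2 ^ i` ones because `2 ^ i ≤
n` for every level, and its zeros drop out as `G 0 = 0`. -/
theorem levelWeight_spec (hG : OrliczAssumption G C) (hn : 2 ≤ n) (i : Fin (numLevels n + 1)) :
    0 < levelWeight G n i ∧ 2 ^ (i : ℕ) * G (1 / levelWeight G n i) = 1 := by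
  have hi : 2 ^ (i : ℕ) ≤ n := (Nat.pow_le_pow_right (by norm_num) (Nat.lt_succ_iff.1 i.isLt)).trans
    (Nat.pow_log_le_self 2 (by omega))
  have hne : (fun j : Fin n => if j.val < 2 ^ (i : ℕ) then (1 : ℝ) else 0) ≠ 0 :=
    Function.ne_iff.2 ⟨⟨0, by omega⟩, by simp⟩
  refine ⟨orliczNorm_pos hG hne, ?_⟩
  have h := sum_div_orliczNorm hG hne
  change ∑ j : Fin n, G (|if j.val < 2 ^ (i : ℕ) then (1 : ℝ) else 0| / levelWeight G n i) = 1 at h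
  refine Eq.trans ?_ h
  rw [Fin.sum_univ_eq_sum_range
    (fun j => G (|if j < 2 ^ (i : ℕ) then (1 : ℝ) else 0| / levelWeight G n i)),
    ← Finset.sum_subset (s₁ := Finset.range (2 ^ (i : ℕ)))]
  · rw [Finset.sum_congr rfl (g := fun _ => G (1 / levelWeight G n i))]
    · simp
    · intro j hj
      simp [Finset.mem_range.1 hj]
  · simpa using hi
  · intro j _ hj
    simp [Finset.mem_range.not.1 hj, hG.map_zero]

theorem stackedMatrix_mulVec (G : ℝ → ℝ) (z : Fin (numLevels n + 1) → Fin n → Bool)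
    (y : Fin n → ℝ) (p : Fin (numLevels n + 1) × Fin n) :
    (stackedMatrix G z).mulVec y p = if z p.1 p.2 then levelWeight G n p.1 * y p.2 else 0 := by
  simp [stackedMatrix, Matrix.mulVec, dotProduct, samplingMatrix, Matrix.diagonal_apply]

/-- Dyadic decomposition of `G` over the interval `[0, b]`. -/
theorem apply_le_dyadic_sum (hG : OrliczAssumption G C) {b x : ℝ} (hb : 0 ≤ b) (hx : 0 ≤ x)
    (hxb : x ≤ b) (K : ℕ) :
    G x ≤ ∑ k ∈ Finset.range K, (if b / 2 ^ (k + 1) ≤ x then G (b / 2 ^ k) else 0) +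
      G (b / 2 ^ K) := by
  induction K with
  | zero => simpa using hG.mono hx hxb
  | succ K ih =>
    rw [Finset.sum_range_succ]
    -- In the first case the new summand equals the old remainder; in the second, monotonicity
    -- bounds `G x` by the new remainder.
    split_ifs with h
    · have : 0 ≤ G (b / 2 ^ (K + 1)) := hG.nonneg (by positivity)
      linarith
    · refine (hG.mono hx (not_le.1 h).le).trans ?_
      have : 0 ≤ ∑ k ∈ Finset.range K, (if b / 2 ^ (k + 1) ≤ x then G (b / 2 ^ k) else 0) :=
        Finset.sum_nonneg fun k _ => by
          split_ifs
          exacts [hG.nonneg (by positivity), le_rfl]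
      linarith

/-- Some superlevel set carries a large share of a unit vector. -/
theorem exists_heavy_superlevel (hG : OrliczAssumption G C) {y : Fin n → ℝ}
    (hy : ∑ j, G |y j| = 1) {b : ℝ} (hb : 0 < b) (hGb : G b = 1) {l : ℕ} (hl : 1 ≤ l)
    (hn : n ≤ 2 ^ l) :
    ∃ θ, 0 < θ ∧ 2 * θ ≤ b ∧
      1 / (4 * l : ℝ) ≤ (Finset.univ.filter fun j => θ ≤ |y j|).card * G (2 * θ) := by
  -- Otherwise the `l + 1` dyadic shells contribute less than `(l + 1) / (4l) ≤ 1 / 2`, and the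
  -- coordinates below them at most `n * G (b / 2 ^ (l + 1)) ≤ 1 / 2`, which is too little for a sum
  -- of `1`.
  by_contra! hc
  have hyb : ∀ j, |y j| ≤ b := fun j => hG.le_of_apply_le hb.le (by
    rw [hGb, ← hy]
    exact Finset.single_le_sum (f := fun j => G |y j|) (fun i _ => hG.nonneg (abs_nonneg _))
      (Finset.mem_univ j))
  have hl0 : (0 : ℝ) < l := by exact_mod_cast hl
  have h1 : (1 : ℝ) ≤ ∑ k ∈ Finset.range (l + 1),
      (Finset.univ.filter fun j => b / 2 ^ (k + 1) ≤ |y j|).card * G (b / 2 ^ k) +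
        n * G (b / 2 ^ (l + 1)) := by
    rw [← hy]
    refine (Finset.sum_le_sum fun j _ => apply_le_dyadic_sum hG hb.le (abs_nonneg _) (hyb j)
      (l + 1)).trans (le_of_eq ?_)
    rw [Finset.sum_add_distrib, Finset.sum_comm]
    simp [Finset.sum_ite]
  have h2 : (n : ℝ) * G (b / 2 ^ (l + 1)) ≤ 1 / 2 := by
    have := hG.mul_le (r := 1 / 2 ^ (l + 1)) (x := b) (by positivity)
      (by rw [div_le_one (by positivity)]; exact one_le_pow₀ (by norm_num)) hb.le
    rw [hGb, one_div_mul_eq_div] at this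
    calc (n : ℝ) * G (b / 2 ^ (l + 1)) ≤ 2 ^ l * (1 / 2 ^ (l + 1) * 1) := by
          gcongr
          · exact hG.nonneg (by positivity)
          · exact_mod_cast hn
      _ = 1 / 2 := by rw [pow_succ]; field_simp
  have h3 : ∑ k ∈ Finset.range (l + 1),
      (Finset.univ.filter fun j => b / 2 ^ (k + 1) ≤ |y j|).card * G (b / 2 ^ k) <
      ∑ k ∈ Finset.range (l + 1), 1 / (4 * l : ℝ) := by
    refine Finset.sum_lt_sum_of_nonempty (by simp) fun k _ => ?_
    have := hc (b / 2 ^ (k + 1)) (by positivity) (by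
      rw [pow_succ, mul_div_assoc']
      rw [div_le_iff₀ (by positivity)]
      nlinarith [one_le_pow₀ (n := k) (show (1 : ℝ) ≤ 2 by norm_num)])
    rwa [show 2 * (b / 2 ^ (k + 1)) = b / 2 ^ k by rw [pow_succ]; field_simp] at this
  rw [Finset.sum_const, Finset.card_range, nsmul_eq_mul] at h3
  have h4 : ((l + 1 : ℕ) : ℝ) * (1 / (4 * l)) ≤ 1 / 2 := by
    rw [mul_one_div, div_le_iff₀ (by positivity)]
    push_cast
    have : (1 : ℝ) ≤ l := by exact_mod_cast hl
    linarith
  linarith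

/-- A vector whose superlevel sets are hit by the samples about as often as expected keeps a
large part of its norm. -/
theorem le_sum_sq_stackedMatrix (hG : OrliczAssumption G C) (hn : 2 ≤ n)
    {z : Fin (numLevels n + 1) → Fin n → Bool} {y : Fin n → ℝ} (hy : ∑ j, G |y j| = 1)
    {Λ : ℝ} (hΛ : 1 ≤ Λ) (h0 : ∀ j, z 0 j = true)
    (hS : ∀ θ > 0, ∀ i : Fin (numLevels n + 1),
      2 ^ (i : ℕ) * Λ ≤ (Finset.univ.filter fun j => θ ≤ |y j|).card →
      ((Finset.univ.filter fun j => θ ≤ |y j|).card : ℝ) ≤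
        2 ^ (i + 1 : ℕ) * (Finset.univ.filter fun j => θ ≤ |y j| ∧ z i j = true).card) :
    1 / (256 * ((numLevels n + 1 : ℕ) : ℝ) ^ 2 * Λ) ≤ ∑ p, (stackedMatrix G z).mulVec y p ^ 2 := by
  obtain ⟨hw0, hGw0⟩ := levelWeight_spec hG hn (0 : Fin (numLevels n + 1))
  rw [Fin.val_zero, pow_zero, one_mul] at hGw0
  obtain ⟨θ, hθ, hθb, hheavy⟩ := exists_heavy_superlevel hG hy (one_div_pos.2 hw0) hGw0
    (l := numLevels n + 1) (by omega) (Nat.lt_pow_succ_log_self (by norm_num) n).le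
  set l : ℝ := ((numLevels n + 1 : ℕ) : ℝ) with hl
  have hl0 : 0 < l := by positivity
  set U := Finset.univ.filter fun j => θ ≤ |y j| with hU
  have hs0 : 0 < (U.card : ℝ) := by
    rcases Nat.eq_zero_or_pos U.card with h | h
    · rw [h, Nat.cast_zero, zero_mul] at hheavy
      have : 0 < 1 / (4 * l) := by positivity
      linarith
    · exact_mod_cast h
  -- the bound from a single level
  have level : ∀ i : Fin (numLevels n + 1), ∀ N : ℝ,
      N ≤ (Finset.univ.filter fun j => θ ≤ |y j| ∧ z i j = true).card →
      N * (levelWeight G n i * θ) ^ 2 ≤ ∑ p, (stackedMatrix G z).mulVec y p ^ 2 := by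
    intro i N hN
    have hw := (levelWeight_spec hG hn i).1
    calc N * (levelWeight G n i * θ) ^ 2
        ≤ ∑ j ∈ Finset.univ.filter (fun j => θ ≤ |y j| ∧ z i j = true),
          (levelWeight G n i * θ) ^ 2 := by
          rw [Finset.sum_const, nsmul_eq_mul]
          gcongr
      _ ≤ ∑ j ∈ Finset.univ.filter (fun j => θ ≤ |y j| ∧ z i j = true),
          (stackedMatrix G z).mulVec y (i, j) ^ 2 := by
          refine Finset.sum_le_sum fun j hj => ?_
          obtain ⟨h1, h2⟩ := (Finset.mem_filter.1 hj).2
          rw [stackedMatrix_mulVec, if_pos h2, mul_pow, mul_pow, ← sq_abs (y j)]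
          gcongr
      _ ≤ ∑ j, (stackedMatrix G z).mulVec y (i, j) ^ 2 :=
          Finset.sum_le_sum_of_subset_of_nonneg (Finset.subset_univ _) fun _ _ _ => sq_nonneg _
      _ ≤ _ := by
          rw [Fintype.sum_prod_type]
          exact Finset.single_le_sum (f := fun i => ∑ j, (stackedMatrix G z).mulVec y (i, j) ^ 2)
            (fun _ _ => Finset.sum_nonneg fun _ _ => sq_nonneg _) (Finset.mem_univ i)
  have hβ : 1 / (4 * l) ≤ 1 := by
    rw [div_le_one (by positivity)]
    have : (1 : ℝ) ≤ l := by rw [hl]; exact_mod_cast (by omega)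
    linarith
  -- If `2 w_i θ ≤ 1`, convexity gives `G (2θ) ≤ 2 w_i θ * G (1 / w_i) = 2 w_i θ / 2 ^ i`, to be
  -- compared with the heaviness of `U`. Otherwise the left side is at most `1`.
  have weight : ∀ i : Fin (numLevels n + 1), (2 : ℝ) ^ (i : ℕ) ≤ U.card →
      2 ^ (i : ℕ) / (4 * l * U.card) ≤ 2 * (levelWeight G n i * θ) := by
    intro i hi
    obtain ⟨hw, hGw⟩ := levelWeight_spec hG hn i
    rcases le_total (2 * (levelWeight G n i * θ)) 1 with h | h
    · have := hG.mul_le (r := 2 * (levelWeight G n i * θ)) (x := 1 / levelWeight G n i)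
        (by positivity) h (by positivity)
      rw [show 2 * (levelWeight G n i * θ) * (1 / levelWeight G n i) = 2 * θ by field_simp,
        eq_div_of_mul_eq (by positivity) ((mul_comm _ _).trans hGw)] at this
      have h2 : 1 / (4 * l) ≤ U.card * (2 * (levelWeight G n i * θ) * (1 / 2 ^ (i : ℕ))) :=
        hheavy.trans (by gcongr)
      rw [div_le_iff₀ (by positivity)] at h2 ⊢
      have h3 := mul_le_mul_of_nonneg_left h2 (show (0 : ℝ) ≤ 2 ^ (i : ℕ) by positivity)
      have e : (2 : ℝ) ^ (i : ℕ) * (U.card * (2 * (levelWeight G n i * θ) * (1 / 2 ^ (i : ℕ))) *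
        (4 * l)) = 2 * (levelWeight G n i * θ) * (4 * l * U.card) := by field_simp
      linarith
    · refine le_trans ?_ h
      rw [div_le_one (by positivity)]
      have : (1 : ℝ) ≤ 4 * l := by rwa [div_le_one (by positivity)] at hβ
      nlinarith
  -- A set of fewer than `Λ` points may be missed by sampling, but level `0` contains all of it.
  rcases lt_or_ge (U.card : ℝ) Λ with hlt | hge
  · have h1 := level 0 U.card (by simp [h0, hU])
    have h2 := weight 0 (by simpa using hs0)
    rw [Fin.val_zero, pow_zero] at h2
    refine le_trans ?_ h1
    have h3 : (1 / (8 * l * U.card)) ^ 2 ≤ (levelWeight G n (0 : Fin (numLevels n + 1)) * θ) ^ 2 := by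
      gcongr
      have : 1 / (8 * l * U.card) = 1 / (4 * l * U.card) / 2 := by field_simp; norm_num
      rw [this]
      simp only [Fin.val_zero] at h2 ⊢
      linarith
    calc 1 / (256 * l ^ 2 * Λ) ≤ 1 / (64 * l ^ 2 * U.card) := by
          gcongr
          norm_num
      _ = U.card * (1 / (8 * l * U.card)) ^ 2 := by field_simp; norm_num
      _ ≤ _ := by gcongr
  · have hΛ0 : 0 < Λ := by linarith
    -- The level with `2 ^ i * Λ ≤ |U| ≤ 2 ^ (i + 1) * Λ`; it exists because `2 ^ i ≤ |U| ≤ n`.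
    set i := Nat.log 2 ⌊U.card / Λ⌋₊ with hi
    have hfl : ⌊U.card / Λ⌋₊ ≠ 0 := by
      have : 1 ≤ ⌊U.card / Λ⌋₊ := Nat.le_floor (by
        rw [Nat.cast_one, le_div_iff₀ hΛ0]; linarith)
      omega
    have hi1 : (2 : ℝ) ^ i * Λ ≤ U.card := by
      rw [← le_div_iff₀ hΛ0]
      refine le_trans ?_ (Nat.floor_le (by positivity))
      exact_mod_cast Nat.pow_log_le_self 2 hfl
    have hi2 : (U.card : ℝ) ≤ 2 ^ (i + 1) * Λ := by
      rw [← div_le_iff₀ hΛ0]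
      refine (Nat.lt_floor_add_one _).le.trans ?_
      exact_mod_cast Nat.lt_pow_succ_log_self (by norm_num) ⌊U.card / Λ⌋₊
    have hi3 : (2 : ℝ) ^ i ≤ U.card :=
      le_trans (le_mul_of_one_le_right (by positivity) hΛ) hi1
    have hit : i < numLevels n + 1 := by
      refine Nat.lt_succ_of_le (Nat.le_log_of_pow_le (by norm_num) ?_)
      have : 2 ^ i ≤ U.card := by exact_mod_cast hi3
      exact this.trans ((Finset.card_le_univ _).trans (by simp))
    have h1 := level ⟨i, hit⟩ (U.card / 2 ^ (i + 1)) (by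
      rw [div_le_iff₀' (by positivity)]
      exact hS θ hθ ⟨i, hit⟩ hi1)
    have h2 := weight ⟨i, hit⟩ hi3
    refine le_trans ?_ h1
    have h3 : ((2 : ℝ) ^ i / (8 * l * U.card)) ^ 2 ≤ (levelWeight G n i * θ) ^ 2 := by
      gcongr
      have : (2 : ℝ) ^ i / (8 * l * U.card) = 2 ^ i / (4 * l * U.card) / 2 := by
        field_simp; norm_num
      rw [this]
      simp only at h2
      linarith
    calc 1 / (256 * l ^ 2 * Λ) = 2 ^ i / (128 * l ^ 2 * (2 ^ (i + 1) * Λ)) := by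
          field_simp; ring
      _ ≤ 2 ^ i / (128 * l ^ 2 * U.card) := by gcongr
      _ = U.card / 2 ^ (i + 1) * (2 ^ i / (8 * l * U.card)) ^ 2 := by
          field_simp; ring
      _ ≤ _ := by gcongr

end

/-! ### Superlevel sets and sampling -/

open Classical in
/-- The sets cut out of the rows of `A` by the half spaces `{v | 1 ≤ ⟨v, x⟩}`. -/
noncomputable def superlevelSets {n d : ℕ} (A : Matrix (Fin n) (Fin d) ℝ) :
    Finset (Finset (Fin n)) :=
  Finset.univ.filter fun U => ∃ x : Fin d → ℝ, ∀ j, j ∈ U ↔ 1 ≤ A.mulVec x j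

/-- A Radon type argument. More than `d` rows satisfy a nontrivial relation `∑ f j • A j = 0`.
Shattering yields `x` for which `⟨A j, x⟩ ≥ 1` holds exactly where `f j > 0`; pairing the relation
with `x` contradicts `∑ f j ≥ 0`. -/
theorem card_le_of_shatters {n d : ℕ} {A : Matrix (Fin n) (Fin d) ℝ} {s : Finset (Fin n)}
    (hs : (superlevelSets A).Shatters s) : s.card ≤ d := by
  classical
  by_contra! hc
  have hli : ¬ LinearIndependent ℝ fun j : s => A j := fun h => by
    have := h.fintype_card_le_finrank
    simp at this
    omega
  obtain ⟨g, hg, i, hi⟩ := Fintype.not_linearIndependent_iff.1 hli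
  -- Replace the relation by its negative if necessary, so that its coefficients have nonnegative
  -- sum.
  obtain ⟨f, hf, hf1, hf2⟩ : ∃ f : s → ℝ, (∑ j, f j • A j = 0) ∧ (∃ i, f i ≠ 0) ∧ 0 ≤ ∑ j, f j := by
    rcases le_total 0 (∑ j, g j) with h | h
    · exact ⟨g, hg, ⟨i, hi⟩, h⟩
    · exact ⟨-g, by simp only [Pi.neg_apply, neg_smul, Finset.sum_neg_distrib, hg, neg_zero], ⟨i, by simpa using hi⟩, by simpa using h⟩
  obtain ⟨u, hu, hut⟩ := hs (t := s.filter fun j => ∃ h : j ∈ s, 0 < f ⟨j, h⟩)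
    (Finset.filter_subset _ _)
  obtain ⟨x, hx⟩ := (Finset.mem_filter.1 hu).2
  have hmem : ∀ j : s, 1 ≤ A.mulVec x j ↔ 0 < f j := by
    intro j
    have := Finset.ext_iff.1 hut j
    simpa [hx] using this
  have hsum : ∑ j : s, f j * A.mulVec x j = 0 := by
    calc ∑ j : s, f j * A.mulVec x j = ∑ k, (∑ j, f j • A j) k * x k := by
          simp only [Matrix.mulVec, dotProduct, Finset.mul_sum, Finset.sum_apply, Pi.smul_apply,
            smul_eq_mul, Finset.sum_mul]
          rw [Finset.sum_comm]
          simp only [mul_assoc]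
      _ = 0 := by simp only [hf, Pi.zero_apply, zero_mul, Finset.sum_const_zero]
  have hterm : ∀ j : s, f j ≤ f j * A.mulVec x j ∧ (f j < 0 → f j < f j * A.mulVec x j) := by
    intro j
    have := hmem j
    by_cases hj : 0 < f j
    · exact ⟨le_mul_of_one_le_right hj.le (this.2 hj), fun h => absurd h (not_lt.2 hj.le)⟩
    · have h1 : A.mulVec x j < 1 := by
        by_contra! h
        exact hj (this.1 h)
      refine ⟨by nlinarith, fun h => by nlinarith⟩
  by_cases hneg : ∃ j, f j < 0
  · obtain ⟨j, hj⟩ := hneg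
    have : ∑ j, f j < ∑ j, f j * A.mulVec x j :=
      Finset.sum_lt_sum (fun j _ => (hterm j).1) ⟨j, Finset.mem_univ _, (hterm j).2 hj⟩
    linarith
  · push Not at hneg
    have h1 : ∑ j, f j ≤ 0 := hsum ▸ Finset.sum_le_sum fun j _ => (hterm j).1
    obtain ⟨j, hj⟩ := hf1
    exact hj ((Finset.sum_eq_zero_iff_of_nonneg fun j _ => hneg j).1 (le_antisymm h1 hf2) j
      (Finset.mem_univ _))

theorem sum_choose_le (n d : ℕ) : ∑ k ∈ Finset.range (d + 1), n.choose k ≤ (n + 1) ^ d := by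
  rw [add_pow]
  refine Finset.sum_le_sum fun k hk => ?_
  have hk : k ≤ d := by simpa [Nat.lt_succ_iff] using hk
  rw [one_pow, mul_one]
  exact (Nat.choose_le_pow n k).trans (Nat.le_mul_of_pos_right _ (Nat.choose_pos hk))

/-- The Sauer–Shelah bound for VC dimension at most `d`. -/
theorem card_superlevelSets_le {n d : ℕ} (A : Matrix (Fin n) (Fin d) ℝ) :
    (superlevelSets A).card ≤ (n + 1) ^ d := by
  classical
  have hvc : (superlevelSets A).vcDim ≤ d :=
    Finset.sup_le fun s hs => card_le_of_shatters (Finset.mem_shatterer.1 hs)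
  calc (superlevelSets A).card ≤ (superlevelSets A).shatterer.card :=
        Finset.card_le_card_shatterer _
    _ ≤ ∑ k ∈ Finset.Iic (superlevelSets A).vcDim, (Fintype.card (Fin n)).choose k :=
        Finset.card_shatterer_le_sum_vcDim
    _ ≤ ∑ k ∈ Finset.range (d + 1), n.choose k := by
        rw [Fintype.card_fin]
        refine Finset.sum_le_sum_of_subset fun k hk => ?_
        have := Finset.mem_Iic.1 hk
        simp
        omega
    _ ≤ _ := sum_choose_le n d

/-- The sets `{j | θ ≤ |(A x) j|}`. -/
theorem exists_absSuperlevelSets {n d : ℕ} (A : Matrix (Fin n) (Fin d) ℝ) :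
    ∃ 𝒰 : Finset (Finset (Fin n)), 𝒰.card ≤ (n + 1) ^ (2 * d) ∧
      ∀ (x : Fin d → ℝ), ∀ θ > 0, (Finset.univ.filter fun j => θ ≤ |A.mulVec x j|) ∈ 𝒰 := by
  classical
  -- `θ ≤ |y j|` means `1 ≤ y j / θ` or `1 ≤ -y j / θ`: a union of two sets of the family, whence
  -- the exponent `2 * d`.
  refine ⟨Finset.image₂ (fun U V => U ∪ V) (superlevelSets A) (superlevelSets A), ?_, ?_⟩
  · refine (Finset.card_image₂_le _ _ _).trans ?_
    rw [two_mul, pow_add]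
    exact Nat.mul_le_mul (card_superlevelSets_le A) (card_superlevelSets_le A)
  · intro x θ hθ
    refine Finset.mem_image₂.2 ⟨Finset.univ.filter fun j => 1 ≤ A.mulVec (θ⁻¹ • x) j, ?_,
      Finset.univ.filter fun j => 1 ≤ A.mulVec (-(θ⁻¹ • x)) j, ?_, ?_⟩
    · exact Finset.mem_filter.2 ⟨Finset.mem_univ _, _, fun j => by
        rw [Finset.mem_filter, and_iff_right (Finset.mem_univ _)]⟩
    · exact Finset.mem_filter.2 ⟨Finset.mem_univ _, _, fun j => by
        rw [Finset.mem_filter, and_iff_right (Finset.mem_univ _)]⟩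
    · ext j
      simp only [Finset.mem_union, Finset.mem_filter, Finset.mem_univ, true_and, Matrix.mulVec_neg,
        Matrix.mulVec_smul, Pi.neg_apply, Pi.smul_apply, smul_eq_mul, le_abs]
      rw [inv_mul_eq_div, le_div_iff₀ hθ, ← neg_div, le_div_iff₀ hθ, one_mul]

/-- Chernoff bound for the number of samples in a set. -/
theorem samplingLaw_few_le {n : ℕ} (i : Fin (numLevels n + 1)) (U : Finset (Fin n)) :
    samplingLaw n {z | (2 : ℝ) ^ (i + 1 : ℕ) * (U.filter fun j => z i j = true).card < U.card} ≤
      ENNReal.ofReal (Real.exp (-(U.card / 2 ^ (i : ℕ) / 8))) := by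
  set p : ℝ := 1 / 2 ^ (i : ℕ) with hp
  have hp0 : 0 ≤ p := by positivity
  set ν := bernoulliMeasure true false (levelProb i.val) with hν
  -- The product of the `f j` is `exp (-N)` with `N` the number of samples in `U`. Its mean is at
  -- most `exp (-5/8 * p|U|)`, because `1 - exp (-1) ≥ 5/8`. On the event `N < p|U| / 2` it is at
  -- least `exp (-p|U| / 2)`, and `5/8 - 1/2 = 1/8`.
  set f : Fin n → Bool → ℝ := fun j b => if j ∈ U ∧ b = true then Real.exp (-1) else 1 with hf
  have hprod : ∀ w : Fin n → Bool, ∏ j, f j (w j) =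
      Real.exp (-((U.filter fun j => w j = true).card : ℝ)) := by
    intro w
    rw [hf, Finset.prod_ite, Finset.prod_const, Finset.prod_const_one, mul_one, ← Real.exp_nat_mul,
      mul_neg_one, ← Finset.filter_filter, Finset.filter_univ_mem]
  have he : Real.exp (-1) ≤ 3 / 8 := by
    rw [Real.exp_neg, inv_le_comm₀ (Real.exp_pos _) (by norm_num)]
    have := Real.exp_one_gt_d9
    norm_num at this ⊢
    linarith
  have hint : ∀ j ∈ U, ∫ b, f j b ∂ν ≤ Real.exp (-(5 / 8 * p)) := by
    intro j hj
    have : ∫ b, f j b ∂ν = p * Real.exp (-1) + (1 - p) := by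
      rw [hν, integral_bernoulliMeasure]
      simp [hf, hj, levelProb, hp]
    rw [this]
    have h1 := Real.add_one_le_exp (-(5 / 8 * p))
    nlinarith
  have hint' : ∀ j ∉ U, ∫ b, f j b ∂ν = 1 := by
    intro j hj
    simp only [hf, hj, false_and, if_false, integral_const, probReal_univ, smul_eq_mul, mul_one]
  have hI : ∫ w, ∏ j, f j (w j) ∂(Measure.pi fun _ : Fin n => ν) ≤
      Real.exp (-(5 / 8 * p * U.card)) := by
    rw [integral_fintype_prod_eq_prod, ← Finset.prod_subset (Finset.subset_univ U) fun j _ hj =>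
      hint' j hj]
    refine (Finset.prod_le_prod (fun j _ => integral_nonneg fun b => ?_) hint).trans (le_of_eq ?_)
    · simp only [hf]; positivity
    · rw [Finset.prod_const, ← Real.exp_nat_mul]
      ring_nf
  have hmeas : samplingLaw n {z | (2 : ℝ) ^ (i + 1 : ℕ) *
      (U.filter fun j => z i j = true).card < U.card} = (Measure.pi fun _ : Fin n => ν)
        {w | (2 : ℝ) ^ (i + 1 : ℕ) * (U.filter fun j => w j = true).card < U.card} :=
    (measurePreserving_eval (fun i : Fin (numLevels n + 1) => Measure.pi fun _ : Fin n =>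
      bernoulliMeasure true false (levelProb i.val)) i).measure_preimage
      (s := {w | (2 : ℝ) ^ (i + 1 : ℕ) * (U.filter fun j => w j = true).card < U.card})
      (Set.toFinite _).measurableSet.nullMeasurableSet
  rw [hmeas]
  have hmk := mul_meas_ge_le_integral_of_nonneg (μ := Measure.pi fun _ : Fin n => ν)
    (f := fun w => ∏ j, f j (w j)) (Filter.Eventually.of_forall fun w => by
      simp only [Pi.zero_apply]; rw [hprod]; positivity)
    Integrable.of_finite (Real.exp (-(p * U.card / 2)))
  rw [← ENNReal.ofReal_toReal (measure_ne_top (Measure.pi fun _ : Fin n => ν) _)]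
  refine ENNReal.ofReal_le_ofReal ?_
  have hle : ((Measure.pi fun _ : Fin n => ν) {w | (2 : ℝ) ^ (i + 1 : ℕ) *
      (U.filter fun j => w j = true).card < U.card}).toReal ≤ (Measure.pi fun _ : Fin n => ν).real
        {w | Real.exp (-(p * U.card / 2)) ≤ ∏ j, f j (w j)} := by
    refine measureReal_mono fun w hw => ?_
    simp only [Set.mem_ofPred_eq] at hw ⊢
    rw [hprod, Real.exp_le_exp, neg_le_neg_iff]
    rw [pow_succ] at hw
    rw [hp, one_div_mul_eq_div, div_div, le_div_iff₀ (by positivity)]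
    linarith
  refine hle.trans ?_
  have h3 := hmk.trans hI
  rw [mul_comm, ← le_div_iff₀ (Real.exp_pos _), ← Real.exp_sub] at h3
  refine h3.trans (le_of_eq ?_)
  congr 1
  rw [hp]
  ring

theorem samplingLaw_zero_false {n : ℕ} (j : Fin n) :
    samplingLaw n {z | z 0 j = false} = 0 := by
  have h := samplingLaw_eval (n := n) 0 j
  rw [Fin.val_zero, pow_zero, div_one, ENNReal.ofReal_one] at h
  have h2 := (prob_compl_eq_zero_iff (μ := samplingLaw n) (s := {z | z 0 j = true})
    (Set.toFinite _).measurableSet).2 h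
  convert h2 using 2
  ext z
  simp

/-- With high probability the stacked matrix does not contract the column space of `A` much. -/
theorem samplingLaw_contraction {G : ℝ → ℝ} {C : ℝ} (hG : OrliczAssumption G C) {n d : ℕ}
    (hn : 2 ≤ n) (hd : 1 ≤ d) (A : Matrix (Fin n) (Fin d) ℝ) :
    samplingLaw n {z | ¬ ∀ x : Fin d → ℝ,
      1 / (16384 * (d : ℝ) * ((numLevels n + 1 : ℕ) : ℝ) ^ 3) * orliczNorm G (A.mulVec x) ^ 2 ≤
        ∑ p, (stackedMatrix G z).mulVec (A.mulVec x) p ^ 2} ≤ ENNReal.ofReal (1 / 40) := by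
  obtain ⟨𝒰, hcard, h𝒰⟩ := exists_absSuperlevelSets A
  set l : ℕ := numLevels n + 1 with hl
  -- Then `exp (-Λ / 8) = exp (-8) ^ (d * l)`, which beats the at most `8 ^ (d * l)` pairs of a set
  -- and a level.
  set Λ : ℝ := 64 * (d : ℝ) * l with hΛ
  have hl1 : 1 ≤ l := by omega
  have hdl : 1 ≤ d * l := Nat.mul_pos hd hl1
  have hdl' : (1 : ℝ) ≤ (d : ℝ) * l := by exact_mod_cast hdl
  set bad : Finset (Fin n) × Fin l → Set (Fin l → Fin n → Bool) := fun q =>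
    {z | (2 : ℝ) ^ (q.2 : ℕ) * Λ ≤ q.1.card ∧
      (2 : ℝ) ^ (q.2 + 1 : ℕ) * (q.1.filter fun j => z q.2 j = true).card < q.1.card} with hbad
  -- Outside the bad events the deterministic bound applies to `α⁻¹ • x`, and both sides are
  -- homogeneous of degree two. Here `16384 = 256 * 64`.
  have hsub : {z | ¬ ∀ x : Fin d → ℝ, 1 / (16384 * (d : ℝ) * ((l : ℕ) : ℝ) ^ 3) *
      orliczNorm G (A.mulVec x) ^ 2 ≤ ∑ p, (stackedMatrix G z).mulVec (A.mulVec x) p ^ 2} ⊆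
      (⋃ j, {z | z 0 j = false}) ∪ ⋃ q ∈ 𝒰 ×ˢ Finset.univ, bad q := by
    intro z
    contrapose!
    simp only [Set.mem_union, Set.mem_iUnion, Set.mem_ofPred_eq, not_or, not_exists,
      Finset.mem_product, Finset.mem_univ, and_true, Prod.forall, hbad, Bool.not_eq_false]
    rintro ⟨h0, hS⟩ x
    by_cases hx : A.mulVec x = 0
    · simp [hx, orliczNorm]
    set α := orliczNorm G (A.mulVec x) with hα
    have hα0 : 0 < α := orliczNorm_pos hG hx
    have hsum : ∑ j, G |A.mulVec (α⁻¹ • x) j| = 1 := by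
      rw [← sum_div_orliczNorm hG hx]
      refine Finset.sum_congr rfl fun j _ => ?_
      rw [Matrix.mulVec_smul, Pi.smul_apply, smul_eq_mul, abs_mul, abs_of_pos (inv_pos.2 hα0),
        inv_mul_eq_div]
    have key := le_sum_sq_stackedMatrix hG hn (z := z) hsum (Λ := Λ) (by
      rw [hΛ]; linarith) h0 (fun θ hθ i hi => by
        rw [← Finset.filter_filter]
        exact not_lt.1 fun h => hS _ i (h𝒰 (α⁻¹ • x) θ hθ) ⟨hi, h⟩)
    have e : ∑ p, (stackedMatrix G z).mulVec (A.mulVec (α⁻¹ • x)) p ^ 2 =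
        (α ^ 2)⁻¹ * ∑ p, (stackedMatrix G z).mulVec (A.mulVec x) p ^ 2 := by
      rw [Finset.mul_sum]
      refine Finset.sum_congr rfl fun p _ => ?_
      rw [Matrix.mulVec_smul, Matrix.mulVec_smul, Pi.smul_apply, smul_eq_mul, mul_pow, inv_pow]
    rw [e, inv_mul_eq_div, le_div_iff₀ (by positivity)] at key
    refine not_lt.2 (le_trans (le_of_eq ?_) key)
    rw [hΛ]
    congr 2
    ring
  refine (measure_mono hsub).trans ((measure_union_le _ _).trans ?_)
  rw [measure_iUnion_null fun j => samplingLaw_zero_false j, zero_add]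
  refine (measure_biUnion_finset_le _ _).trans ?_
  have hone : ∀ q ∈ 𝒰 ×ˢ (Finset.univ : Finset (Fin l)),
      samplingLaw n (bad q) ≤ ENNReal.ofReal (Real.exp (-(Λ / 8))) := by
    intro q _
    -- The size condition is deterministic: if it fails, the bad event is empty.
    by_cases hq : (2 : ℝ) ^ (q.2 : ℕ) * Λ ≤ q.1.card
    · refine (measure_mono fun z hz => hz.2).trans ((samplingLaw_few_le q.2 q.1).trans ?_)
      refine ENNReal.ofReal_le_ofReal (Real.exp_le_exp.2 ?_)
      rw [← le_div_iff₀' (by positivity)] at hq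
      linarith
    · have : bad q = ∅ := by
        ext z
        simp [hbad, hq]
      rw [this, measure_empty]
      exact zero_le
  refine (Finset.sum_le_card_nsmul _ _ _ hone).trans ?_
  rw [nsmul_eq_mul, ← ENNReal.ofReal_natCast, ← ENNReal.ofReal_mul (by positivity)]
  refine ENNReal.ofReal_le_ofReal ?_
  have hc : (𝒰 ×ˢ (Finset.univ : Finset (Fin l))).card ≤ 8 ^ (d * l) := by
    rw [Finset.card_product, Finset.card_univ, Fintype.card_fin]
    calc 𝒰.card * l ≤ (n + 1) ^ (2 * d) * l := Nat.mul_le_mul_right _ hcard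
      _ ≤ (2 ^ l) ^ (2 * d) * 2 ^ (d * l) := by
          refine Nat.mul_le_mul (Nat.pow_le_pow_left ?_ _) ?_
          · exact Nat.lt_pow_succ_log_self (by norm_num) n
          · exact (Nat.le_mul_of_pos_left l hd).trans Nat.lt_two_pow_self.le
      _ = 8 ^ (d * l) := by
          rw [← pow_mul, ← pow_add, show (8 : ℕ) = 2 ^ 3 by norm_num, ← pow_mul]
          ring_nf
  have hexp : Real.exp (-(Λ / 8)) = Real.exp (-8) ^ (d * l) := by
    rw [← Real.exp_nat_mul, hΛ]
    push_cast
    ring_nf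
  have h8 : 8 * Real.exp (-8) ≤ 1 / 40 := by
    have h1 : Real.exp 8 = Real.exp 1 ^ 8 := by rw [← Real.exp_nat_mul]; norm_num
    have h2 : (320 : ℝ) ≤ Real.exp 8 := by
      rw [h1]
      calc (320 : ℝ) ≤ 2.7 ^ 8 := by norm_num
        _ ≤ _ := by
          gcongr
          have := Real.exp_one_gt_d9
          linarith
    rw [Real.exp_neg, ← div_eq_mul_inv, div_le_iff₀ (Real.exp_pos _)]
    linarith
  calc _ ≤ ((8 ^ (d * l) : ℕ) : ℝ) * Real.exp (-(Λ / 8)) := by gcongr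
    _ = (8 * Real.exp (-8)) ^ (d * l) := by rw [hexp, mul_pow]; push_cast; rfl
    _ ≤ 8 * Real.exp (-8) :=
        pow_le_of_le_one (by positivity) (h8.trans (by norm_num)) (by omega)
    _ ≤ _ := h8

/-! ### Random signs -/

section

variable {ι : Type} [Fintype ι]

/-- The law of independent uniform signs. -/
noncomputable def signLaw (ι : Type) [Fintype ι] : Measure (ι → ℝ) :=
  Measure.pi fun _ => bernoulliMeasure (1 : ℝ) (-1) (levelProb 1)

instance : IsProbabilityMeasure (signLaw ι) := by
  unfold signLaw
  infer_instance

theorem integrable_sign (f : ℝ → ℝ) :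
    Integrable f (bernoulliMeasure (1 : ℝ) (-1) (levelProb 1)) := by
  rw [bernoulliMeasure_def]
  refine Integrable.add_measure ?_ ?_ <;> exact (integrable_dirac (by simp)).smul_measure_nnreal

theorem integral_sign_pow (k : ℕ) :
    ∫ x, x ^ k ∂(bernoulliMeasure (1 : ℝ) (-1) (levelProb 1)) = (1 + (-1) ^ k) / 2 := by
  rw [integral_bernoulliMeasure]
  simp only [levelProb, pow_one, one_pow, smul_eq_mul]
  ring

theorem integrable_sign_monomial (e : ι → ℕ) :
    Integrable (fun σ => ∏ i, σ i ^ e i) (signLaw ι) :=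
  Integrable.fintype_prod (f := fun i x => x ^ e i) fun _ => integrable_sign _

/-- A single odd exponent makes the integral vanish, so every moment needed below is a matter of
parity. -/
theorem integral_sign_monomial (e : ι → ℕ) :
    ∫ σ, ∏ i, σ i ^ e i ∂(signLaw ι) = ∏ i, (1 + (-1 : ℝ) ^ e i) / 2 := by
  rw [signLaw, integral_fintype_prod_eq_prod (f := fun i x => x ^ e i)]
  simp only [integral_sign_pow]

theorem ae_sign_sq : ∀ᵐ σ ∂(signLaw ι), ∀ i, σ i ^ 2 = 1 := by
  refine ae_all_iff.2 fun i => ?_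
  have h : ∀ᵐ x ∂(bernoulliMeasure (1 : ℝ) (-1) (levelProb 1)), x ^ 2 = 1 := by
    have hm : MeasurableSet {x : ℝ | ¬ x ^ 2 = 1} := by measurability
    rw [ae_iff, bernoulliMeasure_apply_of_notMem_of_notMem _ hm (by simp) (by simp)]
  exact (measurePreserving_eval (fun _ : ι => bernoulliMeasure (1 : ℝ) (-1)
    (levelProb 1)) i).quasiMeasurePreserving.ae h

variable [DecidableEq ι]

/-- The exponents of the monomial `σ p * σ q`. -/
def pairExp (p q i : ι) : ℕ := (if i = p then 1 else 0) + (if i = q then 1 else 0)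

theorem prod_pow_pairExp (σ : ι → ℝ) (p q : ι) : ∏ i, σ i ^ pairExp p q i = σ p * σ q := by
  simp only [pairExp, pow_add, Finset.prod_mul_distrib, pow_ite, pow_one, pow_zero,
    Finset.prod_ite_eq', Finset.mem_univ, if_true]

theorem integrable_sign_pair (p q : ι) : Integrable (fun σ => σ p * σ q) (signLaw ι) := by
  simpa only [prod_pow_pairExp] using integrable_sign_monomial (pairExp p q)

theorem integral_sign_pair (p q : ι) :
    ∫ σ, σ p * σ q ∂(signLaw ι) = if p = q then 1 else 0 := by
  simp only [← prod_pow_pairExp, integral_sign_monomial]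
  split_ifs with h
  · subst h
    refine Finset.prod_eq_one fun i _ => ?_
    simp only [pairExp]
    split_ifs <;> norm_num
  · exact Finset.prod_eq_zero (Finset.mem_univ p) (by simp [pairExp, h])

theorem prod_pow_pairExp_add (σ : ι → ℝ) (p q p' q' : ι) :
    ∏ i, σ i ^ (pairExp p q i + pairExp p' q' i) = (σ p * σ q) * (σ p' * σ q') := by
  simp only [pow_add, Finset.prod_mul_distrib, prod_pow_pairExp]

theorem integrable_sign_quad (p q p' q' : ι) :
    Integrable (fun σ => (σ p * σ q) * (σ p' * σ q')) (signLaw ι) := by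
  simpa only [prod_pow_pairExp_add] using
    integrable_sign_monomial fun i => pairExp p q i + pairExp p' q' i

/-- If the unordered pairs differ, one of `p`, `q` occurs exactly once in the monomial and kills the
integral. -/
theorem integral_sign_quad {p q p' q' : ι} (h : p ≠ q) (h' : p' ≠ q') :
    ∫ σ, (σ p * σ q) * (σ p' * σ q') ∂(signLaw ι) =
      (if p' = p ∧ q' = q then 1 else 0) + (if p' = q ∧ q' = p then 1 else 0) := by
  simp only [← prod_pow_pairExp_add, integral_sign_monomial]
  by_cases h1 : p' = p ∧ q' = q
  · obtain ⟨rfl, rfl⟩ := h1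
    rw [if_pos ⟨rfl, rfl⟩, if_neg (by tauto), add_zero]
    refine Finset.prod_eq_one fun i _ => ?_
    rw [← two_mul, pow_mul]
    norm_num
  by_cases h2 : p' = q ∧ q' = p
  · obtain ⟨rfl, rfl⟩ := h2
    rw [if_neg h1, if_pos ⟨rfl, rfl⟩, zero_add]
    refine Finset.prod_eq_one fun i _ => ?_
    have : pairExp p' q' i = pairExp q' p' i := add_comm _ _
    rw [this, ← two_mul, pow_mul]
    norm_num
  rw [if_neg h1, if_neg h2, add_zero]
  by_cases h3 : p = p' ∨ p = q'
  · refine Finset.prod_eq_zero (Finset.mem_univ q) ?_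
    have a : q ≠ p' := by rintro rfl; rcases h3 with h3 | h3 <;> [exact h h3; exact h2 ⟨rfl, h3.symm⟩]
    have b : q ≠ q' := by rintro rfl; rcases h3 with h3 | h3 <;> [exact h1 ⟨h3.symm, rfl⟩; exact h h3]
    simp [pairExp, h.symm, a, b]
  · push Not at h3
    refine Finset.prod_eq_zero (Finset.mem_univ p) ?_
    simp [pairExp, h, h3.1, h3.2]

theorem integrable_sign_chaos_sq (a : ι × ι → ℝ) :
    Integrable (fun σ => (∑ x, a x * (σ x.1 * σ x.2)) ^ 2) (signLaw ι) := by
  simp only [sq, Finset.sum_mul_sum]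
  refine integrable_finsetSum _ fun x _ => integrable_finsetSum _ fun y _ => ?_
  simp only [mul_mul_mul_comm (a x)]
  exact (integrable_sign_quad _ _ _ _).const_mul _

/-- The variance of an off-diagonal Rademacher chaos. -/
theorem integral_sign_chaos_sq_le (a : ι × ι → ℝ) (ha : ∀ p, a (p, p) = 0) :
    ∫ σ, (∑ x, a x * (σ x.1 * σ x.2)) ^ 2 ∂(signLaw ι) ≤ 2 * ∑ x, a x ^ 2 := by
  -- The coefficients need not be symmetric, so each pair meets both itself and its transpose; the
  -- cross term is removed by the inequality of the means.
  have e : ∫ σ, (∑ x, a x * (σ x.1 * σ x.2)) ^ 2 ∂(signLaw ι) =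
      ∑ x, (a x ^ 2 + a x * a x.swap) := by
    simp only [sq, Finset.sum_mul_sum, mul_mul_mul_comm (a _)]
    rw [integral_finsetSum _ fun x _ => integrable_finsetSum _ fun y _ =>
      (integrable_sign_quad _ _ _ _).const_mul _]
    refine Finset.sum_congr rfl fun x _ => ?_
    rw [integral_finsetSum _ fun y _ => (integrable_sign_quad _ _ _ _).const_mul _]
    simp only [integral_const_mul]
    by_cases hx : x.1 = x.2
    · have : a x = 0 := by
        obtain ⟨p, q⟩ := x
        obtain rfl : p = q := hx
        exact ha p
      simp [this]
    · have : ∀ y : ι × ι, a x * a y * ∫ σ, σ x.1 * σ x.2 * (σ y.1 * σ y.2) ∂(signLaw ι) =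
          (if y = x then a x * a y else 0) + (if y = x.swap then a x * a y else 0) := by
        intro y
        by_cases hy : y.1 = y.2
        · have : a y = 0 := by
            obtain ⟨p, q⟩ := y
            obtain rfl : p = q := hy
            exact ha p
          simp [this]
        · rw [integral_sign_quad hx hy, mul_add, mul_ite, mul_ite, mul_one, mul_zero]
          simp only [Prod.ext_iff, Prod.fst_swap, Prod.snd_swap]
      simp only [this, Finset.sum_add_distrib, Finset.sum_ite_eq', Finset.mem_univ, if_true]
  have hswap : ∑ x : ι × ι, a x.swap ^ 2 = ∑ x, a x ^ 2 :=
    (Equiv.prodComm ι ι).sum_comp fun x => a x ^ 2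
  rw [e]
  calc ∑ x, (a x ^ 2 + a x * a x.swap) ≤ ∑ x, (3 / 2 * a x ^ 2 + 1 / 2 * a x.swap ^ 2) :=
        Finset.sum_le_sum fun x _ => by nlinarith [sq_nonneg (a x - a x.swap)]
    _ = 2 * ∑ x, a x ^ 2 := by
        rw [Finset.sum_add_distrib, ← Finset.mul_sum, ← Finset.mul_sum, hswap]
        ring

/-! ### CountSketch -/

/-- The law of the buckets. -/
noncomputable def hashLaw (ι : Type) [Fintype ι] (m : ℕ) : Measure (ι → Fin m) :=
  Measure.pi fun _ => uniformOn (Set.univ : Set (Fin m))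

instance {m : ℕ} [NeZero m] : IsProbabilityMeasure (uniformOn (Set.univ : Set (Fin m))) :=
  isProbabilityMeasure_uniformOn Set.finite_univ Set.univ_nonempty

instance {m : ℕ} [NeZero m] : IsProbabilityMeasure (hashLaw ι m) := by
  unfold hashLaw
  infer_instance

theorem uniformOn_real_singleton {m : ℕ} (b : Fin m) :
    (uniformOn (Set.univ : Set (Fin m))).real {b} = 1 / m := by
  rw [measureReal_def, uniformOn_univ]
  simp

/-- The collision indicator is a sum over buckets of products over all indices, to which
independence applies: `m * (1 / m) ^ 2`. -/
theorem integral_hash_collision {m : ℕ} [NeZero m] {p q : ι} (hpq : p ≠ q) :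
    ∫ h, (if h p = h q then (1 : ℝ) else 0) ∂(hashLaw ι m) = 1 / m := by
  have e : ∀ h : ι → Fin m, (if h p = h q then (1 : ℝ) else 0) = ∑ b, ∏ i,
      (if i = p ∨ i = q then (if h i = b then 1 else 0) else 1) := by
    intro h
    have : ∀ b, ∏ i, (if i = p ∨ i = q then (if h i = b then (1 : ℝ) else 0) else 1) =
        (if h p = b then 1 else 0) * (if h q = b then 1 else 0) := by
      intro b
      rw [Finset.prod_ite, Finset.prod_const_one, mul_one, Finset.filter_or,
        Finset.filter_eq', Finset.filter_eq', if_pos (Finset.mem_univ _),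
        if_pos (Finset.mem_univ _), ← Finset.insert_eq, Finset.prod_pair hpq]
    simp only [this, ite_mul, one_mul, zero_mul, Finset.sum_ite_eq, Finset.mem_univ, if_true]
    simp only [eq_comm]
  simp only [e]
  rw [integral_finsetSum _ fun b _ => Integrable.of_finite]
  have : ∀ b : Fin m, ∫ h, ∏ i, (if i = p ∨ i = q then (if h i = b then (1 : ℝ) else 0) else 1)
      ∂(hashLaw ι m) = (1 / m) * (1 / m) := by
    intro b
    rw [hashLaw, integral_fintype_prod_eq_prod
      (f := fun i x => if i = p ∨ i = q then (if x = b then (1 : ℝ) else 0) else 1)]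
    have h1 : ∀ i : ι, ∫ x, (if i = p ∨ i = q then (if x = b then (1 : ℝ) else 0) else 1)
        ∂(uniformOn (Set.univ : Set (Fin m))) = if i = p ∨ i = q then (1 / m : ℝ) else 1 := by
      intro i
      split_ifs
      · rw [← uniformOn_real_singleton b, ← integral_indicator_one (by measurability)]
        simp [Set.indicator_apply]
      · simp
    simp only [h1]
    rw [Finset.prod_ite, Finset.prod_const_one, mul_one, Finset.filter_or,
        Finset.filter_eq', Finset.filter_eq', if_pos (Finset.mem_univ _),
        if_pos (Finset.mem_univ _), ← Finset.insert_eq, Finset.prod_pair hpq]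
  simp only [this, Finset.sum_const, Finset.card_univ, Fintype.card_fin, nsmul_eq_mul]
  have : (m : ℝ) ≠ 0 := Nat.cast_ne_zero.2 (NeZero.ne m)
  field_simp

theorem countSketch_inner {m : ℕ} (h : ι → Fin m) (σ u v : ι → ℝ) :
    ∑ b, (countSketch h σ).mulVec u b * (countSketch h σ).mulVec v b =
      ∑ x : ι × ι, (if h x.1 = h x.2 then u x.1 * v x.2 else 0) * (σ x.1 * σ x.2) := by
  simp only [Matrix.mulVec, dotProduct, countSketch_apply, Finset.sum_mul_sum]
  rw [Finset.sum_comm, Fintype.sum_prod_type]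
  refine Finset.sum_congr rfl fun p _ => ?_
  rw [Finset.sum_comm]
  refine Finset.sum_congr rfl fun q _ => ?_
  rw [Finset.sum_eq_single (h p)]
  · rw [if_pos rfl]
    simp only [@eq_comm _ (h q)]
    split_ifs <;> ring
  · intro b _ hb
    simp [hb.symm]
  · simp

/-- CountSketch preserves the squared norm in expectation. -/
theorem lintegral_countSketch_sq {m : ℕ} (h : ι → Fin m) (v : ι → ℝ) :
    ∫⁻ σ, ENNReal.ofReal (∑ b, (countSketch h σ).mulVec v b ^ 2) ∂(signLaw ι) =
      ENNReal.ofReal (∑ p, v p ^ 2) := by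
  have e : ∀ σ : ι → ℝ, ∑ b, (countSketch h σ).mulVec v b ^ 2 =
      ∑ x : ι × ι, (if h x.1 = h x.2 then v x.1 * v x.2 else 0) * (σ x.1 * σ x.2) := fun σ => by
    simp only [sq, ← countSketch_inner]
  have hint : Integrable (fun σ : ι → ℝ =>
      ∑ x : ι × ι, (if h x.1 = h x.2 then v x.1 * v x.2 else 0) * (σ x.1 * σ x.2)) (signLaw ι) :=
    integrable_finsetSum _ fun x _ => (integrable_sign_pair _ _).const_mul _
  simp only [e]
  rw [← ofReal_integral_eq_lintegral_ofReal hint]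
  · rw [integral_finsetSum _ fun x _ => (integrable_sign_pair _ _).const_mul _]
    simp only [integral_const_mul, integral_sign_pair]
    rw [Fintype.sum_prod_type]
    simp [sq]
  · refine Filter.Eventually.of_forall fun σ => ?_
    simp only [← e]
    exact Finset.sum_nonneg fun _ _ => sq_nonneg _

theorem measurable_countSketch_mulVec {m : ℕ} (v : ι → ℝ) (b : Fin m) :
    Measurable fun ω : (ι → Fin m) × (ι → ℝ) => (countSketch ω.1 ω.2).mulVec v b := by
  simp only [Matrix.mulVec, dotProduct, countSketch_apply]
  refine Finset.measurable_fun_sum _ fun i _ => Measurable.mul_const (Measurable.ite ?_ ?_ ?_) _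
  · exact measurableSet_eq_fun (by fun_prop) measurable_const
  · fun_prop
  · fun_prop

/-- CountSketch approximately preserves inner products. -/
theorem lintegral_countSketch_inner_sub_sq_le {m : ℕ} [NeZero m] (u v : ι → ℝ) :
    ∫⁻ ω, ENNReal.ofReal ((∑ b, (countSketch ω.1 ω.2).mulVec u b * (countSketch ω.1 ω.2).mulVec v b
        - ∑ p, u p * v p) ^ 2) ∂((hashLaw ι m).prod (signLaw ι)) ≤
      ENNReal.ofReal (2 / m * ((∑ p, u p ^ 2) * ∑ p, v p ^ 2)) := by
  have hmeas : Measurable fun ω : (ι → Fin m) × (ι → ℝ) => ENNReal.ofReal ((∑ b,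
      (countSketch ω.1 ω.2).mulVec u b * (countSketch ω.1 ω.2).mulVec v b
        - ∑ p, u p * v p) ^ 2) := by
    refine (Measurable.pow_const (Measurable.sub_const (Finset.measurable_fun_sum _ fun b _ => ?_)
      _) 2).ennreal_ofReal
    exact (measurable_countSketch_mulVec u b).mul (measurable_countSketch_mulVec v b)
  -- After the true inner product is subtracted, only collisions of distinct indices remain, since
  -- `σ p ^ 2 = 1` almost surely; each collides with probability `1 / m`.
  set a : (ι → Fin m) → ι × ι → ℝ := fun h x =>
    if h x.1 = h x.2 ∧ x.1 ≠ x.2 then u x.1 * v x.2 else 0 with ha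
  have hinner : ∀ h : ι → Fin m, ∫⁻ σ, ENNReal.ofReal ((∑ b, (countSketch h σ).mulVec u b *
      (countSketch h σ).mulVec v b - ∑ p, u p * v p) ^ 2) ∂(signLaw ι) ≤
      ENNReal.ofReal (2 * ∑ x, a h x ^ 2) := by
    intro h
    have e : ∀ᵐ σ ∂(signLaw ι), ENNReal.ofReal ((∑ b, (countSketch h σ).mulVec u b *
        (countSketch h σ).mulVec v b - ∑ p, u p * v p) ^ 2) =
        ENNReal.ofReal ((∑ x, a h x * (σ x.1 * σ x.2)) ^ 2) := by
      filter_upwards [ae_sign_sq (ι := ι)] with σ hσ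
      congr 2
      rw [countSketch_inner, sub_eq_iff_eq_add]
      have : ∑ p, u p * v p =
          ∑ x : ι × ι, (if x.1 = x.2 then u x.1 * v x.2 else 0) * (σ x.1 * σ x.2) := by
        rw [Fintype.sum_prod_type]
        simp [← sq, hσ]
      rw [this, ← Finset.sum_add_distrib]
      refine Finset.sum_congr rfl fun x _ => ?_
      rw [← add_mul, ha]
      by_cases hx : x.1 = x.2 <;> simp [hx]
    rw [lintegral_congr_ae e, ← ofReal_integral_eq_lintegral_ofReal (integrable_sign_chaos_sq _)
      (Filter.Eventually.of_forall fun σ => sq_nonneg _)]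
    exact ENNReal.ofReal_le_ofReal (integral_sign_chaos_sq_le _ fun p => by simp [ha])
  rw [lintegral_prod _ hmeas.aemeasurable]
  refine (lintegral_mono hinner).trans ?_
  rw [← ofReal_integral_eq_lintegral_ofReal Integrable.of_finite
    (Filter.Eventually.of_forall fun h => by simp only [Pi.zero_apply]; positivity)]
  refine ENNReal.ofReal_le_ofReal ?_
  rw [integral_const_mul, integral_finsetSum _ fun x _ => Integrable.of_finite]
  have hx : ∀ x : ι × ι, ∫ h, a h x ^ 2 ∂(hashLaw ι m) ≤ 1 / m * (u x.1 ^ 2 * v x.2 ^ 2) := by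
    intro x
    by_cases hx : x.1 = x.2
    · simp only [ha, hx, ne_eq, not_true_eq_false, and_false, if_false]
      simp
      positivity
    · have : ∀ h : ι → Fin m, a h x ^ 2 =
          (if h x.1 = h x.2 then (1 : ℝ) else 0) * (u x.1 ^ 2 * v x.2 ^ 2) := by
        intro h
        simp only [ha, hx, ne_eq, not_false_eq_true, and_true]
        split_ifs <;> ring
      simp only [this]
      rw [integral_mul_const, integral_hash_collision hx]
  calc 2 * ∑ x, ∫ h, a h x ^ 2 ∂(hashLaw ι m)
      ≤ 2 * ∑ x : ι × ι, 1 / m * (u x.1 ^ 2 * v x.2 ^ 2) := by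
        gcongr with x
        exact hx x
    _ = _ := by
        rw [← Finset.mul_sum, Fintype.sum_prod_type, Finset.sum_mul_sum]
        ring

theorem sum_smul_sq {J : Type} [Fintype J] {r : ℕ} (c : Fin r → ℝ) (w : Fin r → J → ℝ) :
    ∑ b, (∑ k, c k • w k) b ^ 2 =
      ∑ x : Fin r × Fin r, (c x.1 * c x.2) * ∑ b, w x.1 b * w x.2 b := by
  have : ∀ b, (∑ k, c k • w k) b ^ 2 =
      ∑ x : Fin r × Fin r, (c x.1 * c x.2) * (w x.1 b * w x.2 b) := by
    intro b
    rw [Finset.sum_apply, sq, Finset.sum_mul_sum, Fintype.sum_prod_type]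
    refine Finset.sum_congr rfl fun k _ => Finset.sum_congr rfl fun l _ => ?_
    simp only [Pi.smul_apply, smul_eq_mul]
    ring
  simp only [this, Finset.mul_sum]
  rw [Finset.sum_comm]

theorem sum_smul_sq_of_orthonormal {J : Type} [Fintype J] {r : ℕ} {u : Fin r → J → ℝ}
    (hu : ∀ k l, ∑ p, u k p * u l p = if k = l then 1 else 0) (c : Fin r → ℝ) :
    ∑ p, (∑ k, c k • u k) p ^ 2 = ∑ k, c k ^ 2 := by
  rw [sum_smul_sq]
  simp only [hu, Fintype.sum_prod_type]
  simp [sq]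

/-- CountSketch does not contract the span of an orthonormal family. -/
theorem countSketch_contraction {m r : ℕ} [NeZero m] (u : Fin r → ι → ℝ)
    (hu : ∀ k l, ∑ p, u k p * u l p = if k = l then 1 else 0) :
    ((hashLaw ι m).prod (signLaw ι)) {ω | ¬ ∀ c : Fin r → ℝ,
      1 / 2 * ∑ p, (∑ k, c k • u k) p ^ 2 ≤
        ∑ b, (countSketch ω.1 ω.2).mulVec (∑ k, c k • u k) b ^ 2} ≤
      ENNReal.ofReal (8 * r ^ 2 / m) := by
  -- The deviation of the Gram matrix of the images from that of `u`, entry by entry. If its squared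
  -- Frobenius norm is below `1 / 4`, the quadratic form moves by at most half; Markov's inequality
  -- turns `2 r² / m` into `8 r² / m`.
  set E : (ι → Fin m) × (ι → ℝ) → Fin r × Fin r → ℝ := fun ω x =>
    ∑ b, (countSketch ω.1 ω.2).mulVec (u x.1) b * (countSketch ω.1 ω.2).mulVec (u x.2) b
        - ∑ p, u x.1 p * u x.2 p with hE
  have hEm : ∀ x, Measurable fun ω => E ω x := fun x =>
    Measurable.sub_const (Finset.measurable_fun_sum _ fun b _ =>
      (measurable_countSketch_mulVec (u x.1) b).mul (measurable_countSketch_mulVec (u x.2) b)) _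
  have hsub : {ω | ¬ ∀ c : Fin r → ℝ, 1 / 2 * ∑ p, (∑ k, c k • u k) p ^ 2 ≤
        ∑ b, (countSketch ω.1 ω.2).mulVec (∑ k, c k • u k) b ^ 2} ⊆
      {ω | ENNReal.ofReal (1 / 4) ≤ ∑ x, ENNReal.ofReal (E ω x ^ 2)} := by
    intro ω
    contrapose!
    intro hω
    have hω' : ∑ x, E ω x ^ 2 < 1 / 4 := by
      rw [Set.mem_ofPred_eq, not_le, ← ENNReal.ofReal_sum_of_nonneg fun _ _ => sq_nonneg _,
        ENNReal.ofReal_lt_ofReal_iff (by norm_num)] at hω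
      exact hω
    rw [Set.mem_ofPred_eq]
    push Not
    intro c
    have hlin : (countSketch ω.1 ω.2).mulVec (∑ k, c k • u k) =
        ∑ k, c k • (countSketch ω.1 ω.2).mulVec (u k) := by
      simp only [Matrix.mulVec_sum, Matrix.mulVec_smul]
    have hnorm : ∑ p, (∑ k, c k • u k) p ^ 2 = ∑ k, c k ^ 2 :=
      sum_smul_sq_of_orthonormal hu c
    have hdiff : ∑ b, (countSketch ω.1 ω.2).mulVec (∑ k, c k • u k) b ^ 2 =
        ∑ p, (∑ k, c k • u k) p ^ 2 + ∑ x : Fin r × Fin r, (c x.1 * c x.2) * E ω x := by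
      rw [hlin, sum_smul_sq, sum_smul_sq, ← Finset.sum_add_distrib]
      refine Finset.sum_congr rfl fun x _ => ?_
      rw [hE]
      ring
    have hcs : (∑ x : Fin r × Fin r, (c x.1 * c x.2) * E ω x) ^ 2 ≤
        (∑ k, c k ^ 2) ^ 2 * ∑ x, E ω x ^ 2 := by
      refine (Finset.sum_mul_sq_le_sq_mul_sq _ _ _).trans (le_of_eq ?_)
      congr 1
      rw [Fintype.sum_prod_type, sq (∑ k, c k ^ 2), Finset.sum_mul_sum]
      simp only [mul_pow]
    have h0 : 0 ≤ ∑ k, c k ^ 2 := Finset.sum_nonneg fun _ _ => sq_nonneg _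
    have hcs' : |∑ x : Fin r × Fin r, (c x.1 * c x.2) * E ω x| ≤ 1 / 2 * ∑ k, c k ^ 2 := by
      refine abs_le_of_sq_le_sq (hcs.trans ?_) (by positivity)
      nlinarith [mul_le_mul_of_nonneg_left hω'.le (sq_nonneg (∑ k, c k ^ 2))]
    rw [hdiff, hnorm]
    have := (abs_le.1 hcs').1
    linarith
  refine (measure_mono hsub).trans ?_
  refine (meas_ge_le_lintegral_div (Finset.measurable_fun_sum _ fun x _ =>
    ((hEm x).pow_const 2).ennreal_ofReal).aemeasurable (by simp) (by simp)).trans ?_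
  rw [lintegral_finsetSum _ fun x _ => ((hEm x).pow_const 2).ennreal_ofReal]
  have : ∀ x : Fin r × Fin r, ∫⁻ ω, ENNReal.ofReal (E ω x ^ 2) ∂((hashLaw ι m).prod (signLaw ι)) ≤
      ENNReal.ofReal (2 / m) := by
    intro x
    refine (lintegral_countSketch_inner_sub_sq_le (u x.1) (u x.2)).trans (le_of_eq ?_)
    have h1 : ∀ k, ∑ p, u k p ^ 2 = 1 := fun k => by simpa [sq] using hu k k
    rw [h1, h1, mul_one, mul_one]
  refine (ENNReal.div_le_div_right (Finset.sum_le_card_nsmul _ _ _ fun x _ => this x) _).trans ?_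
  rw [Finset.card_univ, Fintype.card_prod, Fintype.card_fin, nsmul_eq_mul,
    ← ENNReal.ofReal_natCast, ← ENNReal.ofReal_mul (by positivity),
    ← ENNReal.ofReal_div_of_pos (by norm_num)]
  refine ENNReal.ofReal_le_ofReal (le_of_eq ?_)
  push_cast
  ring

end

/-! ### Gaussian vectors -/

/-- The standard Gaussian law. -/
noncomputable def gaussianVec (ι : Type) [Fintype ι] : Measure (ι → ℝ) :=
  Measure.pi fun _ => gaussianReal 0 1

instance {ι : Type} [Fintype ι] : IsProbabilityMeasure (gaussianVec ι) := by
  unfold gaussianVec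
  infer_instance

/-- The law of the Gaussian matrix. -/
noncomputable def gaussianMat (m k : ℕ) : Measure (Fin m → Fin k → ℝ) :=
  Measure.pi fun _ => gaussianVec (Fin k)

instance {m k : ℕ} : IsProbabilityMeasure (gaussianMat m k) := by
  unfold gaussianMat
  infer_instance

/-- Characteristic functions: the exponential of a sum factors over independent coordinates. -/
theorem map_dotProduct_gaussianVec {ι : Type} [Fintype ι] (x : ι → ℝ) :
    (gaussianVec ι).map (fun g => ∑ i, g i * x i) =
      gaussianReal 0 (∑ i, x i ^ 2).toNNReal := by
  have hm : Measurable fun g : ι → ℝ => ∑ i, g i * x i := by fun_prop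
  have : IsProbabilityMeasure ((gaussianVec ι).map (fun g => ∑ i, g i * x i)) :=
    Measure.isProbabilityMeasure_map hm.aemeasurable
  refine Measure.ext_of_charFun ?_
  ext t
  rw [charFun_gaussianReal, charFun_apply_real, integral_map hm.aemeasurable (by fun_prop)]
  have e : ∀ g : ι → ℝ, Complex.exp (t * ((∑ i, g i * x i : ℝ) : ℂ) * Complex.I) =
      ∏ i, Complex.exp (((t * x i : ℝ) : ℂ) * g i * Complex.I) := by
    intro g
    rw [← Complex.exp_sum]
    congr 1
    push_cast
    rw [Finset.mul_sum, Finset.sum_mul]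
    exact Finset.sum_congr rfl fun i _ => by ring
  simp only [e]
  rw [gaussianVec, integral_fintype_prod_eq_prod
    (f := fun i y => Complex.exp (((t * x i : ℝ) : ℂ) * (y : ℝ) * Complex.I))]
  have h1 : ∀ i, ∫ y : ℝ, Complex.exp (((t * x i : ℝ) : ℂ) * y * Complex.I) ∂(gaussianReal 0 1) =
      Complex.exp (-((t * x i : ℝ) : ℂ) ^ 2 / 2) := by
    intro i
    rw [← charFun_apply_real, charFun_gaussianReal]
    congr 1
    simp
    ring
  simp only [h1]
  rw [← Complex.exp_sum]
  congr 1
  rw [Real.coe_toNNReal _ (Finset.sum_nonneg fun _ _ => sq_nonneg _)]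
  push_cast
  rw [Finset.sum_mul, Finset.sum_div, mul_zero, zero_mul, zero_sub, ← Finset.sum_neg_distrib]
  exact Finset.sum_congr rfl fun i _ => by ring

theorem lintegral_gaussian_sq (v : NNReal) :
    ∫⁻ y, ENNReal.ofReal (y ^ 2) ∂(gaussianReal 0 v) = v := by
  have h := evariance_eq_lintegral_ofReal (fun y => y) (gaussianReal 0 v)
  rw [integral_id_gaussianReal] at h
  simp only [sub_zero] at h
  have h2 : MemLp (fun y : ℝ => y) 2 (gaussianReal 0 v) := memLp_id_gaussianReal 2
  rw [← h, ← h2.ofReal_variance_eq, variance_fun_id_gaussianReal, ENNReal.ofReal_coe_nnreal]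

/-- The Gaussian embedding preserves the squared norm in expectation. -/
theorem lintegral_gaussianEmbedding_sq {m k : ℕ} (hm : 0 < m) (x : Fin k → ℝ) :
    ∫⁻ g, ENNReal.ofReal (∑ r, (gaussianEmbedding g).mulVec x r ^ 2) ∂(gaussianMat m k) =
      ENNReal.ofReal (∑ p, x p ^ 2) := by
  have hm' : (0 : ℝ) < m := by exact_mod_cast hm
  have e : ∀ g : Fin m → Fin k → ℝ, ENNReal.ofReal (∑ r, (gaussianEmbedding g).mulVec x r ^ 2) =
      ENNReal.ofReal (1 / m) * ∑ r, ENNReal.ofReal ((∑ i, g r i * x i) ^ 2) := by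
    intro g
    rw [← ENNReal.ofReal_sum_of_nonneg fun _ _ => sq_nonneg _, ← ENNReal.ofReal_mul (by positivity),
      Finset.mul_sum]
    congr 1
    refine Finset.sum_congr rfl fun r _ => ?_
    rw [gaussianEmbedding, Matrix.smul_mulVec, Pi.smul_apply, smul_eq_mul, mul_pow, div_pow,
      Real.sq_sqrt hm'.le, one_pow]
    rfl
  simp only [e]
  rw [lintegral_const_mul _ (by fun_prop), lintegral_finsetSum _ (by fun_prop)]
  have h1 : ∀ r, ∫⁻ g, ENNReal.ofReal ((∑ i, g r i * x i) ^ 2) ∂(gaussianMat m k) =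
      ENNReal.ofReal (∑ p, x p ^ 2) := by
    intro r
    refine ((measurePreserving_eval (fun _ : Fin m => gaussianVec (Fin k)) r).lintegral_comp
      (f := fun w => ENNReal.ofReal ((∑ i, w i * x i) ^ 2)) (by fun_prop)).trans ?_
    rw [← lintegral_map (f := fun y => ENNReal.ofReal (y ^ 2)) (by fun_prop)
        (g := fun w : Fin k → ℝ => ∑ i, w i * x i) (by fun_prop),
      map_dotProduct_gaussianVec, lintegral_gaussian_sq, ENNReal.ofReal]
  simp only [h1, Finset.sum_const, Finset.card_univ, Fintype.card_fin, nsmul_eq_mul]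
  rw [← ENNReal.ofReal_natCast, ← ENNReal.ofReal_mul (by positivity),
    ← ENNReal.ofReal_mul (by positivity), ← mul_assoc, one_div_mul_cancel hm'.ne', one_mul]

/-! ### Concentration -/

theorem integrable_exp_mul_sq_gaussian {s : ℝ} (hs : s < 1 / 2) :
    Integrable (fun y => Real.exp (s * y ^ 2)) (gaussianReal 0 1) ∧
      ∫ y, Real.exp (s * y ^ 2) ∂(gaussianReal 0 1) = Real.sqrt (1 / (1 - 2 * s)) := by
  have e : ∀ y : ℝ, gaussianPDFReal 0 1 y • Real.exp (s * y ^ 2) =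
      (Real.sqrt (2 * Real.pi))⁻¹ * Real.exp (-(1 / 2 - s) * y ^ 2) := by
    intro y
    rw [gaussianPDFReal, smul_eq_mul, mul_assoc, ← Real.exp_add]
    simp only [NNReal.coe_one, mul_one, sub_zero]
    congr 2
    ring
  constructor
  · rw [gaussianReal_of_var_ne_zero 0 one_ne_zero]
    rw [integrable_withDensity_iff_integrable_smul' (measurable_gaussianPDF 0 1)
      (Filter.Eventually.of_forall fun _ => gaussianPDF_lt_top)]
    simp only [toReal_gaussianPDF, e]
    exact (integrable_exp_neg_mul_sq (by linarith)).const_mul _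
  · rw [integral_gaussianReal_eq_integral_smul one_ne_zero]
    simp only [e]
    rw [integral_const_mul, integral_gaussian, ← Real.sqrt_inv, ← Real.sqrt_mul (by positivity)]
    congr 1
    have := Real.pi_pos
    have : 1 - 2 * s ≠ 0 := by linarith
    have : 1 / 2 - s ≠ 0 := by intro h; linarith
    field_simp

/-- Exponential Markov inequality for the chi-square distribution. -/
theorem gaussianVec_chernoff {m : ℕ} {s : ℝ} (hs : s < 1 / 2) {δ : ℝ}
    (hδ : 1 / (1 - 2 * s) ≤ Real.exp (2 * δ)) (a : ℝ) :
    (gaussianVec (Fin m)).real {y | a ≤ s * ∑ i, y i ^ 2} ≤ Real.exp (m * δ - a) := by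
  obtain ⟨hint, hval⟩ := integrable_exp_mul_sq_gaussian hs
  have e : ∀ y : Fin m → ℝ, Real.exp (s * ∑ i, y i ^ 2) = ∏ i, Real.exp (s * y i ^ 2) := by
    intro y
    rw [← Real.exp_sum, Finset.mul_sum]
  have hI : Integrable (fun y : Fin m → ℝ => Real.exp (s * ∑ i, y i ^ 2)) (gaussianVec (Fin m)) := by
    simp only [e]
    exact Integrable.fintype_prod (f := fun _ y => Real.exp (s * y ^ 2)) fun _ => hint
  have hV : ∫ y, Real.exp (s * ∑ i, y i ^ 2) ∂(gaussianVec (Fin m)) ≤ Real.exp (m * δ) := by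
    simp only [e]
    rw [gaussianVec, integral_fintype_prod_eq_prod (f := fun _ y => Real.exp (s * y ^ 2))]
    simp only [hval, Finset.prod_const, Finset.card_univ, Fintype.card_fin]
    rw [Real.exp_nat_mul]
    gcongr
    rw [Real.sqrt_le_left (Real.exp_pos _).le, ← Real.exp_nat_mul]
    rwa [Nat.cast_ofNat]
  have hmk := mul_meas_ge_le_integral_of_nonneg (μ := gaussianVec (Fin m))
    (f := fun y => Real.exp (s * ∑ i, y i ^ 2)) (Filter.Eventually.of_forall fun y =>
    (Real.exp_pos (s * ∑ i, y i ^ 2)).le) hI (Real.exp a)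
  simp only [Real.exp_le_exp] at hmk
  have h3 := hmk.trans hV
  rwa [mul_comm, ← le_div_iff₀ (Real.exp_pos _), ← Real.exp_sub] at h3

/-- The Chernoff bound with `s = ±1/32`. The exponents per coordinate are `17/512 - 18/512` for the
upper tail and `-15/512 + 14/512` for the lower one. -/
theorem gaussianVec_sum_sq_concentration (m : ℕ) :
    (gaussianVec (Fin m)).real {y | m / 8 < |∑ i, y i ^ 2 - m|} ≤ 2 * Real.exp (-(m / 512)) := by
  have h1 := gaussianVec_chernoff (m := m) (s := 1 / 32) (by norm_num) (δ := 17 / 512) (by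
    have := Real.quadratic_le_exp_of_nonneg (x := 2 * (17 / 512)) (by norm_num)
    norm_num at this ⊢
    linarith) (1 / 32 * (9 / 8 * m))
  have h2 := gaussianVec_chernoff (m := m) (s := -1 / 32) (by norm_num) (δ := -15 / 512) (by
    have := Real.add_one_le_exp (2 * (-15 / 512) : ℝ)
    norm_num at this ⊢
    linarith) (-1 / 32 * (7 / 8 * m))
  have hsub : {y : Fin m → ℝ | m / 8 < |∑ i, y i ^ 2 - m|} ⊆
      {y | 1 / 32 * (9 / 8 * m) ≤ 1 / 32 * ∑ i, y i ^ 2} ∪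
      {y | -1 / 32 * (7 / 8 * m) ≤ -1 / 32 * ∑ i, y i ^ 2} := by
    intro y hy
    simp only [Set.mem_ofPred_eq, Set.mem_union] at hy ⊢
    rcases lt_abs.1 hy with h | h
    · left; linarith
    · right; linarith
  refine (measureReal_mono hsub).trans ((measureReal_union_le _ _).trans ?_)
  rw [two_mul]
  refine add_le_add (h1.trans (Real.exp_le_exp.2 ?_)) (h2.trans (Real.exp_le_exp.2 ?_))
  · apply le_of_eq; ring
  · apply le_of_eq; ring

/-- Concentration of the norm of the image of a fixed vector. -/
theorem gaussianMat_concentration (m : ℕ) {k : ℕ} (x : Fin k → ℝ) :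
    gaussianMat m k {g | m / 8 * ∑ p, x p ^ 2 <
      |∑ r, (∑ i, g r i * x i) ^ 2 - m * ∑ p, x p ^ 2|} ≤
      ENNReal.ofReal (2 * Real.exp (-(m / 512))) := by
  set v : ℝ := ∑ p, x p ^ 2 with hv
  have hv0 : 0 ≤ v := Finset.sum_nonneg fun _ _ => sq_nonneg _
  rcases hv0.eq_or_lt with h0 | hpos
  · have hx : ∀ p, x p = 0 := fun p => by
      have := (Finset.sum_eq_zero_iff_of_nonneg fun p _ => sq_nonneg (x p)).1 (hv ▸ h0.symm) p
        (Finset.mem_univ p)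
      simpa using this
    simp [← h0, hx]
  · set w : Fin k → ℝ := fun i => x i / Real.sqrt v with hw
    have hw1 : ∑ i, w i ^ 2 = 1 := by
      simp only [hw, div_pow, Real.sq_sqrt hv0]
      rw [← Finset.sum_div, ← hv, div_self hpos.ne']
    -- The rows are independent, and each has a standard Gaussian inner product with the unit vector
    -- `w`.
    have hlaw : (gaussianMat m k).map (fun g r => ∑ i, g r i * w i) = gaussianVec (Fin m) := by
      have h1 : (gaussianVec (Fin k)).map (fun g => ∑ i, g i * w i) = gaussianReal 0 1 := by
        rw [map_dotProduct_gaussianVec]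
        congr 1
        rw [hw1, Real.toNNReal_one]
      have : ∀ r : Fin m, SigmaFinite ((gaussianVec (Fin k)).map (fun g => ∑ i, g i * w i)) := by
        intro r
        rw [h1]
        infer_instance
      rw [gaussianMat, Measure.pi_map_pi (f := fun _ (g : Fin k → ℝ) => ∑ i, g i * w i)
        (fun _ => Measurable.aemeasurable (by fun_prop))]
      simp only [h1]
      rfl
    have hset : {g : Fin m → Fin k → ℝ | m / 8 * v < |∑ r, (∑ i, g r i * x i) ^ 2 - m * v|} =
        (fun g r => ∑ i, g r i * w i) ⁻¹' {y : Fin m → ℝ | m / 8 < |∑ i, y i ^ 2 - m|} := by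
      ext g
      simp only [Set.mem_ofPred_eq, Set.mem_preimage]
      have h2 : ∑ r, (∑ i, g r i * x i) ^ 2 = v * ∑ r, (∑ i, g r i * w i) ^ 2 := by
        rw [Finset.mul_sum]
        refine Finset.sum_congr rfl fun r _ => ?_
        have : ∑ i, g r i * w i = (∑ i, g r i * x i) / Real.sqrt v := by
          rw [Finset.sum_div]
          exact Finset.sum_congr rfl fun i _ => by rw [hw, mul_div_assoc]
        rw [this, div_pow, Real.sq_sqrt hv0]
        field_simp
      rw [h2, show v * ∑ r, (∑ i, g r i * w i) ^ 2 - m * v =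
        v * (∑ r, (∑ i, g r i * w i) ^ 2 - m) by ring, abs_mul, abs_of_pos hpos, mul_comm,
        mul_lt_mul_iff_right₀ hpos]
    have hms : MeasurableSet {y : Fin m → ℝ | m / 8 < |∑ i, y i ^ 2 - m|} :=
      measurableSet_lt measurable_const (by fun_prop)
    rw [hset, ← Measure.map_apply (by fun_prop) hms, hlaw]
    rw [← ENNReal.ofReal_toReal (measure_ne_top (gaussianVec (Fin m)) _)]
    exact ENNReal.ofReal_le_ofReal (gaussianVec_sum_sq_concentration m)

/-! ### Nets -/

/-- A half-net of the unit ball. -/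
theorem exists_half_net (E : Type) [NormedAddCommGroup E] [NormedSpace ℝ E]
    [FiniteDimensional ℝ E] : ∃ N : Finset E, N.card ≤ 5 ^ Module.finrank ℝ E ∧
      (∀ a ∈ N, ‖a‖ ≤ 1) ∧ ∀ x : E, ‖x‖ ≤ 1 → ∃ a ∈ N, ‖x - a‖ ≤ 1 / 2 := by
  classical
  -- A separated set of maximal cardinality is a net. Doubling turns it into a `1`-separated subset
  -- of the ball of radius `2`, the setting of the packing bound `5 ^ dim`.
  set P : Finset E → Prop := fun N => (∀ a ∈ N, ‖a‖ ≤ 1) ∧ ∀ a ∈ N, ∀ b ∈ N, a ≠ b → 1 / 2 ≤ ‖a - b‖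
  have hcard : ∀ N, P N → N.card ≤ 5 ^ Module.finrank ℝ E := by
    rintro N ⟨h1, h2⟩
    have hinj : Function.Injective fun a : E => (2 : ℝ) • a := smul_right_injective E two_ne_zero
    rw [← Finset.card_image_of_injective N hinj]
    refine Besicovitch.card_le_of_separated _ ?_ ?_
    · intro c hc
      obtain ⟨a, ha, rfl⟩ := Finset.mem_image.1 hc
      rw [norm_smul]
      have := h1 a ha
      norm_num
      linarith
    · intro c hc c' hc' hne
      obtain ⟨a, ha, rfl⟩ := Finset.mem_image.1 hc
      obtain ⟨b, hb, rfl⟩ := Finset.mem_image.1 hc'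
      rw [← smul_sub, norm_smul]
      have := h2 a ha b hb (fun h => hne (by rw [h]))
      norm_num
      linarith
  set K : Set ℕ := {k | ∃ N, P N ∧ N.card = k} with hK
  have hbdd : BddAbove K := ⟨_, by rintro _ ⟨N, hN, rfl⟩; exact hcard N hN⟩
  obtain ⟨N, hN, hNc⟩ := Nat.sSup_mem (s := K) ⟨0, ∅, by simp [P], rfl⟩ hbdd
  refine ⟨N, hcard N hN, hN.1, fun x hx => ?_⟩
  by_contra! hc
  have hxN : x ∉ N := fun h => by
    have := hc x h
    simp at this
    linarith
  have hP : P (insert x N) := by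
    refine ⟨fun a ha => ?_, fun a ha b hb hab => ?_⟩
    · rcases Finset.mem_insert.1 ha with rfl | ha
      exacts [hx, hN.1 a ha]
    · rcases Finset.mem_insert.1 ha with h | ha <;> rcases Finset.mem_insert.1 hb with h' | hb
      · exact absurd (h.trans h'.symm) hab
      · rw [h]; exact (hc b hb).le
      · rw [h', norm_sub_rev]; exact (hc a ha).le
      · exact hN.2 a ha b hb hab
  have := le_csSup hbdd (show (insert x N).card ∈ K from ⟨_, hP, rfl⟩)
  rw [← hNc, Finset.card_insert_of_notMem hxN] at this
  omega

/-- A linear functional is bounded by twice its maximum over a half-net. -/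
theorem abs_le_of_half_net {E : Type} [NormedAddCommGroup E] [NormedSpace ℝ E]
    [FiniteDimensional ℝ E] {N : Finset E} (hN : ∀ x : E, ‖x‖ ≤ 1 → ∃ a ∈ N, ‖x - a‖ ≤ 1 / 2)
    (L : E →ₗ[ℝ] ℝ) {M : ℝ} (hM : ∀ a ∈ N, |L a| ≤ M) {x : E} (hx : ‖x‖ ≤ 1) :
    |L x| ≤ 2 * M := by
  set L' : E →L[ℝ] ℝ := LinearMap.toContinuousLinearMap L with hL'
  have hM0 : 0 ≤ M := by
    obtain ⟨a, ha, -⟩ := hN 0 (by simp)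
    exact (abs_nonneg _).trans (hM a ha)
  have key : ‖L'‖ ≤ M + ‖L'‖ / 2 := by
    -- Rounding `y` to the net costs half the operator norm, which is then absorbed on the left.
    refine ContinuousLinearMap.opNorm_le_of_unit_norm (by positivity) fun y hy => ?_
    obtain ⟨a, ha, hya⟩ := hN y hy.le
    calc ‖L' y‖ = ‖L' a + L' (y - a)‖ := by rw [← map_add, add_sub_cancel]
      _ ≤ ‖L' a‖ + ‖L' (y - a)‖ := norm_add_le _ _
      _ ≤ M + ‖L'‖ * (1 / 2) := by
          refine add_le_add (hM a ha) ((L'.le_opNorm _).trans ?_)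
          gcongr
      _ = _ := by ring
  calc |L x| = ‖L' x‖ := rfl
    _ ≤ ‖L'‖ * ‖x‖ := L'.le_opNorm x
    _ ≤ 2 * M := by nlinarith [norm_nonneg L', norm_nonneg x]

/-- A symmetric bilinear form that is close to the inner product on the sums and differences of
the points of a half-net is close to it everywhere. -/
theorem abs_le_of_half_net_bilin {E : Type} [NormedAddCommGroup E] [InnerProductSpace ℝ E]
    [FiniteDimensional ℝ E] {N : Finset E} (hN1 : ∀ a ∈ N, ‖a‖ ≤ 1)
    (hN : ∀ x : E, ‖x‖ ≤ 1 → ∃ a ∈ N, ‖x - a‖ ≤ 1 / 2)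
    (Q : E →ₗ[ℝ] E →ₗ[ℝ] ℝ) (hQ : ∀ x y, Q x y = Q y x)
    (hp : ∀ a ∈ N, ∀ b ∈ N, |Q (a + b) (a + b)| ≤ 1 / 8 * ‖a + b‖ ^ 2)
    (hm : ∀ a ∈ N, ∀ b ∈ N, |Q (a - b) (a - b)| ≤ 1 / 8 * ‖a - b‖ ^ 2) (x : E) :
    |Q x x| ≤ 1 / 2 * ‖x‖ ^ 2 := by
  have h1 : ∀ a ∈ N, ∀ b ∈ N, |Q a b| ≤ 1 / 8 := by
    intro a ha b hb
    -- Polarization and the parallelogram law: `(‖a + b‖² + ‖a - b‖²) / 32 ≤ 1 / 8`. Passing from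
    -- the net to the ball doubles the bound once in each argument, to `1 / 2`.
    have e : Q a b = (Q (a + b) (a + b) - Q (a - b) (a - b)) / 4 := by
      simp only [map_add, map_sub, LinearMap.add_apply, LinearMap.sub_apply, hQ b a]
      ring
    have hpar := parallelogram_law_with_norm ℝ a b
    have ha1 := hN1 a ha
    have hb1 := hN1 b hb
    have ha0 := norm_nonneg a
    have hb0 := norm_nonneg b
    have := hp a ha b hb
    have := hm a ha b hb
    rw [e, abs_div, abs_of_pos (show (0 : ℝ) < 4 by norm_num), div_le_iff₀ (by norm_num)]
    refine (abs_sub _ _).trans ?_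
    nlinarith
  have h2 : ∀ a ∈ N, ∀ y : E, ‖y‖ ≤ 1 → |Q a y| ≤ 1 / 4 := fun a ha y hy =>
    (abs_le_of_half_net hN (Q a) (h1 a ha) hy).trans (by norm_num)
  have h3 : ∀ x y : E, ‖x‖ ≤ 1 → ‖y‖ ≤ 1 → |Q x y| ≤ 1 / 2 := fun x y hx hy => by
    rw [hQ]
    exact (abs_le_of_half_net hN (Q y) (fun a ha => by rw [hQ]; exact h2 a ha y hy) hx).trans
      (by norm_num)
  rcases eq_or_ne x 0 with rfl | hx
  · simp
  · have hx0 : 0 < ‖x‖ := norm_pos_iff.2 hx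
    have hn : ‖‖x‖⁻¹ • x‖ ≤ 1 := by rw [norm_smul, norm_inv, norm_norm, inv_mul_cancel₀ hx0.ne']
    have h4 := h3 _ _ hn hn
    simp only [map_smul, LinearMap.smul_apply, smul_eq_mul, abs_mul, abs_inv, abs_norm] at h4
    rw [← mul_assoc, ← mul_inv, inv_mul_eq_div, div_le_iff₀ (by positivity)] at h4
    rwa [sq]

/-! ### Subspace embedding -/

/-- The Gaussian embedding does not contract the span of an orthonormal family. -/
theorem gaussianEmbedding_contraction {m k r d : ℕ} (hd : 1 ≤ d) (hr : r ≤ d)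
    (hm : 100000 * (d : ℝ) ≤ m) (u : Fin r → Fin k → ℝ)
    (hu : ∀ k l, ∑ p, u k p * u l p = if k = l then 1 else 0) :
    gaussianMat m k {g | ¬ ∀ c : Fin r → ℝ, 1 / 2 * ∑ p, (∑ k, c k • u k) p ^ 2 ≤
      ∑ b, (gaussianEmbedding g).mulVec (∑ k, c k • u k) b ^ 2} ≤ ENNReal.ofReal (1 / 40) := by
  have hd' : (1 : ℝ) ≤ d := by exact_mod_cast hd
  have hm0 : (0 : ℝ) < m := by linarith
  obtain ⟨N, hNc, hN1, hN⟩ := exists_half_net (EuclideanSpace ℝ (Fin r))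
  set V : EuclideanSpace ℝ (Fin r) → Fin k → ℝ := fun c => ∑ k, c k • u k with hV
  have hVadd : ∀ c c', V (c + c') = V c + V c' := fun c c' => by
    simp only [hV, PiLp.add_apply, add_smul, Finset.sum_add_distrib]
  have hVsmul : ∀ (t : ℝ) c, V (t • c) = t • V c := fun t c => by
    simp only [hV, PiLp.smul_apply, smul_assoc, Finset.smul_sum]
  have hVn : ∀ c, ∑ p, V c p ^ 2 = ‖c‖ ^ 2 := fun c => by
    rw [EuclideanSpace.real_norm_sq_eq]
    exact sum_smul_sq_of_orthonormal hu c
  set bad : (Fin k → ℝ) → Set (Fin m → Fin k → ℝ) := fun x => {g | m / 8 * ∑ p, x p ^ 2 <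
      |∑ r, (∑ i, g r i * x i) ^ 2 - m * ∑ p, x p ^ 2|} with hbad
  have hsub : {g | ¬ ∀ c : Fin r → ℝ, 1 / 2 * ∑ p, (∑ k, c k • u k) p ^ 2 ≤
      ∑ b, (gaussianEmbedding g).mulVec (∑ k, c k • u k) b ^ 2} ⊆
      ⋃ q ∈ N ×ˢ N, (bad (V (q.1 + q.2)) ∪ bad (V (q.1 - q.2))) := by
    intro g
    contrapose!
    simp only [Set.mem_iUnion, Set.mem_union, not_exists, not_or, hbad, Set.mem_ofPred_eq,
      Finset.mem_product, Prod.forall, and_imp, not_lt]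
    intro hg c
    have hmul : ∀ x : Fin k → ℝ, ∑ b, (gaussianEmbedding g).mulVec x b ^ 2 =
        1 / m * ∑ r, (∑ i, g r i * x i) ^ 2 := by
      intro x
      rw [Finset.mul_sum]
      refine Finset.sum_congr rfl fun r _ => ?_
      rw [gaussianEmbedding, Matrix.smul_mulVec, Pi.smul_apply, smul_eq_mul, mul_pow, div_pow,
        Real.sq_sqrt hm0.le, one_pow]
      rfl
    set F : EuclideanSpace ℝ (Fin r) → Fin m → ℝ := fun c r => ∑ i, g r i * V c i with hF
    have hFadd : ∀ c c' r, F (c + c') r = F c r + F c' r := fun c c' r => by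
      simp only [hF, hVadd, Pi.add_apply, mul_add, Finset.sum_add_distrib]
    have hFsmul : ∀ (t : ℝ) c r, F (t • c) r = t * F c r := fun t c r => by
      simp only [hF, hVsmul, Pi.smul_apply, smul_eq_mul, Finset.mul_sum]
      exact Finset.sum_congr rfl fun i _ => by ring
    -- The error form: the Gram form of the images minus the inner product of the coefficient
    -- vectors.
    set Q : EuclideanSpace ℝ (Fin r) →ₗ[ℝ] EuclideanSpace ℝ (Fin r) →ₗ[ℝ] ℝ :=
      LinearMap.mk₂ ℝ (fun c c' => 1 / m * ∑ r, F c r * F c' r - inner ℝ c c')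
        (fun a b c => by
          simp only [hFadd, add_mul, Finset.sum_add_distrib, inner_add_left]; ring)
        (fun t a b => by
          simp only [hFsmul, mul_assoc, ← Finset.mul_sum, real_inner_smul_left, smul_eq_mul]; ring)
        (fun a b c => by
          simp only [hFadd, mul_add, Finset.sum_add_distrib, inner_add_right]; ring)
        (fun t a b => by
          simp only [hFsmul, mul_left_comm _ t, ← Finset.mul_sum, real_inner_smul_right,
            smul_eq_mul]; ring) with hQ
    have hQd : ∀ c, Q c c = 1 / m * ∑ r, F c r ^ 2 - ‖c‖ ^ 2 := fun c => by
      simp only [hQ, LinearMap.mk₂_apply, ← sq, real_inner_self_eq_norm_sq]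
    have hQs : ∀ x y, Q x y = Q y x := fun x y => by
      simp only [hQ, LinearMap.mk₂_apply, mul_comm (F x _), real_inner_comm]
    have hgood : ∀ c, |∑ r, (∑ i, g r i * V c i) ^ 2 - m * ∑ p, V c p ^ 2| ≤
        m / 8 * ∑ p, V c p ^ 2 → |Q c c| ≤ 1 / 8 * ‖c‖ ^ 2 := by
      intro c h
      rw [hVn] at h
      have e : Q c c = (∑ r, F c r ^ 2 - m * ‖c‖ ^ 2) / m := by
        rw [hQd]; field_simp
      rw [e, abs_div, abs_of_pos hm0, div_le_iff₀ hm0]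
      refine h.trans (le_of_eq ?_)
      ring
    have hfin := abs_le_of_half_net_bilin hN1 hN Q hQs
      (fun a ha b hb => hgood _ (hg a b ha hb).1) (fun a ha b hb => hgood _ (hg a b ha hb).2)
      (WithLp.toLp 2 c)
    rw [hQd] at hfin
    have h1 := (abs_le.1 hfin).1
    have h2 : ∑ p, (∑ k, c k • u k) p ^ 2 = ‖WithLp.toLp 2 c‖ ^ 2 := hVn (WithLp.toLp 2 c)
    have h3 : ∑ b, (gaussianEmbedding g).mulVec (∑ k, c k • u k) b ^ 2 =
      1 / m * ∑ r, F (WithLp.toLp 2 c) r ^ 2 := hmul _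
    rw [h2, h3]
    linarith
  refine (measure_mono hsub).trans ((measure_biUnion_finset_le _ _).trans ?_)
  have hone : ∀ q ∈ N ×ˢ N, gaussianMat m k (bad (V (q.1 + q.2)) ∪ bad (V (q.1 - q.2))) ≤
      ENNReal.ofReal (4 * Real.exp (-(m / 512))) := by
    intro q _
    refine (measure_union_le _ _).trans ((add_le_add (gaussianMat_concentration m _)
      (gaussianMat_concentration m _)).trans (le_of_eq ?_))
    rw [← ENNReal.ofReal_add (by positivity) (by positivity)]
    congr 1
    ring
  refine (Finset.sum_le_card_nsmul _ _ _ hone).trans ?_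
  rw [nsmul_eq_mul, ← ENNReal.ofReal_natCast, ← ENNReal.ofReal_mul (by positivity)]
  refine ENNReal.ofReal_le_ofReal ?_
  -- `25 ^ d` pairs, each with two vectors and two tails, against `exp (-9) ^ d`; the hypothesis on
  -- `m` is far more than `m / 512 ≥ 9 * d` requires.
  have hc : (N ×ˢ N).card ≤ 25 ^ d := by
    rw [finrank_euclideanSpace_fin] at hNc
    have : N.card ≤ 5 ^ d := hNc.trans (Nat.pow_le_pow_right (by norm_num) hr)
    rw [Finset.card_product, show (25 : ℕ) = 5 * 5 by norm_num, mul_pow]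
    exact Nat.mul_le_mul this this
  have hexp : Real.exp (-(m / 512)) ≤ Real.exp (-9) ^ d := by
    rw [← Real.exp_nat_mul]
    refine Real.exp_le_exp.2 ?_
    linarith
  have h9 : 25 * Real.exp (-9) ≤ 1 / 160 := by
    have h1 : Real.exp 9 = Real.exp 1 ^ 9 := by rw [← Real.exp_nat_mul]; norm_num
    have h2 : (4000 : ℝ) ≤ Real.exp 9 := by
      rw [h1]
      calc (4000 : ℝ) ≤ 2.7 ^ 9 := by norm_num
        _ ≤ _ := by
          gcongr
          have := Real.exp_one_gt_d9
          linarith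
    rw [Real.exp_neg, ← div_eq_mul_inv, div_le_iff₀ (Real.exp_pos _)]
    linarith
  calc _ ≤ ((25 ^ d : ℕ) : ℝ) * (4 * Real.exp (-9) ^ d) := by gcongr
    _ = 4 * (25 * Real.exp (-9)) ^ d := by rw [mul_pow]; push_cast; ring
    _ ≤ 4 * (25 * Real.exp (-9)) := by
        gcongr
        exact pow_le_of_le_one (by positivity) (h9.trans (by norm_num)) (by omega)
    _ ≤ _ := by linarith

/-- An orthonormal basis of the column space of a matrix. -/
theorem exists_orthonormal_range {ι : Type} [Fintype ι] {d : ℕ} (B : Matrix ι (Fin d) ℝ) :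
    ∃ r ≤ d, ∃ u : Fin r → ι → ℝ, (∀ k l, ∑ p, u k p * u l p = if k = l then 1 else 0) ∧
      ∀ x, ∃ c : Fin r → ℝ, B.mulVec x = ∑ k, c k • u k := by
  set W : Submodule ℝ (EuclideanSpace ℝ ι) :=
    LinearMap.range ((WithLp.linearEquiv 2 ℝ (ι → ℝ)).symm.toLinearMap ∘ₗ B.mulVecLin) with hW
  set b := stdOrthonormalBasis ℝ W with hb
  refine ⟨Module.finrank ℝ W, ?_, fun k p => (b k : EuclideanSpace ℝ ι) p, ?_, ?_⟩
  · exact (LinearMap.finrank_range_le _).trans (by simp)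
  · intro k l
    have h := orthonormal_iff_ite.1 b.orthonormal l k
    rw [Submodule.coe_inner, PiLp.inner_apply] at h
    simp only [eq_comm (a := l)] at h
    rw [← h]
    rfl
  · intro x
    set w : W := ⟨WithLp.toLp 2 (B.mulVec x), LinearMap.mem_range.2 ⟨x, rfl⟩⟩ with hw
    refine ⟨fun k => b.repr w k, ?_⟩
    have h := congrArg (fun v : W => (v : EuclideanSpace ℝ ι)) (b.sum_repr w)
    ext p
    have h2 := congrArg (fun v : EuclideanSpace ℝ ι => v p) h
    simp only [hw] at h2
    rw [Finset.sum_apply]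
    simp only [Submodule.coe_sum, Submodule.coe_smul] at h2
    rw [← hw] at h2
    simpa using h2.symm

/-! ### Auerbach bases -/

/-- `G ∘ |·|` is convex on the whole line, hence continuous also at `0`, which is an endpoint of the
domain of convexity of `G`. -/
theorem OrliczAssumption.continuous_abs {G : ℝ → ℝ} {C : ℝ} (hG : OrliczAssumption G C) :
    Continuous fun x => G |x| := by
  have himg : (fun x : ℝ => |x|) '' Set.univ ⊆ Set.Ici 0 := by
    rintro _ ⟨x, -, rfl⟩
    exact abs_nonneg x
  have hconv : Convex ℝ ((fun x : ℝ => |x|) '' Set.univ) := by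
    have : (fun x : ℝ => |x|) '' Set.univ = Set.Ici 0 :=
      himg.antisymm fun x hx => ⟨x, trivial, abs_of_nonneg hx⟩
    rw [this]
    exact convex_Ici 0
  have h : ConvexOn ℝ Set.univ (G ∘ fun x : ℝ => |x|) :=
    (hG.convex.subset himg hconv).comp ⟨convex_univ, fun x _ y _ a b ha hb _ => by
      simpa [abs_mul, abs_of_nonneg, ha, hb] using abs_add_le (a * x) (b * y)⟩
      (hG.strictMono.monotoneOn.mono himg)
  have := h.continuousOn isOpen_univ
  rwa [continuousOn_univ] at this

theorem sum_smul_inv_orliczNorm {G : ℝ → ℝ} {C : ℝ} (hG : OrliczAssumption G C) {n : ℕ}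
    {y : Fin n → ℝ} (hy : y ≠ 0) : ∑ j, G |((orliczNorm G y)⁻¹ • y) j| = 1 := by
  rw [← sum_div_orliczNorm hG hy]
  refine Finset.sum_congr rfl fun j _ => ?_
  rw [Pi.smul_apply, smul_eq_mul, abs_mul, abs_of_pos (inv_pos.2 (orliczNorm_pos hG hy)),
    inv_mul_eq_div]

/-- Auerbach's lemma for the Orlicz norm. -/
theorem exists_auerbach {G : ℝ → ℝ} {C : ℝ} (hG : OrliczAssumption G C) {n d : ℕ} (hn : 2 ≤ n)
    (A : Matrix (Fin n) (Fin d) ℝ) :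
    ∃ r ≤ d, ∃ u : Fin r → Fin n → ℝ, (∀ k, ∑ j, G |u k j| ≤ 1) ∧
      ∀ x, A.mulVec x ≠ 0 → ∃ c : Fin r → ℝ, A.mulVec x = ∑ k, c k • u k ∧
        ∀ k, |c k| ≤ orliczNorm G (A.mulVec x) := by
  set V := LinearMap.range A.mulVecLin with hV
  set r := Module.finrank ℝ V with hr
  set K : Set V := {v | ∑ j, G |(v : Fin n → ℝ) j| ≤ 1} with hK
  set b : Module.Basis (Fin r) ℝ V := Module.finBasis ℝ V with hb
  obtain ⟨hw0, hGw0⟩ := levelWeight_spec hG hn (0 : Fin (numLevels n + 1))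
  rw [Fin.val_zero, pow_zero, one_mul] at hGw0
  rw [Fin.val_zero] at hw0
  -- The Orlicz ball is closed by continuity, and bounded since `G |v j| ≤ 1 = G (1 / w_0)` bounds
  -- each coordinate.
  have hKc : IsCompact K := by
    refine Metric.isCompact_of_isClosed_isBounded ?_ ?_
    · refine isClosed_le (continuous_finsetSum _ fun j _ => ?_) continuous_const
      exact hG.continuous_abs.comp ((continuous_apply j).comp continuous_subtype_val)
    · refine (Metric.isBounded_closedBall (x := (0 : V))
        (r := 1 / levelWeight G n 0)).subset fun v hv => ?_
      rw [mem_closedBall_zero_iff, Submodule.coe_norm, pi_norm_le_iff_of_nonneg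
        (one_div_nonneg.2 hw0.le)]
      intro j
      refine hG.le_of_apply_le (one_div_nonneg.2 hw0.le) ?_
      rw [hGw0]
      exact (Finset.single_le_sum (f := fun j => G |(v : Fin n → ℝ) j|)
        (fun i _ => hG.nonneg (abs_nonneg _)) (Finset.mem_univ j)).trans hv
  have hnorm : ∀ v : V, v ≠ 0 → (orliczNorm G (v : Fin n → ℝ))⁻¹ • v ∈ K := fun v hv =>
    (sum_smul_inv_orliczNorm hG (y := (v : Fin n → ℝ)) (by simpa using hv)).le
  have hdetc : Continuous fun v : Fin r → V => |b.det v| := by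
    refine Continuous.abs ?_
    rw [show ⇑b.det = fun v => (b.toMatrix v).det from funext fun v => b.det_apply v]
    refine Continuous.matrix_det (continuous_matrix fun i j => ?_)
    simp only [Module.Basis.toMatrix_apply]
    exact ((LinearMap.continuous_of_finiteDimensional (b.coord i)).comp (continuous_apply j))
  set b' : Fin r → V := fun k => (orliczNorm G (b k : Fin n → ℝ))⁻¹ • b k with hb'
  have hb'K : b' ∈ Set.univ.pi fun _ : Fin r => K := fun k _ => hnorm _ (b.ne_zero k)
  -- The Auerbach basis maximizes `|det|` over the ball; the maximum is positive, as a normalized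
  -- basis shows.
  obtain ⟨u, huK, hmax⟩ := (isCompact_univ_pi fun _ : Fin r => hKc).exists_isMaxOn ⟨b', hb'K⟩
    hdetc.continuousOn
  have hdet : 0 < |b.det u| := by
    refine lt_of_lt_of_le ?_ (hmax hb'K)
    simp only [hb', AlternatingMap.map_smul_univ, Module.Basis.det_self, smul_eq_mul, mul_one]
    refine abs_pos.2 (Finset.prod_ne_zero_iff.2 fun k _ => inv_ne_zero (ne_of_gt ?_))
    exact orliczNorm_pos hG (by simpa using b.ne_zero k)
  have hunit : IsUnit (b.det u) := (abs_pos.1 hdet).isUnit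
  obtain ⟨hli, hsp⟩ := (Module.Basis.is_basis_iff_det b).2 hunit
  set u' := Module.Basis.mk hli hsp.ge with hu'
  refine ⟨r, ?_, fun k => (u k : Fin n → ℝ), fun k => huK k trivial, fun x hx => ?_⟩
  · exact (LinearMap.finrank_range_le _).trans (by simp)
  set v : V := ⟨A.mulVec x, x, rfl⟩ with hv
  have hv0 : v ≠ 0 := fun h => hx (congrArg Subtype.val h)
  have hsum : v = ∑ k, u'.repr v k • u k := by
    conv_lhs => rw [← u'.sum_repr v]
    simp [hu']
  refine ⟨fun k => u'.repr v k, ?_, fun k => ?_⟩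
  · have := congrArg Subtype.val hsum
    simpa using this
  · have hα := orliczNorm_pos hG hx
    set α := orliczNorm G (A.mulVec x) with hα'
    -- Exchanging `u k` for the normalized `v` stays in the ball and multiplies the determinant by
    -- `α⁻¹ * c k` (Cramer), so maximality forces `|c k| ≤ α`.
    have hmem : Function.update u k (α⁻¹ • v) ∈ Set.univ.pi fun _ : Fin r => K := by
      intro l _
      rcases eq_or_ne l k with rfl | hl
      · rw [Function.update_self]
        exact hnorm v hv0
      · rw [Function.update_of_ne hl]
        exact huK l trivial
    have hle : |b.det (Function.update u k (α⁻¹ • v))| ≤ |b.det u| := hmax hmem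
    have hval : b.det (Function.update u k (α⁻¹ • v)) = α⁻¹ * u'.repr v k * b.det u := by
      rw [AlternatingMap.map_update_smul, smul_eq_mul, mul_assoc]
      congr 1
      conv_lhs => rw [hsum]
      rw [AlternatingMap.map_update_sum]
      rw [Finset.sum_eq_single k]
      · rw [AlternatingMap.map_update_smul, Function.update_eq_self, smul_eq_mul]
      · intro l _ hl
        rw [AlternatingMap.map_update_smul, AlternatingMap.map_update_self _ _ hl.symm, smul_zero]
      · simp
    rw [hval, abs_mul, mul_le_iff_le_one_left hdet, abs_mul, abs_inv, abs_of_pos hα,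
      inv_mul_le_iff₀ hα, mul_one] at hle
    exact hle

/-! ### Dilation of the stacked matrix -/

section

variable {G : ℝ → ℝ} {C : ℝ} {n : ℕ}

/-- Few coordinates of a vector are so large that level `i` should not sample them. -/
theorem card_large_le (hG : OrliczAssumption G C) (hn : 2 ≤ n) {y : Fin n → ℝ}
    (hy : ∑ j, G |y j| ≤ 1) {T : ℝ} (hT : 1 ≤ T) (i : Fin (numLevels n + 1)) :
    ((Finset.univ.filter fun j => T / levelWeight G n i ≤ |y j|).card : ℝ) * (1 / 2 ^ (i : ℕ)) ≤
      1 / T := by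
  obtain ⟨hw, hGw⟩ := levelWeight_spec hG hn i
  have hT0 : 0 < T := by linarith
  -- One such coordinate contributes at least `T / 2 ^ i` to a sum that is at most `1`.
  have h1 : T * (1 / 2 ^ (i : ℕ)) ≤ G (T / levelWeight G n i) := by
    have := hG.mul_apply_le hT (x := 1 / levelWeight G n i) (by positivity)
    rwa [eq_div_of_mul_eq (by positivity) ((mul_comm _ _).trans hGw), mul_one_div T
      (levelWeight G n i)] at this
  have h2 : ((Finset.univ.filter fun j => T / levelWeight G n i ≤ |y j|).card : ℝ) *
      G (T / levelWeight G n i) ≤ 1 := by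
    refine le_trans ?_ hy
    rw [← nsmul_eq_mul, ← Finset.sum_const]
    refine (Finset.sum_le_sum fun j hj => hG.mono (by positivity)
      (Finset.mem_filter.1 hj).2).trans ?_
    exact Finset.sum_le_sum_of_subset_of_nonneg (Finset.subset_univ _) fun _ _ _ =>
      hG.nonneg (abs_nonneg _)
  rw [le_div_iff₀ hT0]
  refine le_trans ?_ h2
  rw [mul_assoc, mul_comm _ T]
  gcongr

/-- The growth condition bounds the second moment of the small coordinates. -/
theorem small_sq_le (hG : OrliczAssumption G C) (hn : 2 ≤ n) {T x : ℝ} (hT : 1 ≤ T)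
    (i : Fin (numLevels n + 1)) (hx : |x| < T / levelWeight G n i) :
    (levelWeight G n i * x) ^ 2 * (1 / 2 ^ (i : ℕ)) ≤ C * T * G |x| := by
  obtain ⟨hw, hGw⟩ := levelWeight_spec hG hn i
  have hT0 : 0 < T := by linarith
  have hC := hG.const_pos
  rcases eq_or_ne x 0 with rfl | hx0
  · simp [hG.map_zero]
  have hxp : 0 < |x| := abs_pos.2 hx0
  have h1 : T * (1 / 2 ^ (i : ℕ)) ≤ G (T / levelWeight G n i) := by
    have := hG.mul_apply_le hT (x := 1 / levelWeight G n i) (by positivity)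
    rwa [eq_div_of_mul_eq (by positivity) ((mul_comm _ _).trans hGw), mul_one_div T
      (levelWeight G n i)] at this
  -- The chain is `T / 2 ^ i ≤ G (T / w_i) ≤ C (T / (w_i |x|))² G |x|`; then divide by `T`.
  have h2 := hG.growth _ _ hxp hx
  rw [div_le_iff₀ (hG.pos hxp), div_pow, sq_abs] at h2
  have h3 := h1.trans h2
  have hx2 : 0 < x ^ 2 := by positivity
  have e : C * ((T / levelWeight G n i) ^ 2 / x ^ 2) * G |x| =
      T * (C * T * G |x| / (levelWeight G n i * x) ^ 2) := by
    field_simp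
  rw [e] at h3
  have h4 := le_of_mul_le_mul_left h3 hT0
  rwa [le_div_iff₀ (by positivity), mul_comm] at h4

/-- The image of `y` under the stacked matrix, without the coordinates that are large for their
level. -/
noncomputable def truncatedStack (G : ℝ → ℝ) (T : ℝ) (y : Fin n → ℝ)
    (z : Fin (numLevels n + 1) → Fin n → Bool) (p : Fin (numLevels n + 1) × Fin n) : ℝ :=
  if z p.1 p.2 ∧ |y p.2| < T / levelWeight G n p.1 then levelWeight G n p.1 * y p.2 else 0

theorem truncatedStack_eq {T : ℝ} {y : Fin n → ℝ} {z : Fin (numLevels n + 1) → Fin n → Bool}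
    (h : ∀ i j, T / levelWeight G n i.val ≤ |y j| → z i j = false) :
    truncatedStack G T y z = (stackedMatrix G z).mulVec y := by
  ext p
  rw [stackedMatrix_mulVec, truncatedStack]
  by_cases hz : z p.1 p.2 = true
  · have : |y p.2| < T / levelWeight G n p.1 := by
      by_contra! hc
      simp [h _ _ hc] at hz
    simp [hz, this]
  · simp [hz]

/-- By `small_sq_le` every level contributes at most `C * T * ∑ G |y j|` in expectation. -/
theorem lintegral_truncatedStack_le (hG : OrliczAssumption G C) (hn : 2 ≤ n) {y : Fin n → ℝ}
    (hy : ∑ j, G |y j| ≤ 1) {T : ℝ} (hT : 1 ≤ T) :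
    ∫⁻ z, ENNReal.ofReal (∑ p, truncatedStack G T y z p ^ 2) ∂(samplingLaw n) ≤
      ENNReal.ofReal ((numLevels n + 1 : ℕ) * (C * T)) := by
  have hC := hG.const_pos
  have hT0 : 0 < T := by linarith
  have e : ∀ z, ENNReal.ofReal (∑ p, truncatedStack G T y z p ^ 2) = ∑ p : _ × _,
      if z p.1 p.2 then ENNReal.ofReal (if |y p.2| < T / levelWeight G n p.1 then
        (levelWeight G n p.1 * y p.2) ^ 2 else 0) else 0 := by
    intro z
    rw [ENNReal.ofReal_sum_of_nonneg fun _ _ => sq_nonneg _]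
    refine Finset.sum_congr rfl fun p _ => ?_
    rw [truncatedStack]
    split_ifs <;> simp_all
  simp only [e]
  rw [lintegral_finsetSum _ fun p _ => measurable_of_countable _]
  simp only [lintegral_bit]
  calc _ ≤ ∑ p : Fin (numLevels n + 1) × Fin n, ENNReal.ofReal (C * T * G |y p.2|) := by
        refine Finset.sum_le_sum fun p _ => ?_
        rw [← ENNReal.ofReal_mul]
        swap
        · split_ifs <;> positivity
        refine ENNReal.ofReal_le_ofReal ?_
        split_ifs with h
        · exact small_sq_le hG hn hT p.1 h
        · rw [zero_mul]
          exact mul_nonneg (by positivity) (hG.nonneg (abs_nonneg _))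
    _ = ENNReal.ofReal (∑ p : Fin (numLevels n + 1) × Fin n, C * T * G |y p.2|) := by
        rw [ENNReal.ofReal_sum_of_nonneg fun _ _ =>
          mul_nonneg (by positivity) (hG.nonneg (abs_nonneg _))]
    _ ≤ _ := by
        refine ENNReal.ofReal_le_ofReal ?_
        rw [Fintype.sum_prod_type]
        simp only [← Finset.mul_sum, Finset.sum_const, Finset.card_univ, Fintype.card_fin,
          nsmul_eq_mul]
        rw [mul_left_comm, ← mul_assoc _ (C * T)]
        exact mul_le_of_le_one_right (by positivity) hy

/-- With high probability no level samples a coordinate that is too large for it. -/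
theorem samplingLaw_large_le (hG : OrliczAssumption G C) (hn : 2 ≤ n) {r : ℕ}
    {u : Fin r → Fin n → ℝ} (hu : ∀ k, ∑ j, G |u k j| ≤ 1) {T : ℝ} (hT : 1 ≤ T) :
    samplingLaw n {z : Fin (numLevels n + 1) → Fin n → Bool | ¬ ∀ k i j, T / levelWeight G n i.val ≤ |u k j| → z i j = false} ≤
      ENNReal.ofReal (r * ((numLevels n + 1 : ℕ) * (1 / T))) := by
  have hsub : {z : Fin (numLevels n + 1) → Fin n → Bool | ¬ ∀ k i j, T / levelWeight G n i.val ≤ |u k j| → z i j = false} ⊆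
      ⋃ k, ⋃ i : Fin (numLevels n + 1), ⋃ j ∈ Finset.univ.filter fun j =>
        T / levelWeight G n i ≤ |u k j|, {z | z i j = true} := by
    intro z hz
    rw [Set.mem_ofPred_eq] at hz
    push Not at hz
    obtain ⟨k, i, j, h1, h2⟩ := hz
    simp only [Set.mem_iUnion]
    exact ⟨k, i, j, by simpa using h1, by simpa using h2⟩
  have h1 : ∀ k, ∀ i : Fin (numLevels n + 1), samplingLaw n (⋃ j ∈ Finset.univ.filter fun j =>
      T / levelWeight G n i ≤ |u k j|, {z | z i j = true}) ≤ ENNReal.ofReal (1 / T) := by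
    intro k i
    refine (measure_biUnion_finset_le _ _).trans ?_
    simp only [samplingLaw_eval, Finset.sum_const, nsmul_eq_mul]
    rw [← ENNReal.ofReal_natCast, ← ENNReal.ofReal_mul (by positivity)]
    exact ENNReal.ofReal_le_ofReal (card_large_le hG hn (hu k) hT i)
  calc _ ≤ ∑ k : Fin r, ∑ i : Fin (numLevels n + 1), ENNReal.ofReal (1 / T) :=
        (measure_mono hsub).trans ((measure_iUnion_fintype_le _ _).trans (Finset.sum_le_sum
          fun k _ => (measure_iUnion_fintype_le _ _).trans (Finset.sum_le_sum fun i _ => h1 k i)))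
    _ = _ := by
        simp only [Finset.sum_const, Finset.card_univ, Fintype.card_fin, nsmul_eq_mul]
        rw [ENNReal.ofReal_mul (by positivity), ENNReal.ofReal_mul (by positivity),
          ENNReal.ofReal_natCast, ENNReal.ofReal_natCast]

end

/-! ### The sketch as a whole -/

theorem prod_apply_le_of_fiber {α β : Type} [MeasurableSpace α] [MeasurableSpace β]
    {μ : Measure α} {ν : Measure β} [IsProbabilityMeasure μ] [SFinite ν] {s : Set (α × β)}
    (hs : MeasurableSet s) {c : ℝ≥0∞} (h : ∀ x, ν (Prod.mk x ⁻¹' s) ≤ c) : μ.prod ν s ≤ c := by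
  rw [Measure.prod_apply hs]
  calc ∫⁻ x, ν (Prod.mk x ⁻¹' s) ∂μ ≤ ∫⁻ _, c ∂μ := lintegral_mono h
    _ = c := by simp

/-- The quantifier over `x` is uncountable, but the condition cuts out an intersection of closed
sets of pairs of matrices. -/
theorem measurableSet_forall_le {Ω J J' : Type} [MeasurableSpace Ω] [Fintype J] [Fintype J']
    {d : ℕ} {P : Ω → Matrix J (Fin d) ℝ} {Q : Ω → Matrix J' (Fin d) ℝ}
    (hP : ∀ p k, Measurable fun ω => P ω p k) (hQ : ∀ p k, Measurable fun ω => Q ω p k) (c : ℝ) :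
    MeasurableSet {ω | ∀ x : Fin d → ℝ,
      c * ∑ p, (P ω).mulVec x p ^ 2 ≤ ∑ b, (Q ω).mulVec x b ^ 2} := by
  set S : Set ((J → Fin d → ℝ) × (J' → Fin d → ℝ)) := {q | ∀ x : Fin d → ℝ,
    c * ∑ p, (∑ k, q.1 p k * x k) ^ 2 ≤ ∑ b, (∑ k, q.2 b k * x k) ^ 2} with hS
  have hclosed : IsClosed S := by
    rw [hS, Set.ofPred_forall]
    exact isClosed_iInter fun x => isClosed_le (by fun_prop) (by fun_prop)
  have hmeas : Measurable fun ω => ((fun p k => P ω p k : J → Fin d → ℝ),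
      (fun p k => Q ω p k : J' → Fin d → ℝ)) :=
    (measurable_pi_lambda _ fun p => measurable_pi_lambda _ fun k => hP p k).prodMk
      (measurable_pi_lambda _ fun p => measurable_pi_lambda _ fun k => hQ p k)
  exact hmeas hclosed.measurableSet

theorem measurable_mul_apply {Ω I J K : Type} [MeasurableSpace Ω] [Fintype J]
    {P : Ω → Matrix I J ℝ} {Q : Ω → Matrix J K ℝ} (hP : ∀ i j, Measurable fun ω => P ω i j)
    (hQ : ∀ j k, Measurable fun ω => Q ω j k) (i : I) (k : K) :
    Measurable fun ω => (P ω * Q ω) i k := by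
  simp only [Matrix.mul_apply]
  exact Finset.measurable_fun_sum _ fun j _ => (hP i j).mul (hQ j k)

section

variable {G : ℝ → ℝ} {C : ℝ} {n d m₁ m₂ : ℕ}

theorem measurable_stackedMatrix (p : Fin (numLevels n + 1) × Fin n) (j : Fin n) :
    Measurable fun ω : SketchSample n m₁ m₂ => stackedMatrix G ω.1 p j :=
  (measurable_of_countable fun z => stackedMatrix G z p j).comp measurable_fst

theorem measurable_countSketch (b : Fin m₁) (p : Fin (numLevels n + 1) × Fin n) :
    Measurable fun ω : SketchSample n m₁ m₂ => countSketch ω.2.1 ω.2.2.1 b p := by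
  simp only [countSketch_apply]
  refine Measurable.ite (measurableSet_eq_fun ?_ measurable_const) ?_ measurable_const
  · exact (measurable_pi_apply p).comp (measurable_fst.comp measurable_snd)
  · exact (measurable_pi_apply p).comp (measurable_fst.comp (measurable_snd.comp measurable_snd))

theorem measurable_gaussianEmbedding (r : Fin m₂) (b : Fin m₁) :
    Measurable fun ω : SketchSample n m₁ m₂ => gaussianEmbedding ω.2.2.2 r b := by
  have : Measurable fun ω : SketchSample n m₁ m₂ => ω.2.2.2 r b :=
    (measurable_pi_apply b).comp ((measurable_pi_apply r).comp
      (measurable_snd.comp (measurable_snd.comp measurable_snd)))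
  exact this.const_mul (1 / Real.sqrt (m₂ : ℝ))

theorem measurable_sparseSketch (b : Fin m₁) (j : Fin n) :
    Measurable fun ω : SketchSample n m₁ m₂ => sparseSketch G ω b j :=
  measurable_mul_apply measurable_countSketch measurable_stackedMatrix b j

theorem symSketch_eq (ω : SketchSample n m₁ m₂) :
    symSketch G ω = gaussianEmbedding ω.2.2.2 * sparseSketch G ω := Matrix.mul_assoc _ _ _

theorem measurable_symSketch (r : Fin m₂) (j : Fin n) :
    Measurable fun ω : SketchSample n m₁ m₂ => symSketch G ω r j := by
  simp only [symSketch_eq]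
  exact measurable_mul_apply measurable_gaussianEmbedding measurable_sparseSketch r j

theorem measurable_stackedMatrix_mul (A : Matrix (Fin n) (Fin d) ℝ)
    (p : Fin (numLevels n + 1) × Fin n) (k : Fin d) :
    Measurable fun ω : SketchSample n m₁ m₂ => (stackedMatrix G ω.1 * A) p k :=
  measurable_mul_apply (P := fun ω : SketchSample n m₁ m₂ => stackedMatrix G ω.1)
    (Q := fun _ => A) measurable_stackedMatrix (fun _ _ => measurable_const) p k

theorem measurable_sparseSketch_mul (A : Matrix (Fin n) (Fin d) ℝ) (b : Fin m₁) (k : Fin d) :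
    Measurable fun ω : SketchSample n m₁ m₂ => (sparseSketch G ω * A) b k :=
  measurable_mul_apply (P := fun ω : SketchSample n m₁ m₂ => sparseSketch G ω)
    (Q := fun _ => A) measurable_sparseSketch (fun _ _ => measurable_const) b k

theorem measurable_symSketch_mul (A : Matrix (Fin n) (Fin d) ℝ) (r : Fin m₂) (k : Fin d) :
    Measurable fun ω : SketchSample n m₁ m₂ => (symSketch G ω * A) r k :=
  measurable_mul_apply (P := fun ω : SketchSample n m₁ m₂ => symSketch G ω)
    (Q := fun _ => A) measurable_symSketch (fun _ _ => measurable_const) r k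

theorem sketchLaw_eq (n m₁ m₂ : ℕ) : sketchLaw n m₁ m₂ = (samplingLaw n).prod
    ((hashLaw (Fin (numLevels n + 1) × Fin n) m₁).prod
      ((signLaw (Fin (numLevels n + 1) × Fin n)).prod (gaussianMat m₂ m₁))) := rfl

theorem measurableSet_countSketch {J : Type} [Fintype J] [DecidableEq J]
    (M : Matrix J (Fin d) ℝ) :
    MeasurableSet {q : (J → Fin m₁) × (J → ℝ) | ∀ x : Fin d → ℝ,
      1 / 2 * ∑ p, M.mulVec x p ^ 2 ≤ ∑ b, (countSketch q.1 q.2 * M).mulVec x b ^ 2} := by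
  have h : ∀ (b : Fin m₁) (p : J),
      Measurable fun q : (J → Fin m₁) × (J → ℝ) => countSketch q.1 q.2 b p := by
    intro b p
    simp only [countSketch_apply]
    refine Measurable.ite (measurableSet_eq_fun ?_ measurable_const) ?_ measurable_const
    · exact (measurable_pi_apply p).comp measurable_fst
    · exact (measurable_pi_apply p).comp measurable_snd
  exact measurableSet_forall_le (P := fun _ : (J → Fin m₁) × (J → ℝ) => M)
    (Q := fun q => countSketch q.1 q.2 * M) (fun _ _ => measurable_const)
    (fun b k => measurable_mul_apply (P := fun q : (J → Fin m₁) × (J → ℝ) => countSketch q.1 q.2)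
      (Q := fun _ => M) h (fun _ _ => measurable_const) b k) _

/-- With high probability CountSketch does not contract the column space of a matrix. -/
theorem countSketch_mul_contraction {J : Type} [Fintype J] [DecidableEq J] [NeZero m₁]
    (hm₁ : 320 * (d : ℝ) ^ 2 ≤ m₁) (M : Matrix J (Fin d) ℝ) :
    ((hashLaw J m₁).prod (signLaw J)) {q | ¬ ∀ x : Fin d → ℝ,
      1 / 2 * ∑ p, M.mulVec x p ^ 2 ≤ ∑ b, (countSketch q.1 q.2 * M).mulVec x b ^ 2} ≤
      ENNReal.ofReal (1 / 40) := by
  obtain ⟨r, hr, u, hu, hspan⟩ := exists_orthonormal_range M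
  have hsub : {q : (J → Fin m₁) × (J → ℝ) | ¬ ∀ x : Fin d → ℝ,
      1 / 2 * ∑ p, M.mulVec x p ^ 2 ≤ ∑ b, (countSketch q.1 q.2 * M).mulVec x b ^ 2} ⊆
      {q | ¬ ∀ c : Fin r → ℝ, 1 / 2 * ∑ p, (∑ k, c k • u k) p ^ 2 ≤
        ∑ b, (countSketch q.1 q.2).mulVec (∑ k, c k • u k) b ^ 2} := by
    intro q hq hall
    refine hq fun x => ?_
    obtain ⟨c, hc⟩ := hspan x
    rw [← Matrix.mulVec_mulVec, hc]
    exact hall c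
  refine (measure_mono hsub).trans ((countSketch_contraction u hu).trans ?_)
  refine ENNReal.ofReal_le_ofReal ?_
  have hm0 : (0 : ℝ) < m₁ := by exact_mod_cast NeZero.pos m₁
  have hr' : (r : ℝ) ≤ d := by exact_mod_cast hr
  rw [div_le_iff₀ hm0]
  have : (r : ℝ) ^ 2 ≤ (d : ℝ) ^ 2 := by gcongr
  linarith

/-- With high probability CountSketch does not contract the image of the stacked matrix. -/
theorem sketchLaw_countSketch [NeZero m₁] (G : ℝ → ℝ) (hm₁ : 320 * (d : ℝ) ^ 2 ≤ m₁)
    (A : Matrix (Fin n) (Fin d) ℝ) :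
    sketchLaw n m₁ m₂ {ω | ¬ ∀ x : Fin d → ℝ,
      1 / 2 * ∑ p, (stackedMatrix G ω.1 * A).mulVec x p ^ 2 ≤
        ∑ b, (sparseSketch G ω * A).mulVec x b ^ 2} ≤ ENNReal.ofReal (1 / 40) := by
  have hms : MeasurableSet {ω : SketchSample n m₁ m₂ | ∀ x : Fin d → ℝ,
      1 / 2 * ∑ p, (stackedMatrix G ω.1 * A).mulVec x p ^ 2 ≤
        ∑ b, (sparseSketch G ω * A).mulVec x b ^ 2} :=
    measurableSet_forall_le (P := fun ω => stackedMatrix G ω.1 * A)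
      (Q := fun ω => sparseSketch G ω * A)
      (fun p k => measurable_stackedMatrix_mul (G := G) (m₁ := m₁) (m₂ := m₂) A p k)
      (measurable_sparseSketch_mul A) _
  rw [sketchLaw_eq]
  -- With the sampling bits fixed, the matrix to be embedded is deterministic; the Gaussian factor
  -- is then projected away.
  refine prod_apply_le_of_fiber hms.compl fun z => ?_
  have hmp : MeasurePreserving (Prod.map id Prod.fst)
      ((hashLaw (Fin (numLevels n + 1) × Fin n) m₁).prod
        ((signLaw (Fin (numLevels n + 1) × Fin n)).prod (gaussianMat m₂ m₁)))
      ((hashLaw (Fin (numLevels n + 1) × Fin n) m₁).prod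
        (signLaw (Fin (numLevels n + 1) × Fin n))) :=
    (MeasurePreserving.id _).prod measurePreserving_fst
  have hpre := hmp.measure_preimage
    (measurableSet_countSketch (stackedMatrix G z * A)).compl.nullMeasurableSet
  refine le_trans (le_of_eq ?_) (hpre.le.trans (countSketch_mul_contraction hm₁ _))
  congr 1
  ext q
  simp only [Set.mem_preimage, Set.mem_compl_iff, Set.mem_ofPred_eq, Prod.map, id,
    sparseSketch, Matrix.mul_assoc]

/-- With high probability the Gaussian embedding does not contract its input. -/
theorem sketchLaw_gaussian [NeZero m₁] (G : ℝ → ℝ) (hd : 1 ≤ d) (hm₂ : 100000 * (d : ℝ) ≤ m₂)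
    (A : Matrix (Fin n) (Fin d) ℝ) :
    sketchLaw n m₁ m₂ {ω | ¬ ∀ x : Fin d → ℝ,
      1 / 2 * ∑ p, (sparseSketch G ω * A).mulVec x p ^ 2 ≤
        ∑ b, (symSketch G ω * A).mulVec x b ^ 2} ≤ ENNReal.ofReal (1 / 40) := by
  have hms : MeasurableSet {ω : SketchSample n m₁ m₂ | ∀ x : Fin d → ℝ,
      1 / 2 * ∑ p, (sparseSketch G ω * A).mulVec x p ^ 2 ≤
        ∑ b, (symSketch G ω * A).mulVec x b ^ 2} :=
    measurableSet_forall_le (P := fun ω => sparseSketch G ω * A)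
      (Q := fun ω => symSketch G ω * A) (measurable_sparseSketch_mul A)
      (measurable_symSketch_mul A) _
  rw [sketchLaw_eq]
  refine prod_apply_le_of_fiber hms.compl fun z => ?_
  have hms₁ := measurable_prodMk_left (x := z) hms.compl
  refine prod_apply_le_of_fiber hms₁ fun h => ?_
  have hms₂ := measurable_prodMk_left (x := h) hms₁
  refine prod_apply_le_of_fiber hms₂ fun σ => ?_
  set M := countSketch h σ * stackedMatrix G z * A with hM
  obtain ⟨r, hr, u, hu, hspan⟩ := exists_orthonormal_range M
  refine (measure_mono ?_).trans (gaussianEmbedding_contraction hd hr hm₂ u hu)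
  intro g hg hall
  refine hg fun x => ?_
  obtain ⟨c, hc⟩ := hspan x
  have e1 : sparseSketch G (z, h, σ, g) * A = M := rfl
  have e2 : symSketch G (z, h, σ, g) * A = gaussianEmbedding g * M := by
    rw [symSketch_eq, Matrix.mul_assoc, e1]
  rw [e1, e2, ← Matrix.mulVec_mulVec x (gaussianEmbedding g) M, hc]
  exact hall c

/-- An event that only involves the sampling bits has the probability that `samplingLaw` assigns
to it. -/
theorem sketchLaw_sampling [NeZero m₁] (p : (Fin (numLevels n + 1) → Fin n → Bool) → Prop) :
    sketchLaw n m₁ m₂ {ω | p ω.1} = samplingLaw n {z | p z} :=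
  (measurePreserving_sampling n m₁ m₂).measure_preimage
    (s := {z : Fin (numLevels n + 1) → Fin n → Bool | p z})
    (Set.toFinite _).measurableSet.nullMeasurableSet

/-- With high probability the sketch does not contract the column space of `A` much. -/
theorem sketchLaw_contraction [NeZero m₁] (hG : OrliczAssumption G C) (hn : 2 ≤ n) (hd : 1 ≤ d)
    (hm₁ : 320 * (d : ℝ) ^ 2 ≤ m₁) (hm₂ : 100000 * (d : ℝ) ≤ m₂)
    (A : Matrix (Fin n) (Fin d) ℝ) :
    sketchLaw n m₁ m₂ {ω | ¬ ∀ x : Fin d → ℝ,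
      1 / (65536 * (d : ℝ) * ((numLevels n + 1 : ℕ) : ℝ) ^ 3) * orliczNorm G (A.mulVec x) ^ 2 ≤
        ∑ b, (symSketch G ω * A).mulVec x b ^ 2} ≤ ENNReal.ofReal (3 / 40) := by
  have h1 : sketchLaw n m₁ m₂ {ω | ¬ ∀ x : Fin d → ℝ,
      1 / (16384 * (d : ℝ) * ((numLevels n + 1 : ℕ) : ℝ) ^ 3) * orliczNorm G (A.mulVec x) ^ 2 ≤
        ∑ p, (stackedMatrix G ω.1).mulVec (A.mulVec x) p ^ 2} ≤ ENNReal.ofReal (1 / 40) := by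
    refine le_trans (le_of_eq ?_) (samplingLaw_contraction hG hn hd A)
    exact sketchLaw_sampling fun z => ¬ ∀ x : Fin d → ℝ,
      1 / (16384 * (d : ℝ) * ((numLevels n + 1 : ℕ) : ℝ) ^ 3) * orliczNorm G (A.mulVec x) ^ 2 ≤
        ∑ p, (stackedMatrix G z).mulVec (A.mulVec x) p ^ 2
  have h2 := sketchLaw_countSketch (n := n) (m₂ := m₂) G hm₁ A
  have h3 := sketchLaw_gaussian (n := n) (m₁ := m₁) G hd hm₂ A
  refine (measure_mono ?_).trans ((measure_union_le _ _).trans ((add_le_add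
    ((measure_union_le _ _).trans (add_le_add h1 h2)) h3).trans (le_of_eq ?_)))
  · intro ω
    contrapose!
    simp only [Set.mem_union, not_or, Set.mem_ofPred_eq]
    push Not
    rintro ⟨⟨a1, a2⟩, a3⟩ x
    have b1 := a1 x
    have b2 := a2 x
    have b3 := a3 x
    rw [← Matrix.mulVec_mulVec] at b2
    have e : 1 / (65536 * (d : ℝ) * ((numLevels n + 1 : ℕ) : ℝ) ^ 3) *
        orliczNorm G (A.mulVec x) ^ 2 = 1 / 4 * (1 / (16384 * (d : ℝ) *
          ((numLevels n + 1 : ℕ) : ℝ) ^ 3) * orliczNorm G (A.mulVec x) ^ 2) := by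
      have : (d : ℝ) ≠ 0 := by positivity
      field_simp
      ring
    rw [e]
    linarith
  · rw [← ENNReal.ofReal_add (by norm_num) (by norm_num), ← ENNReal.ofReal_add (by norm_num)
      (by norm_num)]
    norm_num

/-- The two unstructured factors of the sketch preserve squared norms in expectation. -/
theorem lintegral_embedding_le [NeZero m₁] (hm₂ : 0 < m₂)
    (v : (Fin (numLevels n + 1) → Fin n → Bool) → Fin (numLevels n + 1) × Fin n → ℝ) :
    ∫⁻ ω, ENNReal.ofReal (∑ b, (gaussianEmbedding ω.2.2.2).mulVec
        ((countSketch ω.2.1 ω.2.2.1).mulVec (v ω.1)) b ^ 2) ∂(sketchLaw n m₁ m₂) ≤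
      ∫⁻ z, ENNReal.ofReal (∑ p, v z p ^ 2) ∂(samplingLaw n) := by
  rw [sketchLaw_eq]
  -- The inequality half of Tonelli's theorem suffices and asks for no joint measurability.
  refine (lintegral_prod_le _).trans (lintegral_mono fun z => ?_)
  refine (lintegral_prod_le _).trans ?_
  refine (lintegral_mono (g := fun _ => ENNReal.ofReal (∑ p, v z p ^ 2)) fun h => ?_).trans
    (by simp)
  refine (lintegral_prod_le _).trans ?_
  simp only [lintegral_gaussianEmbedding_sq hm₂]
  exact (lintegral_countSketch_sq h (v z)).le

/-- With high probability the sketch does not dilate the column space of `A` much. -/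
theorem sketchLaw_dilation [NeZero m₁] (hG : OrliczAssumption G C) (hn : 2 ≤ n) (hd : 1 ≤ d)
    (hm₂ : 0 < m₂) (A : Matrix (Fin n) (Fin d) ℝ) :
    sketchLaw n m₁ m₂ {ω | ¬ ∀ x : Fin d → ℝ, ∑ b, (symSketch G ω * A).mulVec x b ^ 2 ≤
      25600 * C * (d : ℝ) ^ 3 * ((numLevels n + 1 : ℕ) : ℝ) ^ 2 *
        orliczNorm G (A.mulVec x) ^ 2} ≤ ENNReal.ofReal (1 / 80) := by
  have hC := hG.const_pos
  set l : ℝ := ((numLevels n + 1 : ℕ) : ℝ) with hl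
  have hl1 : 1 ≤ l := by rw [hl]; exact_mod_cast Nat.le_add_left 1 _
  have hd1 : (1 : ℝ) ≤ d := by exact_mod_cast hd
  -- Chosen so that `r * l / T ≤ 1 / 160` for every `r ≤ d`.
  set T : ℝ := 160 * d * l with hT
  have hdl : 1 ≤ (d : ℝ) * l := one_le_mul_of_one_le_of_one_le hd1 hl1
  have hT1 : 1 ≤ T := by rw [hT]; linarith
  obtain ⟨r, hr, u, hu, hspan⟩ := exists_auerbach hG hn A
  have hr' : (r : ℝ) ≤ d := by exact_mod_cast hr
  set Φ : SketchSample n m₁ m₂ → Fin r → ℝ := fun ω k => ∑ b, (gaussianEmbedding ω.2.2.2).mulVec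
    ((countSketch ω.2.1 ω.2.2.1).mulVec (truncatedStack G T (u k) ω.1)) b ^ 2 with hΦ
  have hΦ0 : ∀ ω k, 0 ≤ Φ ω k := fun ω k => Finset.sum_nonneg fun _ _ => sq_nonneg _
  have hΦm : ∀ k, Measurable fun ω => ENNReal.ofReal (Φ ω k) := by
    intro k
    refine Measurable.ennreal_ofReal (Finset.measurable_fun_sum _ fun b _ =>
      Measurable.pow_const ?_ 2)
    simp only [Matrix.mulVec, dotProduct]
    refine Finset.measurable_fun_sum _ fun i _ => (measurable_gaussianEmbedding b i).mul
      (Finset.measurable_fun_sum _ fun p _ => (measurable_countSketch i p).mul ?_)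
    exact (measurable_of_countable fun z => truncatedStack G T (u k) z p).comp measurable_fst
  -- `160` times the bound on the expectation of the sum over the basis, for Markov's inequality.
  set R : ℝ := 160 * (d * (l * (C * T))) with hR
  have hR0 : 0 < R := by positivity
  have hlarge : sketchLaw n m₁ m₂ {ω | ¬ ∀ k i j, T / levelWeight G n i.val ≤ |u k j| →
      ω.1 i j = false} ≤ ENNReal.ofReal (1 / 160) := by
    rw [sketchLaw_sampling fun z : Fin (numLevels n + 1) → Fin n → Bool =>
      ¬ ∀ k i j, T / levelWeight G n i.val ≤ |u k j| → z i j = false]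
    refine (samplingLaw_large_le hG hn hu hT1).trans (ENNReal.ofReal_le_ofReal ?_)
    rw [← hl, mul_one_div, hT, mul_div_assoc', div_le_div_iff₀ (by positivity) (by norm_num)]
    nlinarith
  have hmarkov : sketchLaw n m₁ m₂ {ω | ENNReal.ofReal R ≤ ∑ k, ENNReal.ofReal (Φ ω k)} ≤
      ENNReal.ofReal (1 / 160) := by
    refine (meas_ge_le_lintegral_div (Finset.measurable_fun_sum _ fun k _ => hΦm k).aemeasurable
      (by simpa using hR0) (by simp)).trans ?_
    rw [lintegral_finsetSum _ fun k _ => hΦm k]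
    have hk : ∀ k, ∫⁻ ω, ENNReal.ofReal (Φ ω k) ∂(sketchLaw n m₁ m₂) ≤
        ENNReal.ofReal (l * (C * T)) := fun k =>
      (lintegral_embedding_le hm₂ fun z => truncatedStack G T (u k) z).trans
        (lintegral_truncatedStack_le hG hn (hu k) hT1)
    refine (ENNReal.div_le_div_right (Finset.sum_le_card_nsmul _ _ _ fun k _ => hk k) _).trans ?_
    rw [Finset.card_univ, Fintype.card_fin, nsmul_eq_mul, ← ENNReal.ofReal_natCast,
      ← ENNReal.ofReal_mul (by positivity), ← ENNReal.ofReal_div_of_pos hR0]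
    refine ENNReal.ofReal_le_ofReal ?_
    rw [div_le_div_iff₀ hR0 (by norm_num), hR]
    have : r * (l * (C * T)) ≤ d * (l * (C * T)) := by gcongr
    linarith
  refine (measure_mono ?_).trans ((measure_union_le _ _).trans ((add_le_add hlarge hmarkov).trans
    (le_of_eq ?_)))
  · intro ω
    contrapose!
    simp only [Set.mem_union, not_or, Set.mem_ofPred_eq, not_le]
    push Not
    rintro ⟨hω, hsum⟩ x
    rw [← ENNReal.ofReal_sum_of_nonneg fun k _ => hΦ0 ω k,
      ENNReal.ofReal_lt_ofReal_iff hR0] at hsum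
    by_cases hx : A.mulVec x = 0
    · simp [← Matrix.mulVec_mulVec, hx, orliczNorm]
    obtain ⟨c, hc, hcb⟩ := hspan x hx
    set α := orliczNorm G (A.mulVec x) with hα
    have hα0 : 0 < α := orliczNorm_pos hG hx
    have hS : (symSketch G ω * A).mulVec x = ∑ k, c k • (symSketch G ω).mulVec (u k) := by
      rw [← Matrix.mulVec_mulVec, hc]
      simp only [Matrix.mulVec_sum, Matrix.mulVec_smul]
    have hΦeq : ∀ k, Φ ω k = ∑ b, (symSketch G ω).mulVec (u k) b ^ 2 := by
      intro k
      simp only [hΦ]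
      -- On this event no large coordinate was sampled, so the truncation has changed nothing.
      rw [truncatedStack_eq (hω k)]
      simp only [symSketch, Matrix.mulVec_mulVec, Matrix.mul_assoc]
    have hc2 : ∑ k, c k ^ 2 ≤ d * α ^ 2 := by
      calc ∑ k, c k ^ 2 ≤ ∑ k : Fin r, α ^ 2 :=
            Finset.sum_le_sum fun k _ => sq_le_sq' (by linarith [(abs_le.1 (hcb k)).1])
              (abs_le.1 (hcb k)).2
        _ = r * α ^ 2 := by simp
        _ ≤ d * α ^ 2 := by gcongr
    calc ∑ b, (symSketch G ω * A).mulVec x b ^ 2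
        ≤ ∑ b, (∑ k, c k ^ 2) * ∑ k, (symSketch G ω).mulVec (u k) b ^ 2 := by
          refine Finset.sum_le_sum fun b _ => ?_
          rw [hS, Finset.sum_apply]
          exact Finset.sum_mul_sq_le_sq_mul_sq _ _ _
      _ = (∑ k, c k ^ 2) * ∑ k, Φ ω k := by
          rw [← Finset.mul_sum, Finset.sum_comm]
          simp only [hΦeq]
      _ ≤ (d * α ^ 2) * R := by
          gcongr
      _ = _ := by rw [hR, hT]; ring
  · rw [← ENNReal.ofReal_add (by norm_num) (by norm_num)]
    norm_num

end

/-- A set contains an event of large probability if the complement of the event is small. -/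
theorem ofReal_le_measure_of_compl {Ω : Type} [MeasurableSpace Ω] {μ : Measure Ω}
    [IsProbabilityMeasure μ] {bad s : Set Ω} {p : ℝ} (hp : p ≤ 1)
    (hbad : μ bad ≤ ENNReal.ofReal (1 - p))
    (hs : ∀ ω, ω ∉ bad → ω ∈ s) : ENNReal.ofReal p ≤ μ s := by
  -- Only subadditivity is used, so neither set has to be measurable.
  have h1 : (1 : ℝ≥0∞) ≤ μ s + ENNReal.ofReal (1 - p) := by
    calc (1 : ℝ≥0∞) = μ Set.univ := measure_univ.symm
      _ ≤ μ (s ∪ bad) := measure_mono fun ω _ => by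
          by_cases h : ω ∈ bad
          exacts [Or.inr h, Or.inl (hs ω h)]
      _ ≤ μ s + μ bad := measure_union_le _ _
      _ ≤ _ := by gcongr
  refine ENNReal.ofReal_le_of_le_toReal ?_
  have h2 := ENNReal.toReal_mono (by simp [measure_ne_top]) h1
  rw [ENNReal.toReal_one, ENNReal.toReal_add (measure_ne_top _ _) (by simp),
    ENNReal.toReal_ofReal (by linarith)] at h2
  linarith

/-- From bounds on the squared norm in terms of the number of levels to bounds on the norm in
terms of `log n`. -/
theorem distortion_of_sq {m : ℕ} {d l C N lg : ℝ} {v : Fin m → ℝ} (hd : 1 ≤ d) (hC : 0 < C)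
    (hN : 0 ≤ N) (hlg : 0.69 ≤ lg) (hl0 : 0 < l) (hl : l ≤ 3 * lg)
    (hlow : 1 / (65536 * d * l ^ 3) * N ^ 2 ≤ ∑ b, v b ^ 2)
    (hup : ∑ b, v b ^ 2 ≤ 25600 * C * d ^ 3 * l ^ 2 * N ^ 2) :
    1 / 4096 / (Real.sqrt d * lg ^ 3) * N ≤ l2norm v ∧
      l2norm v ≤ 2000 * (Real.sqrt C * d ^ 2 * lg ^ (7 / 2 : ℝ)) * N := by
  have hlg0 : 0 < lg := by linarith
  have hd0 : 0 < d := by linarith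
  constructor
  · refine Real.le_sqrt_of_sq_le (le_trans ?_ hlow)
    rw [mul_pow, div_pow, mul_pow, Real.sq_sqrt hd0.le]
    refine mul_le_mul_of_nonneg_right ?_ (sq_nonneg N)
    rw [div_le_div_iff₀ (by positivity) (by positivity)]
    have h1 : l ^ 3 ≤ (3 * lg) ^ 3 := by gcongr
    have h2 : (0.69 : ℝ) ^ 3 ≤ lg ^ 3 := by gcongr
    -- Uses `65536 * 27 ≤ 4096 ^ 2 * 0.69 ^ 3`: a surplus power of the logarithm is bounded below by
    -- a constant.
    have h3 : l ^ 3 * 65536 ≤ 4096 ^ 2 * (lg ^ 3) ^ 2 := by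
      have : 0 < lg ^ 3 := by positivity
      nlinarith
    calc (1 / 4096) ^ 2 * (65536 * d * l ^ 3) = (1 / 4096) ^ 2 * d * (l ^ 3 * 65536) := by ring
      _ ≤ (1 / 4096) ^ 2 * d * (4096 ^ 2 * (lg ^ 3) ^ 2) := by gcongr
      _ = _ := by ring
  · rw [l2norm, Real.sqrt_le_left (by positivity)]
    refine hup.trans ?_
    have hrp : (lg ^ (7 / 2 : ℝ)) ^ 2 = lg ^ 7 := by
      rw [← Real.rpow_natCast, ← Real.rpow_mul hlg0.le, ← Real.rpow_natCast]
      norm_num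
    rw [mul_pow, mul_pow, mul_pow, mul_pow, Real.sq_sqrt hC.le, hrp]
    refine mul_le_mul_of_nonneg_right ?_ (sq_nonneg N)
    have h1 : l ^ 2 ≤ (3 * lg) ^ 2 := by gcongr
    have h2 : (0.69 : ℝ) ^ 5 ≤ lg ^ 5 := by gcongr
    -- Uses `25600 * 9 ≤ 2000 ^ 2 * 0.69 ^ 5`.
    have h3 : 25600 * l ^ 2 ≤ 2000 ^ 2 * lg ^ 7 := by
      have e : lg ^ 7 = lg ^ 5 * lg ^ 2 := by ring
      have : 0 < lg ^ 2 := by positivity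
      rw [e]
      nlinarith
    have h4 : d ^ 3 ≤ d ^ 4 := pow_le_pow_right₀ hd (by norm_num)
    calc 25600 * C * d ^ 3 * l ^ 2 = C * d ^ 3 * (25600 * l ^ 2) := by ring
      _ ≤ C * d ^ 4 * (2000 ^ 2 * lg ^ 7) := by gcongr
      _ = _ := by ring

theorem corollary6 :
    -- `P` is the program that computes `S * A`; `K₀`, `c`, `C` are absolute constants, and
    -- `B`, `k` depend only on the upper bound `K₁` for the constants in the sketch dimensions
    ∃ (P : Program) (K₀ c C : ℝ), 0 < K₀ ∧ 0 < c ∧ 0 < C ∧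
      ∀ K₁ : ℝ, K₀ ≤ K₁ → ∃ (B : ℝ) (k : ℕ), 0 < B ∧
        ∀ (G : ℝ → ℝ) (C_G : ℝ), OrliczAssumption G C_G →
        ∀ n d m₁ m₂ : ℕ, 2 ≤ n → 1 ≤ d →
          K₀ * ((d : ℝ) ^ 2 / (1 / 10) ^ 2) ≤ (m₁ : ℝ) →
          (m₁ : ℝ) ≤ K₁ * ((d : ℝ) ^ 2 / (1 / 10) ^ 2) →
          K₀ * ((d : ℝ) / (1 / 10) ^ 2) ≤ (m₂ : ℝ) →
          (m₂ : ℝ) ≤ K₁ * ((d : ℝ) / (1 / 10) ^ 2) →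
        ∀ A : Matrix (Fin n) (Fin d) ℝ,
          -- with probability at least `0.9`, contraction and dilation for all `x`
          ENNReal.ofReal (9 / 10) ≤ sketchLaw n m₁ m₂
            {ω | ∀ x : Fin d → ℝ,
              c / (Real.sqrt (d : ℝ) * Real.log (n : ℝ) ^ 3) * orliczNorm G (A.mulVec x)
                ≤ l2norm ((symSketch G ω * A).mulVec x) ∧
              l2norm ((symSketch G ω * A).mulVec x)
                ≤ C * (Real.sqrt C_G * (d : ℝ) ^ 2 * Real.log (n : ℝ) ^ (7 / 2 : ℝ))
                    * orliczNorm G (A.mulVec x)} ∧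
          -- running time, for every order in which the nonzero entries of `A` are listed
          ∀ L : List (Fin n × Fin d), L.Nodup → (∀ p, p ∈ L ↔ A p.1 p.2 ≠ 0) →
            ∃ T : SketchSample n m₁ m₂ → ℕ, Measurable T ∧
              (∀ ω, ∃ s : RamState,
                Exec P (initialState G A L ω) (T ω) s ∧ HasOutput s (symSketch G ω * A)) ∧
              (∀ ω, (T ω : ℝ) ≤ B * ((nnz A : ℝ) * Real.log (n : ℝ) + (d : ℝ) ^ k)) ∧
              ∫⁻ ω, (T ω : ℝ≥0∞) ∂(sketchLaw n m₁ m₂)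
                ≤ ENNReal.ofReal (B * ((nnz A : ℝ) + (d : ℝ) ^ k)) := by
  -- `K₀ / ε² = 100000` is what the Gaussian embedding asks for; CountSketch would need only `320 *
  -- d ^ 2` rows.
  refine ⟨sketchProgram, 1000, 1 / 4096, 2000, by norm_num, by norm_num, by norm_num,
    fun K₁ _ => ⟨60 + 200000 * K₁ ^ 2, 4, by positivity, ?_⟩⟩
  intro G C hG n d m₁ m₂ hn hd hl₁ hu₁ hl₂ hu₂ A
  have hd1 : (1 : ℝ) ≤ d := by exact_mod_cast hd
  have hm₁ : 100000 * (d : ℝ) ^ 2 ≤ m₁ := (le_of_eq (by ring)).trans hl₁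
  have hm₂ : 100000 * (d : ℝ) ≤ m₂ := (le_of_eq (by ring)).trans hl₂
  have hp₁ : 0 < m₁ := by
    have : (0 : ℝ) < m₁ := by nlinarith
    exact_mod_cast this
  have hp₂ : 0 < m₂ := by
    have : (0 : ℝ) < m₂ := by linarith
    exact_mod_cast this
  refine ⟨?_, fun L hL hA => sketchProgram_spec hn hd hp₁ hp₂ hu₁ hu₂ hL hA⟩
  have : NeZero m₁ := ⟨hp₁.ne'⟩
  -- Three contraction failures of `1/40` each and a dilation failure of `1/80` total `7/80`, below
  -- `1/10`.
  have hbad := (measure_union_le _ _).trans (add_le_add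
    (sketchLaw_contraction hG hn hd (by nlinarith) hm₂ A (m₁ := m₁))
    (sketchLaw_dilation hG hn hd hp₂ A (m₁ := m₁)))
  rw [← ENNReal.ofReal_add (by norm_num) (by norm_num)] at hbad
  refine ofReal_le_measure_of_compl (by norm_num) (hbad.trans (ENNReal.ofReal_le_ofReal
    (by norm_num : (3 / 40 + 1 / 80 : ℝ) ≤ 1 - 9 / 10))) ?_
  intro ω hω x
  simp only [Set.mem_union, not_or, Set.mem_ofPred_eq, not_not] at hω
  have hN : 0 ≤ orliczNorm G (A.mulVec x) := by
    by_cases hx : A.mulVec x = 0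
    · simp [hx, orliczNorm]
    · exact (orliczNorm_pos hG hx).le
  exact distortion_of_sq hd1 hG.const_pos hN (by
    have : Real.log 2 ≤ Real.log n := Real.log_le_log (by norm_num) (by exact_mod_cast hn)
    linarith [Real.log_two_gt_d9]) (by exact_mod_cast Nat.succ_pos (numLevels n))
    (numLevels_add_one_le_log hn) (hω.1 x) (hω.2 x)
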